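/- All point sets are finite subsets of the Euclidean plane in general position (no three points collinear). For a point set $P$, let $\operatorname{CH}(P)\subseteq P$ be the set of vertices of its convex hull. An edge of $P$ is a segment with two distinct endpoints in $P$, and a triangulation of $P$ is a maximal set of edges of $P$ that pairwise intersect at most in common endpoints. A bijection $f_0\colon \operatorname{CH}(P)\to\operatorname{CH}(Q)$ is called cyclic if, for all $p_1,p_2\in\operatorname{CH}(P)$, the segment $p_1p_2$ is an edge of the convex hull of $P$ if and only if $f_0(p_1)f_0(p_2)$ is an edge of the convex hull of $Q$. A point set $P$ is universal if for every point set $Q$ with $|P|=|Q|$ and every cyclic bijection $f_0\colon\operatorname{CH}(P)\to\operatorname{CH}(Q)$ (so that $|\operatorname{CH}(P)|=|\operatorname{CH}(Q)|$) there are a bijection $f\colon P\to Q$ extending $f_0$, a triangulation $T_P$ of $P$ and a triangulation $T_Q$ of $Q$ such that, for all $p_1,p_2\in P$, $p_1p_2\in T_P$ if and only if $f(p_1)f(p_2)\in T_Q$. Let $n\ge 3$ and let $c_1,\dots,c_n$ be nonnegative integers. A $(c_1,\dots,c_n)$-generalized double circle is a point set $P$ with exactly $n+\sum_{i=1}^n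 c_i$ points, consisting of points $P_1,\dots,P_n$ and $A_{i,j}$ ($1\le i\le n$, $1\le j\le c_i$), such that (indices of the $P_i$ being taken modulo $n$) - $\operatorname{CH}(P)=\{P_1,\dots,P_n\}$, and $P_iP_{i+1}$ is an edge of the convex hull of $P$ for each $i$; - for each $i$, the polygon $P_iA_{i,1}A_{i,2}\dots A_{i,c_i}P_{i+1}$ is convex, with its vertices in this order (no condition if $c_i=0$); - every edge of the closed cycle formed by the chains $P_iA_{i,1}A_{i,2}\dots A_{i,c_i}P_{i+1}$, $i=1,\dots,n$, belongs to every triangulation of $P$. Theorem. For all $n\ge 3$ and all nonnegative integers $c_1,\dots,c_n$, every $(c_1,\dots,c_n)$-generalized double circle is universal. -/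

import Mathlib

namespace PointSet

/-- The Euclidean plane. A point set is a `Finset Plane`. -/
abbrev Plane : Type := EuclideanSpace ℝ (Fin 2)

/-- No three distinct points of `P` are collinear. -/
def GeneralPosition (P : Finset Plane) : Prop :=
  ∀ a ∈ P, ∀ b ∈ P, ∀ c ∈ P, a ≠ b → a ≠ c → b ≠ c → ¬ Collinear ℝ ({a, b, c} : Set Plane)

/-- The points of `P` on the convex hull: the vertices (extreme points) of its convex hull. -/
def hullVertices (P : Finset Plane) : Set Plane :=
  (convexHull ℝ (P : Set Plane)).extremePoints ℝ

/-- `p q` is an edge of the convex hull of `P`: two distinct hull vertices whose connecting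
segment runs along the boundary of the hull. -/
def IsHullEdge (P : Finset Plane) (p q : Plane) : Prop :=
  p ∈ hullVertices P ∧ q ∈ hullVertices P ∧ p ≠ q ∧
    segment ℝ p q ⊆ frontier (convexHull ℝ (P : Set Plane))

/-- A set of edges of `P` (straight segments with two distinct endpoints in `P`, recorded as a
graph on the plane) that are pairwise non-intersecting: two different edges have at most common
endpoints in common. -/
def IsNonCrossing (P : Finset Plane) (T : SimpleGraph Plane) : Prop :=
  (∀ a b, T.Adj a b → a ∈ P ∧ b ∈ P) ∧
  ∀ a b c d, T.Adj a b → T.Adj c d → s(a, b) ≠ s(c, d) →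
    segment ℝ a b ∩ segment ℝ c d ⊆ ({a, b} ∩ {c, d} : Set Plane)

/-- A triangulation of `P`: a maximal set of non-intersecting edges of `P`. -/
def IsTriangulation (P : Finset Plane) (T : SimpleGraph Plane) : Prop :=
  Maximal (IsNonCrossing P) T

/-- `(TP, TQ)` is a compatible triangulation of `(P, Q)` with respect to the bijection `f`. -/
def IsCompatibleTriangulation {P Q : Finset Plane} (f : P ≃ Q) (TP TQ : SimpleGraph Plane) :
    Prop :=
  IsTriangulation P TP ∧ IsTriangulation Q TQ ∧
    ∀ p₁ p₂ : P, TP.Adj p₁ p₂ ↔ TQ.Adj (f p₁) (f p₂)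

/-- A bijection between the hull vertices is cyclic if it preserves hull edges in both
directions. -/
def IsCyclicMap {P Q : Finset Plane} (f₀ : hullVertices P ≃ hullVertices Q) : Prop :=
  ∀ p₁ p₂ : hullVertices P, IsHullEdge P p₁ p₂ ↔ IsHullEdge Q (f₀ p₁) (f₀ p₂)

/-- `P` is universal: for every point set `Q` in general position with as many points as `P`,
every cyclic bijection of the hull vertices extends to a bijection `P → Q` that admits a
compatible triangulation. -/
def IsUniversal (P : Finset Plane) : Prop :=
  ∀ Q : Finset Plane, GeneralPosition Q → P.card = Q.card →
    ∀ f₀ : hullVertices P ≃ hullVertices Q, IsCyclicMap f₀ →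
      ∃ f : P ≃ Q,
        (∀ (p : P) (hp : (p : Plane) ∈ hullVertices P), (f p : Plane) = f₀ ⟨p, hp⟩) ∧
        ∃ TP TQ : SimpleGraph Plane, IsCompatibleTriangulation f TP TQ

/-- Twice the signed area of the triangle `a b c`: positive if `(a, b, c)` is in counterclockwise
order, negative if it is in clockwise order. -/
def orientation (a b c : Plane) : ℝ :=
  (b 0 - a 0) * (c 1 - a 1) - (b 1 - a 1) * (c 0 - a 0)

/-- The polygon with vertices `q 0, q 1, …` in this order is (strictly) convex: its vertices are
in convex position and listed in counterclockwise, or in clockwise, order. Nothing is required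
of at most two vertices. -/
def IsConvexPolygon {m : ℕ} (q : Fin m → Plane) : Prop :=
  (∀ i j k, i < j → j < k → 0 < orientation (q i) (q j) (q k)) ∨
  (∀ i j k, i < j → j < k → orientation (q i) (q j) (q k) < 0)

/-- The segment `p q` belongs to every triangulation of `P`. -/
def IsUnavoidableEdge (P : Finset Plane) (p q : Plane) : Prop :=
  ∀ T : SimpleGraph Plane, IsTriangulation P T → T.Adj p q

/-- The `i`-th chain `v i, a i 0, …, a i (c i - 1), v (i + 1)`, with `i + 1` taken cyclically. -/
def chain {n : ℕ} (c : Fin n → ℕ) (v : Fin n → Plane) (a : (i : Fin n) → Fin (c i) → Plane)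
    (i : Fin n) : Fin (c i + 2) → Plane :=
  Fin.cons (α := fun _ => Plane) (v i)
    (Fin.snoc (α := fun _ => Plane) (a i) (v (finRotate n i)))

/-- `P` is a `(c 0, …, c (n - 1))`-generalized double circle with hull vertices `v i` and further
points `a i j`. The conditions `hullEdge`, `convex` and `unavoidable` say that the points `a i j`
lie along the hull edge `v i v (i + 1)`, offset so slightly to the inside that nothing can cross
the cycle through all the chains. -/
structure IsGeneralizedDoubleCircleWith {n : ℕ} (c : Fin n → ℕ) (P : Finset Plane)
    (v : Fin n → Plane) (a : (i : Fin n) → Fin (c i) → Plane) : Prop where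
  three_le : 3 ≤ n
  generalPosition : GeneralPosition P
  card_eq : P.card = n + ∑ i, c i
  points : (P : Set Plane) = Set.range v ∪ ⋃ i, Set.range (a i)
  hull : hullVertices P = Set.range v
  hullEdge : ∀ i, IsHullEdge P (v i) (v (finRotate n i))
  convex : ∀ i, IsConvexPolygon (chain c v a i)
  unavoidable : ∀ (i : Fin n) (j : Fin (c i + 1)),
    IsUnavoidableEdge P (chain c v a i j.castSucc) (chain c v a i j.succ)

/-- `P` is a `(c 0, …, c (n - 1))`-generalized double circle. -/
def IsGeneralizedDoubleCircle {n : ℕ} (c : Fin n → ℕ) (P : Finset Plane) : Prop :=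
  ∃ (v : Fin n → Plane) (a : (i : Fin n) → Fin (c i) → Plane),
    IsGeneralizedDoubleCircleWith c P v a

end PointSet

/-!
The triangulations of `P` and `Q` are both described by one list of triangles whose corners are
*labels* of the points of a generalized double circle. The list triangulates the polygon through all
labels in cyclic order, and each pocket between a chain and its hull edge.

In `P` every choice of triangles works. The unavoidable edges are crossed by no segment
(`IsUnavoidableEdge.not_cross`), and this determines orientations: three labels in cyclic order
that are not all on one chain are counterclockwise (`IsDoubleCircleSign.triple_pos`), and three
labels on one chain are clockwise. So it suffices to place the labels in `Q` so that the polygon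
through all points has a triangulation into counterclockwise triangles, none of them with all
corners on one chain, and each pocket has a triangulation into triangles that are clockwise when
listed along the chain.

That a list of triangles gives a triangulation, i.e. a maximal non-crossing graph, is read off from
its boundary. If all triangles are counterclockwise and their boundaries add up to the hull cycle,
as a cycle, then the number of triangles around a point equals the winding number of the hull, which
is at most one, so triangles do not overlap; and a further segment would have to leave the triangle
it starts in through a side, which is a crossing (`IsFilling.isTriangulation`). A simple polygon in
general position always has a triangulation into triangles of the same orientation
(`Fair.exists_tri`).

To place the labels in `Q`, the inner points are first distributed to the hull edges, `c i` of them
to the `i`-th edge, so that the product of the distances of the points from their edges is minimal.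
Since exchanging two points does not decrease the product, segments between points of one class do
not cross segments between points of another (`IsDistribution.not_cross`). Replacing each hull edge
by the upper hull of its class therefore gives a simple polygon
(`IsDistribution.exists_isChainSystem`), whose triangles cannot have all corners on one upper hull
because those are convex in the wrong direction.

The remaining points of each class lie in the pocket of its upper hull and are inserted into the
chain, one class at a time (`IsChainSystem.exists_extension`). Every chain edge is the side of a
triangle of the polygon, whose apex is not on the chain. If a point of the pocket is seen from the
apex through the edge, it can be inserted into the edge, and the triangle is replaced by the fan
from the apex. The points are distributed to the chain edges by cutting the pocket recursively
along lines through a chain vertex, either from an apex or from the start of the chain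
(`IsFanChain.exists_split`); it is used that around a chain vertex the rays from successive apexes
occur in the right order, as otherwise a triangle of the polygon would reach into the pocket
(`IsChainSystem.not_enters`, `Strip.fan`). The points of one edge are sorted around its apex, and
those of different edges are separated by lines, so the new pocket is again a simple polygon.
-/

namespace PointSet

/-! ### Orientation algebra -/

/-- The orientation of `a b c`, multiplied by a sign `σ`; choosing `σ` suitably, the hull of a point
set may be assumed to be traversed counterclockwise. -/
def sar (σ : ℝ) (a b c : Plane) : ℝ := σ * orientation a b c

section Algebra
variable (σ : ℝ)

theorem sar_cyc (a b c : Plane) : sar σ a b c = sar σ b c a := by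
  simp only [sar, orientation]; ring

theorem sar_cyc' (a b c : Plane) : sar σ a b c = sar σ c a b := by
  simp only [sar, orientation]; ring

theorem sar_swap (a b c : Plane) : sar σ b a c = - sar σ a b c := by
  simp only [sar, orientation]; ring

theorem sar_swap' (a b c : Plane) : sar σ a c b = - sar σ a b c := by
  simp only [sar, orientation]; ring

theorem sar_rev (a b c : Plane) : sar σ c b a = - sar σ a b c := by
  simp only [sar, orientation]; ring

@[simp] theorem sar_self_left (a b : Plane) : sar σ a a b = 0 := by
  simp only [sar, orientation]; ring

@[simp] theorem sar_self_right (a b : Plane) : sar σ a b b = 0 := by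
  simp only [sar, orientation]; ring

@[simp] theorem sar_self_outer (a b : Plane) : sar σ a b a = 0 := by
  simp only [sar, orientation]; ring

/-- The Grassmann–Plücker relation with common origin `p`. -/
theorem sar_gp (p u v x y : Plane) :
    sar σ p u v * sar σ p x y = sar σ p u x * sar σ p v y - sar σ p u y * sar σ p v x := by
  simp only [sar, orientation]; ring

/-- The affine functional `sar σ a b`, evaluated in barycentric coordinates with respect to the
triangle `x s y`. -/
theorem sar_bary (a b x s y z : Plane) :
    sar σ x s y * sar σ a b z =
      sar σ z s y * sar σ a b x + sar σ x z y * sar σ a b s + sar σ x s z * sar σ a b y := by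
  simp only [sar, orientation]; ring

theorem sar_neg (a b c : Plane) : sar (-σ) a b c = - sar σ a b c := by
  simp only [sar]; ring

theorem sar_lineMap (a b x y : Plane) (t : ℝ) :
    sar σ a b (AffineMap.lineMap x y t) = (1 - t) * sar σ a b x + t * sar σ a b y := by
  simp only [sar, orientation, AffineMap.lineMap_apply, vsub_eq_sub, vadd_eq_add,
    PiLp.add_apply, PiLp.smul_apply, PiLp.sub_apply, smul_eq_mul]
  ring

theorem continuous_sar (a b : Plane) : Continuous (fun x => sar σ a b x) := by
  unfold sar orientation; fun_prop

end Algebra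

/-- The sign condition on `σ`. -/
def IsSign (σ : ℝ) : Prop := σ = 1 ∨ σ = -1

theorem IsSign.ne_zero {σ : ℝ} (h : IsSign σ) : σ ≠ 0 := by
  rcases h with rfl | rfl <;> norm_num

theorem IsSign.mul_self {σ : ℝ} (h : IsSign σ) : σ * σ = 1 := by
  rcases h with rfl | rfl <;> norm_num

theorem IsSign.neg {σ : ℝ} (h : IsSign σ) : IsSign (-σ) := by
  rcases h with rfl | rfl <;> simp [IsSign]

theorem isSign_one : IsSign 1 := Or.inl rfl

/-- No three distinct points of `S` are collinear, in terms of orientations. -/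
def Generic (S : Set Plane) : Prop :=
  ∀ a ∈ S, ∀ b ∈ S, ∀ c ∈ S, a ≠ b → a ≠ c → b ≠ c → orientation a b c ≠ 0

theorem Generic.mono {S T : Set Plane} (h : Generic T) (hST : S ⊆ T) : Generic S :=
  fun a ha b hb c hc => h a (hST ha) b (hST hb) c (hST hc)

theorem Generic.sar_ne {S : Set Plane} (h : Generic S) {σ : ℝ} (hσ : IsSign σ) {a b c : Plane}
    (ha : a ∈ S) (hb : b ∈ S) (hc : c ∈ S) (hab : a ≠ b) (hac : a ≠ c) (hbc : b ≠ c) :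
    sar σ a b c ≠ 0 :=
  mul_ne_zero hσ.ne_zero (h a ha b hb c hc hab hac hbc)

theorem Generic.pos_or_neg {S : Set Plane} (h : Generic S) {σ : ℝ} (hσ : IsSign σ) {a b c : Plane}
    (ha : a ∈ S) (hb : b ∈ S) (hc : c ∈ S) (hab : a ≠ b) (hac : a ≠ c) (hbc : b ≠ c) :
    0 < sar σ a b c ∨ sar σ a b c < 0 :=
  (h.sar_ne hσ ha hb hc hab hac hbc).symm.lt_or_gt

theorem plane_ext {x y : Plane} (h0 : x 0 = y 0) (h1 : x 1 = y 1) : x = y := by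
  ext i; fin_cases i
  · exact h0
  · exact h1

theorem eq_lineMap_of_orientation_eq_zero {a b c : Plane} (hab : a ≠ b)
    (h : orientation a b c = 0) : ∃ t : ℝ, c = AffineMap.lineMap a b t := by
  unfold orientation at h
  by_cases h0 : b 0 - a 0 = 0
  · have h1 : b 1 - a 1 ≠ 0 := by
      intro h1
      exact hab (plane_ext (by linarith) (by linarith))
    refine ⟨(c 1 - a 1) / (b 1 - a 1), plane_ext ?_ ?_⟩
    · have : (b 1 - a 1) * (c 0 - a 0) = 0 := by rw [h0] at h; linarith
      have : c 0 - a 0 = 0 := by simpa [h1] using this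
      simp [AffineMap.lineMap_apply, h0]; linarith
    · simp [AffineMap.lineMap_apply]; field_simp; ring
  · refine ⟨(c 0 - a 0) / (b 0 - a 0), plane_ext ?_ ?_⟩
    · simp [AffineMap.lineMap_apply]; field_simp; ring
    · simp [AffineMap.lineMap_apply]; field_simp; linarith

theorem GeneralPosition.generic {P : Finset Plane} (hP : GeneralPosition P) :
    Generic (P : Set Plane) := by
  intro a ha b hb c hc hab hac hbc h
  refine hP a ha b hb c hc hab hac hbc ?_
  obtain ⟨t, rfl⟩ := eq_lineMap_of_orientation_eq_zero hab h
  have h1 : Collinear ℝ ({AffineMap.lineMap a b t, a, b} : Set Plane) :=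
    collinear_insert_of_mem_affineSpan_pair (AffineMap.lineMap_mem_affineSpan_pair t a b)
  convert h1 using 1
  ext x; simp; tauto

/-! ### Crossing segments -/

/-- The segments `a b` and `c d` cross properly: each separates the endpoints of the other. -/
def Cross (a b c d : Plane) : Prop :=
  orientation a b c * orientation a b d < 0 ∧ orientation c d a * orientation c d b < 0

theorem cross_iff_sar {σ : ℝ} (hσ : IsSign σ) {a b c d : Plane} :
    Cross a b c d ↔ sar σ a b c * sar σ a b d < 0 ∧ sar σ c d a * sar σ c d b < 0 := by
  have h : ∀ x y : ℝ, σ * x * (σ * y) = x * y := fun x y => by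
    linear_combination (x * y) * hσ.mul_self
  simp only [Cross, sar, h]

theorem Cross.symm {a b c d : Plane} (h : Cross a b c d) : Cross c d a b := ⟨h.2, h.1⟩

theorem Cross.swap_left {a b c d : Plane} (h : Cross a b c d) : Cross b a c d := by
  have e : ∀ x, orientation b a x = - orientation a b x := fun x => by unfold orientation; ring
  refine ⟨?_, ?_⟩
  · rw [e, e]; have := h.1; linarith
  · have := h.2; linarith

theorem Cross.swap_right {a b c d : Plane} (h : Cross a b c d) : Cross a b d c :=
  h.symm.swap_left.symm

theorem not_cross_of_mem {a b c d : Plane} (h : c = a ∨ c = b ∨ d = a ∨ d = b) :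
    ¬ Cross a b c d := by
  intro hc
  have := hc.1
  rcases h with rfl | rfl | rfl | rfl <;>
  · unfold orientation at this
    ring_nf at this
    exact lt_irrefl _ this

theorem Cross.mem_segments {a b c d : Plane} (h : Cross a b c d) :
    ∃ x, x ∈ segment ℝ a b ∧ x ∈ segment ℝ c d := by
  have key : ∀ a b c d : Plane, Cross a b c d →
      AffineMap.lineMap a b (orientation c d a / (orientation c d a - orientation c d b))
        ∈ segment ℝ a b := by
    intro a b c d h
    have h2 := h.2
    rw [segment_eq_image_lineMap]
    refine Set.mem_image_of_mem _ ?_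
    rcases mul_neg_iff.1 h2 with ⟨p, q⟩ | ⟨p, q⟩
    · exact ⟨div_nonneg p.le (by linarith), (div_le_one (by linarith)).2 (by linarith)⟩
    · exact ⟨div_nonneg_of_nonpos p.le (by linarith), (div_le_one_of_neg (by linarith)).2
        (by linarith)⟩
  refine ⟨_, key a b c d h, ?_⟩
  convert key c d a b h.symm using 1
  have h1 := h.2
  have h2 := h.1
  have e1 : orientation c d a - orientation c d b ≠ 0 := by
    rcases mul_neg_iff.1 h1 with ⟨p, q⟩ | ⟨p, q⟩ <;> intro h <;> linarith
  have e2 : orientation a b c - orientation a b d ≠ 0 := by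
    rcases mul_neg_iff.1 h2 with ⟨p, q⟩ | ⟨p, q⟩ <;> intro h <;> linarith
  have e3 : orientation c d a - orientation c d b = -(orientation a b c - orientation a b d) := by
    unfold orientation; ring
  rw [e3]
  apply plane_ext
  · simp only [AffineMap.lineMap_apply, vsub_eq_sub, vadd_eq_add,
      PiLp.add_apply, PiLp.smul_apply, PiLp.sub_apply, smul_eq_mul]
    field_simp
    unfold orientation; ring
  · simp only [AffineMap.lineMap_apply, vsub_eq_sub, vadd_eq_add,
      PiLp.add_apply, PiLp.smul_apply, PiLp.sub_apply, smul_eq_mul]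
    field_simp
    unfold orientation; ring

theorem orientation_lineMap (a b x y : Plane) (t : ℝ) :
    orientation a b (AffineMap.lineMap x y t) =
      (1 - t) * orientation a b x + t * orientation a b y := by
  have := sar_lineMap 1 a b x y t
  simpa [sar] using this

/-- Two segments meeting in a point that is not a common endpoint cross properly. -/
theorem Generic.cross_of_mem {S : Set Plane} (hS : Generic S) {a b c d x : Plane}
    (ha : a ∈ S) (hb : b ∈ S) (hc : c ∈ S) (hd : d ∈ S) (hab : a ≠ b) (hcd : c ≠ d)
    (hne : s(a, b) ≠ s(c, d)) (h1 : x ∈ segment ℝ a b) (h2 : x ∈ segment ℝ c d)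
    (hx : ¬ (x ∈ ({a, b} ∩ {c, d} : Set Plane))) : Cross a b c d := by
  have neg_of : ∀ a b c d : Plane, ∀ t : ℝ, 0 ≤ t → t ≤ 1 → orientation c d a ≠ 0 →
      orientation c d b ≠ 0 → (1 - t) * orientation c d a + t * orientation c d b = 0 →
      orientation c d a * orientation c d b < 0 := by
    intro a b c d t t0 t1 ha hb h
    by_contra hn
    have hp : 0 < orientation c d a * orientation c d b :=
      lt_of_le_of_ne (not_lt.1 hn) (mul_ne_zero ha hb).symm
    have e := congrArg (· * orientation c d a) h
    simp only [zero_mul] at e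
    have q : 0 < orientation c d a * orientation c d a := mul_self_pos.2 ha
    rcases eq_or_lt_of_le t0 with rfl | t0
    · nlinarith
    · nlinarith [mul_pos t0 hp, mul_nonneg (sub_nonneg.2 t1) q.le]
  -- two segments with a common endpoint meet only there
  have share : ∀ a b d x : Plane, a ∈ S → b ∈ S → d ∈ S → a ≠ b → b ≠ d → a ≠ d →
      x ∈ segment ℝ a b → x ∈ segment ℝ b d → x = b := by
    intro a b d x ha hb hd hab hbd had h1 h2
    rw [segment_eq_image_lineMap] at h1 h2
    obtain ⟨t, -, rfl⟩ := h1
    obtain ⟨s, -, hs⟩ := h2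
    have e := congrArg (orientation a b) hs
    rw [orientation_lineMap, orientation_lineMap] at e
    have z1 : orientation a b a = 0 := by unfold orientation; ring
    have z2 : orientation a b b = 0 := by unfold orientation; ring
    rw [z1, z2] at e
    have : s = 0 := by
      have := hS a ha b hb d hd hab had hbd
      simpa [this] using e
    rw [← hs, this]; simp
  rw [segment_eq_image_lineMap] at h1 h2
  by_cases hac : a = c
  · subst hac
    by_cases hbd : b = d
    · subst hbd; exact absurd rfl hne
    · exfalso; apply hx
      have := share b a d x hb ha hd hab.symm hcd hbd (by rw [segment_symm, segment_eq_image_lineMap]; exact h1)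
        (by rw [segment_eq_image_lineMap]; exact h2)
      simp [this]
  by_cases had : a = d
  · subst had
    by_cases hbc : b = c
    · subst hbc; exact absurd Sym2.eq_swap hne
    · exfalso; apply hx
      have := share b a c x hb ha hc hab.symm hcd.symm hbc (by rw [segment_symm, segment_eq_image_lineMap]; exact h1)
        (by rw [segment_symm, segment_eq_image_lineMap]; exact h2)
      simp [this]
  by_cases hbc : b = c
  · subst hbc
    exfalso; apply hx
    have := share a b d x ha hb hd hab hcd had (by rw [segment_eq_image_lineMap]; exact h1)
        (by rw [segment_eq_image_lineMap]; exact h2)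
    simp [this]
  by_cases hbd : b = d
  · subst hbd
    exfalso; apply hx
    have := share a b c x ha hb hc hab hcd.symm hac (by rw [segment_eq_image_lineMap]; exact h1)
        (by rw [segment_symm, segment_eq_image_lineMap]; exact h2)
    simp [this]
  obtain ⟨t, ⟨t0, t1⟩, rfl⟩ := h1
  obtain ⟨s, ⟨s0, s1⟩, hs⟩ := h2
  have z : ∀ p q : Plane, orientation p q p = 0 ∧ orientation p q q = 0 := fun p q => by
    constructor <;> (unfold orientation; ring)
  constructor
  · apply neg_of c d a b s s0 s1 (hS a ha b hb c hc hab hac hbc) (hS a ha b hb d hd hab had hbd)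
    rw [← orientation_lineMap, hs, orientation_lineMap, (z a b).1, (z a b).2]; ring
  · apply neg_of a b c d t t0 t1 (hS c hc d hd a ha hcd (Ne.symm hac) (Ne.symm had))
      (hS c hc d hd b hb hcd (Ne.symm hbc) (Ne.symm hbd))
    rw [← orientation_lineMap, ← hs, orientation_lineMap, (z c d).1, (z c d).2]; ring

/-- In general position, a set of edges is non-crossing if no two of them cross properly. -/
theorem isNonCrossing_iff {P : Finset Plane} (hP : Generic (P : Set Plane))
    {T : SimpleGraph Plane} :
    IsNonCrossing P T ↔ (∀ a b, T.Adj a b → a ∈ P ∧ b ∈ P) ∧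
      ∀ a b c d, T.Adj a b → T.Adj c d → ¬ Cross a b c d := by
  refine and_congr_right fun hT => ⟨fun h a b c d hab hcd hc => ?_, fun h a b c d hab hcd hne x hx => ?_⟩
  · have hne : s(a, b) ≠ s(c, d) := by
      intro e
      refine not_cross_of_mem ?_ hc
      rcases Sym2.eq_iff.1 e with ⟨rfl, rfl⟩ | ⟨rfl, rfl⟩ <;> simp
    obtain ⟨x, hx1, hx2⟩ := hc.mem_segments
    obtain ⟨h3, h4⟩ := h a b c d hab hcd hne ⟨hx1, hx2⟩
    refine not_cross_of_mem ?_ hc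
    simp only [Set.mem_insert_iff, Set.mem_singleton_iff] at h3 h4
    rcases h3 with rfl | rfl <;> rcases h4 with h4 | h4 <;> simp [← h4]
  · by_contra hn
    exact h a b c d hab hcd (hP.cross_of_mem (hT a b hab).1 (hT a b hab).2 (hT c d hcd).1
      (hT c d hcd).2 hab.ne hcd.ne hne hx.1 hx.2 hn)

/-- A segment with both endpoints on one closed side of a line crosses no segment on the other
closed side, unless everything lies on the line. -/
theorem Cross.eq_zero_of_separated {a b c d : Plane} (h : Cross a b c d) (f : Plane → ℝ)
    (hf : ∀ x y t, f (AffineMap.lineMap x y t) = (1 - t) * f x + t * f y)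
    (ha : f a ≤ 0) (hb : f b ≤ 0) (hc : 0 ≤ f c) (hd : 0 ≤ f d) :
    f a = 0 ∧ f b = 0 ∧ f c = 0 ∧ f d = 0 := by
  obtain ⟨x, hx1, hx2⟩ := h.mem_segments
  rw [segment_eq_image_lineMap] at hx1 hx2
  obtain ⟨t, ⟨t0, t1⟩, rfl⟩ := hx1
  obtain ⟨s, ⟨s0, s1⟩, hs⟩ := hx2
  have z : ∀ p q : Plane, orientation p q p = 0 ∧ orientation p q q = 0 := fun p q => by
    constructor <;> (unfold orientation; ring)
  have e := congrArg f hs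
  rw [hf, hf] at e
  have h1 := h.1
  have h2 := h.2
  have hs1 := congrArg (orientation a b) hs
  rw [orientation_lineMap, orientation_lineMap, (z a b).1, (z a b).2] at hs1
  have ht1 := congrArg (orientation c d) hs
  rw [orientation_lineMap, orientation_lineMap, (z c d).1, (z c d).2] at ht1
  have s0' : 0 < s := lt_of_le_of_ne s0 (by rintro rfl; apply h1.ne; have : orientation a b c = 0 := by linarith
                                            rw [this]; ring)
  have s1' : s < 1 := lt_of_le_of_ne s1 (by rintro rfl; apply h1.ne; have : orientation a b d = 0 := by linarith
                                            rw [this]; ring)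
  have t0' : 0 < t := lt_of_le_of_ne t0 (by rintro rfl; apply h2.ne; have : orientation c d a = 0 := by linarith
                                            rw [this]; ring)
  have t1' : t < 1 := lt_of_le_of_ne t1 (by rintro rfl; apply h2.ne; have : orientation c d b = 0 := by linarith
                                            rw [this]; ring)
  have p1 := mul_nonneg (sub_pos.2 s1').le hc
  have p2 := mul_nonneg s0 hd
  have p3 := mul_nonneg (sub_pos.2 t1').le (neg_nonneg.2 ha)
  have p4 := mul_nonneg t0 (neg_nonneg.2 hb)
  have q1 : (1 - s) * f c = 0 := by linarith
  have q2 : s * f d = 0 := by linarith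
  have q3 : (1 - t) * f a = 0 := by linarith
  have q4 : t * f b = 0 := by linarith
  refine ⟨?_, ?_, ?_, ?_⟩
  · exact (mul_eq_zero.1 q3).resolve_left (by linarith)
  · exact (mul_eq_zero.1 q4).resolve_left (by linarith)
  · exact (mul_eq_zero.1 q1).resolve_left (by linarith)
  · exact (mul_eq_zero.1 q2).resolve_left (by linarith)

/-! ### Combinatorial triangulations of polygons -/

/-- `Tri R l`: the polygon whose vertices are listed by `l` (closed up by the edge from the last to
the first entry) can be cut along diagonals into triangles `a k b`, listed in the order of `l`,
all of which satisfy `R`. A list of two points counts as a degenerate polygon without triangles. -/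
inductive Tri {α : Type*} (R : α → α → α → Prop) : List α → Prop
  | edge (a b : α) : Tri R [a, b]
  | tri {A B : List α} {a k b : α} (hA : A.head? = some a) (hB : B.getLast? = some b)
      (h : R a k b) (h₁ : Tri R (A ++ [k])) (h₂ : Tri R (k :: B)) : Tri R (A ++ k :: B)

section Tri
variable {α β : Type*} {R : α → α → α → Prop}

theorem Tri.mono {R' : α → α → α → Prop} {l : List α} (h : Tri R l)
    (hR : ∀ a b c, R a b c → R' a b c) : Tri R' l := by
  induction h with
  | edge a b => exact .edge a b
  | tri hA hB h _ _ ih₁ ih₂ => exact .tri hA hB (hR _ _ _ h) ih₁ ih₂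

/-- The triangles of `Tri R l` have their corners in `l`, in the order of `l`. -/
theorem Tri.sublist {l : List α} (h : Tri R l) :
    Tri (fun a b c => R a b c ∧ List.Sublist [a, b, c] l) l := by
  induction h with
  | edge a b => exact .edge a b
  | @tri A B a k b hA hB h _ _ ih₁ ih₂ =>
    obtain ⟨A', rfl⟩ := List.head?_eq_some_iff.1 hA
    obtain ⟨B', rfl⟩ := List.getLast?_eq_some_iff.1 hB
    refine .tri hA hB ⟨h, ?_⟩ (ih₁.mono fun x y z hh => ⟨hh.1, hh.2.trans ?_⟩)
      (ih₂.mono fun x y z hh => ⟨hh.1, hh.2.trans ?_⟩)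
    · simp only [List.cons_append]
      refine List.Sublist.cons_cons _ (List.Sublist.trans ?_ (List.sublist_append_right _ _))
      exact List.Sublist.cons_cons _ (List.sublist_append_right _ _)
    · exact List.Sublist.append_left (List.Sublist.cons_cons _ (List.nil_sublist _)) _
    · exact List.sublist_append_right _ _

/-- A triangulation of a polygon with listed images comes from one of the preimages. -/
theorem Tri.of_map {f : β → α} {l : List β} (h : Tri R (l.map f)) :
    Tri (fun a b c => R (f a) (f b) (f c)) l := by
  generalize hm : l.map f = m at h
  induction h generalizing l with
  | edge a b =>
    match l, hm with
    | [x, y], _ => exact .edge x y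
  | @tri A B a k b hA hB h _ _ ih₁ ih₂ =>
    obtain ⟨A', B', rfl, rfl, h3⟩ := List.map_eq_append_iff.1 hm
    obtain ⟨k', B'', rfl, rfl, rfl⟩ := List.map_eq_cons_iff.1 h3
    rw [List.head?_map, Option.map_eq_some_iff] at hA
    rw [List.getLast?_map, Option.map_eq_some_iff] at hB
    obtain ⟨a', ha', rfl⟩ := hA
    obtain ⟨b', hb', rfl⟩ := hB
    exact .tri ha' hb' h (ih₁ (by simp)) (ih₂ (by simp))

/-- Gluing a further polygon onto the edge `x y` of a polygon. -/
theorem Tri.graft {l₁ l₂ m : List α} {x y : α} (h : Tri R (l₁ ++ x :: y :: l₂))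
    (hm : Tri R (x :: (m ++ [y]))) : Tri R (l₁ ++ x :: (m ++ y :: l₂)) := by
  generalize hL : l₁ ++ x :: y :: l₂ = L at h
  induction h generalizing l₁ l₂ with
  | edge a b =>
    match l₁, hL with
    | [], hL =>
      simp only [List.nil_append, List.cons.injEq] at hL
      obtain ⟨rfl, rfl, rfl⟩ := hL
      simpa using hm
    | [u], hL => simp at hL
    | u :: v :: w, hL => simp at hL
  | @tri A B a k b hA hB h h₁ h₂ ih₁ ih₂ =>
    rcases List.append_eq_append_iff.1 hL with ⟨c', rfl, hc⟩ | ⟨c', rfl, hc⟩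
    · match c', hc with
      | [], hc =>
        simp only [List.nil_append, List.cons.injEq] at hc
        obtain ⟨rfl, rfl⟩ := hc
        have := ih₂ (l₁ := []) (l₂ := l₂) rfl
        have hB' : (m ++ y :: l₂).getLast? = some b := by
          rw [List.getLast?_append, hB]; rfl
        simp only [List.append_nil] at hA h₁
        exact .tri hA hB' h h₁ this
      | [u], hc =>
        simp only [List.cons_append, List.nil_append, List.cons.injEq] at hc
        obtain ⟨rfl, rfl, rfl⟩ := hc
        have := ih₁ (l₁ := l₁) (l₂ := []) (by simp)
        have := Tri.tri (A := l₁ ++ x :: m) (a := a) (k := y) (b := b) (B := l₂) (R := R) ?_ hB h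
          (by simpa using this) h₂
        · simpa using this
        · cases l₁ <;> simpa using hA
      | u :: v :: w, hc =>
        simp only [List.cons_append, List.cons.injEq] at hc
        obtain ⟨rfl, rfl, rfl⟩ := hc
        have := ih₁ (l₁ := l₁) (l₂ := w ++ [k]) (by simp)
        have := Tri.tri (A := l₁ ++ x :: (m ++ y :: w)) (a := a) (k := k) (b := b) (B := B)
          (R := R) ?_ hB h (by simpa using this) h₂
        · simpa using this
        · cases l₁ <;> simpa using hA
    · match c', hc with
      | [], hc =>
        simp only [List.nil_append, List.cons.injEq] at hc
        obtain ⟨rfl, rfl⟩ := hc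
        have := ih₂ (l₁ := []) (l₂ := l₂) rfl
        have hB' : (m ++ y :: l₂).getLast? = some b := by
          rw [List.getLast?_append, hB]; rfl
        simp only [List.append_nil]
        exact .tri hA hB' h h₁ this
      | u :: w, hc =>
        simp only [List.cons_append, List.cons.injEq] at hc
        obtain ⟨rfl, rfl⟩ := hc
        have := ih₂ (l₁ := k :: w) (l₂ := l₂) rfl
        have hB' : (w ++ x :: (m ++ y :: l₂)).getLast? = some b := by
          rw [← hB]; simp [List.getLast?_append, List.getLast?_cons]
        simpa using Tri.tri hA hB' h h₁ this

/-- The polygon may be listed starting from any of its vertices. -/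
theorem Tri.rotate_one (hR : ∀ a b c, R a b c → R b c a) {a : α} {l : List α}
    (h : Tri R (a :: l)) : Tri R (l ++ [a]) := by
  generalize hL : a :: l = L at h
  induction h generalizing l with
  | edge u v =>
    simp only [List.cons.injEq] at hL
    obtain ⟨rfl, rfl⟩ := hL
    exact .edge _ _
  | @tri A B a' k b hA hB h h₁ h₂ ih₁ ih₂ =>
    obtain ⟨A', rfl⟩ := List.head?_eq_some_iff.1 hA
    simp only [List.cons_append, List.cons.injEq] at hL
    obtain ⟨rfl, rfl⟩ := hL
    have t1 := ih₁ (l := A' ++ [k]) rfl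
    obtain ⟨B', rfl⟩ := List.getLast?_eq_some_iff.1 hB
    have t2 : Tri R (k :: ((B' ++ [b]) ++ [a])) := by
      have := Tri.tri (A := k :: B') (B := [a]) (a := k) (b := a) (k := b) (R := R) rfl rfl
        (hR _ _ _ h) (by simpa using h₂) (.edge _ _)
      simpa using this
    have := Tri.graft (l₁ := A') (l₂ := []) (x := k) (y := a) (by simpa using t1) t2
    simpa using this

theorem Tri.rotate (hR : ∀ a b c, R a b c → R b c a) {A B : List α}
    (h : Tri R (A ++ B)) : Tri R (B ++ A) := by
  induction A generalizing B with
  | nil => simpa using h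
  | cons a A ih =>
    have := Tri.rotate_one hR (a := a) (l := A ++ B) h
    have := ih (B := B ++ [a]) (by simpa using this)
    simpa using this

/-- Every vertex of a triangulated polygon is a corner of a triangle. -/
theorem Tri.exists_mem_triangle {l : List α} (h : Tri R l) (hl : 3 ≤ l.length) {p : α}
    (hp : p ∈ l) : ∃ a b c, R a b c ∧ (p = a ∨ p = b ∨ p = c) := by
  induction h with
  | edge a b => simp at hl
  | @tri A B a k b hA hB h h₁ h₂ ih₁ ih₂ =>
    obtain ⟨A', rfl⟩ := List.head?_eq_some_iff.1 hA
    obtain ⟨B', rfl⟩ := List.getLast?_eq_some_iff.1 hB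
    have hp' : p ∈ a :: A' ++ [k] ∨ p ∈ k :: (B' ++ [b]) := by
      simp only [List.mem_append, List.mem_cons] at hp ⊢
      tauto
    rcases hp' with hp | hp
    · cases A' with
      | nil => exact ⟨a, k, b, h, by simp at hp; tauto⟩
      | cons u A'' => exact ih₁ (by simp) hp
    · cases B' with
      | nil => exact ⟨a, k, b, h, by simp at hp; tauto⟩
      | cons u A'' => exact ih₂ (by simp) hp

/-- Reversing a polygon reverses its triangles. -/
theorem Tri.reverse {R' : α → α → α → Prop} {l : List α} (h : Tri R l)
    (hR : ∀ a b c, R a b c → R' c b a) : Tri R' l.reverse := by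
  induction h with
  | edge a b => exact .edge b a
  | @tri A B a k b hA hB h h₁ h₂ ih₁ ih₂ =>
    have := Tri.tri (A := B.reverse) (B := A.reverse) (a := b) (k := k) (b := a) (R := R')
      (by simpa using hB) (by simpa using hA) (hR _ _ _ h) (by simpa using ih₂) (by simpa using ih₁)
    simpa using this

/-- Decomposition of a triangulated polygon along the triangle on its first edge `x y`. -/
theorem Tri.apex {x y : α} {l : List α}
    (h : Tri R (x :: y :: l)) (hl : l ≠ []) :
    ∃ l₁ o l₂, l = l₁ ++ o :: l₂ ∧ R x y o ∧ Tri R (y :: (l₁ ++ [o])) ∧ Tri R (x :: o :: l₂) := by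
  generalize hL : x :: y :: l = L at h
  induction h generalizing l with
  | edge u v => simp at hL; exact absurd hL.2.2 hl
  | @tri A B a k b hA hB h h₁ h₂ ih₁ ih₂ =>
    obtain ⟨A', rfl⟩ := List.head?_eq_some_iff.1 hA
    simp only [List.cons_append, List.cons.injEq] at hL
    obtain ⟨rfl, hL⟩ := hL
    cases A' with
    | nil =>
      simp only [List.nil_append, List.cons.injEq] at hL
      obtain ⟨rfl, rfl⟩ := hL
      obtain ⟨B', rfl⟩ := List.getLast?_eq_some_iff.1 hB
      exact ⟨B', b, [], rfl, h, h₂, .edge _ _⟩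
    | cons u A'' =>
      simp only [List.cons_append, List.cons.injEq] at hL
      obtain ⟨rfl, rfl⟩ := hL
      obtain ⟨l₁, o, l₂, e, ho, t1, t2⟩ := ih₁ (l := A'' ++ [k]) (by simp) rfl
      rcases List.eq_nil_or_concat l₂ with rfl | ⟨l₂, k', rfl⟩
      · obtain ⟨rfl, h'⟩ := List.append_inj' e rfl
        simp only [List.cons.injEq, and_true] at h'
        obtain rfl := h'
        exact ⟨A'', k, B, rfl, ho, t1, Tri.tri (A := [x]) rfl hB h t2 h₂⟩
      · have e' : A'' ++ [k] = (l₁ ++ o :: l₂) ++ [k'] := by simpa using e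
        obtain ⟨rfl, h'⟩ := List.append_inj' e' rfl
        simp only [List.cons.injEq, and_true] at h'
        obtain rfl := h'
        refine ⟨l₁, o, l₂ ++ k :: B, by simp, ho, t1, ?_⟩
        exact Tri.tri (A := x :: o :: l₂) rfl hB h (by simpa using t2) h₂

/-- A list all of whose ordered triples satisfy `R` is triangulated by a fan. -/
theorem Tri.of_triples {l : List α} (hl : 2 ≤ l.length)
    (h : ∀ a b c, List.Sublist [a, b, c] l → R a b c) : Tri R l := by
  induction l with
  | nil => simp at hl
  | cons a l ih =>
    match l, hl, ih, h with
    | [b], _, _, _ => exact .edge a b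
    | b :: c :: l, _, ih, h =>
      obtain ⟨l', d, e⟩ : ∃ l' d, c :: l = l' ++ [d] :=
        ⟨(c :: l).dropLast, (c :: l).getLast (by simp), (List.dropLast_append_getLast _).symm⟩
      have t2 := ih (by simp) fun x y z hs => h x y z (hs.trans (List.sublist_cons_self _ _))
      refine Tri.tri (A := [a]) (k := b) (B := c :: l) (b := d) rfl (by rw [e]; simp) ?_ (.edge _ _) t2
      refine h _ _ _ ?_
      rw [e]
      exact List.Sublist.cons_cons _ (List.Sublist.cons_cons _ (List.sublist_append_right _ _))

/-! ### Boundaries -/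

/-- The sum of `c` over the consecutive pairs of a list. -/
def pathSum (c : α → α → ℤ) : List α → ℤ
  | [] => 0
  | [_] => 0
  | a :: b :: l => c a b + pathSum c (b :: l)

theorem pathSum_append (c : α → α → ℤ) (A B : List α) (k : α) :
    pathSum c (A ++ k :: B) = pathSum c (A ++ [k]) + pathSum c (k :: B) := by
  induction A with
  | nil => simp [pathSum]
  | cons a A ih =>
    cases A with
    | nil => simp [pathSum]
    | cons b A => simp only [List.cons_append, pathSum] at ih ⊢; rw [ih]; ring

/-- The sum of `c` over the boundary of a triangle. -/
def triSum (c : α → α → ℤ) (t : α × α × α) : ℤ := c t.1 t.2.1 + c t.2.1 t.2.2 + c t.2.2 t.1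

/-- The triangles of a triangulated polygon, and the fact that their boundaries add up to the
boundary of the polygon. -/
theorem Tri.exists_list {l : List α} (h : Tri R l) :
    ∃ F : List (α × α × α), (∀ t ∈ F, R t.1 t.2.1 t.2.2) ∧
      Tri (fun a b c => (a, b, c) ∈ F) l ∧
      ∀ c : α → α → ℤ, (∀ x y, c y x = - c x y) → ∀ a ∈ l.head?, ∀ b ∈ l.getLast?,
        (F.map (triSum c)).sum = pathSum c l + c b a := by
  induction h with
  | edge a b =>
    refine ⟨[], by simp, .edge a b, fun c hc x hx y hy => ?_⟩
    simp at hx hy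
    subst hx hy
    simp [pathSum, hc a b]
  | @tri A B a k b hA hB h h₁ h₂ ih₁ ih₂ =>
    obtain ⟨F₁, hF₁, t₁, s₁⟩ := ih₁
    obtain ⟨F₂, hF₂, t₂, s₂⟩ := ih₂
    refine ⟨(a, k, b) :: (F₁ ++ F₂), ?_, ?_, ?_⟩
    · intro t ht
      simp only [List.mem_cons, List.mem_append] at ht
      rcases ht with rfl | ht | ht
      exacts [h, hF₁ t ht, hF₂ t ht]
    · exact .tri hA hB (by simp) (t₁.mono fun _ _ _ hh => by simp [hh])
        (t₂.mono fun _ _ _ hh => by simp [hh])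
    · intro c hc x hx y hy
      obtain ⟨A', rfl⟩ := List.head?_eq_some_iff.1 hA
      obtain ⟨B', rfl⟩ := List.getLast?_eq_some_iff.1 hB
      simp only [List.cons_append, List.head?_cons, Option.mem_def, Option.some.injEq] at hx
      have hy' : b = y := by
        have : (a :: A' ++ k :: (B' ++ [b])).getLast? = some b := by
          rw [show a :: A' ++ k :: (B' ++ [b]) = (a :: A' ++ k :: B') ++ [b] by simp]
          exact List.getLast?_concat
        rw [this] at hy; simpa using hy
      subst hx hy'
      rw [pathSum_append, List.map_cons, List.map_append, List.sum_cons, List.sum_append,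
        s₁ c hc a (by simp) k List.getLast?_concat, s₂ c hc k (by simp) b (by
          rw [show k :: (B' ++ [b]) = (k :: B') ++ [b] by simp]; exact List.getLast?_concat)]
      simp only [triSum]
      rw [hc a k, hc b k]
      ring

/-- If all ordered triples of a list satisfy `R`, there is a triangulation containing the ear at a
given inner vertex. -/
theorem exists_list_ear {l₁ l₂ : List α} {x y z : α}
    (h : ∀ a b c, List.Sublist [a, b, c] (l₁ ++ x :: y :: z :: l₂) → R a b c) :
    ∃ F : List (α × α × α), (∀ t ∈ F, R t.1 t.2.1 t.2.2) ∧ (x, y, z) ∈ F ∧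
      ∀ c : α → α → ℤ, (∀ x y, c y x = - c x y) → ∀ a ∈ (l₁ ++ x :: y :: z :: l₂).head?,
        ∀ b ∈ (l₁ ++ x :: y :: z :: l₂).getLast?,
        (F.map (triSum c)).sum = pathSum c (l₁ ++ x :: y :: z :: l₂) + c b a := by
  have hs : List.Sublist (l₁ ++ x :: z :: l₂) (l₁ ++ x :: y :: z :: l₂) :=
    List.Sublist.append_left (List.Sublist.cons_cons _ (List.sublist_cons_self _ _)) _
  obtain ⟨F, hF, -, hc⟩ := (Tri.of_triples (l := l₁ ++ x :: z :: l₂) (R := R)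
    (by simp only [List.length_append, List.length_cons]; omega)
    fun a b c h' => h a b c (h'.trans hs)).exists_list
  refine ⟨(x, y, z) :: F, ?_, by simp, fun c hcc a ha b hb => ?_⟩
  · intro t ht
    rcases List.mem_cons.1 ht with rfl | ht
    · exact h _ _ _ ((List.Sublist.cons_cons _ (List.Sublist.cons_cons _
        (List.Sublist.cons_cons _ (List.nil_sublist _)))).trans (List.sublist_append_right _ _))
    · exact hF t ht
  · rw [List.map_cons, List.sum_cons, hc c hcc a (by cases l₁ <;> simpa using ha) b (by
      rw [List.getLast?_append] at hb ⊢; simpa [List.getLast?_cons] using hb),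
      pathSum_append, pathSum_append c l₁ (y :: z :: l₂)]
    simp only [triSum, pathSum, hcc x z]
    ring

end Tri

/-- A function on the plane of the form `p x + q y + r`. -/
def IsAffine (f : Plane → ℝ) : Prop := ∃ p q r : ℝ, ∀ y, f y = p * y 0 + q * y 1 + r

theorem IsAffine.lineMap {f : Plane → ℝ} (hf : IsAffine f) (x y : Plane) (t : ℝ) :
    f (AffineMap.lineMap x y t) = (1 - t) * f x + t * f y := by
  obtain ⟨p, q, r, h⟩ := hf
  simp only [h, AffineMap.lineMap_apply, vsub_eq_sub, vadd_eq_add,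
    PiLp.add_apply, PiLp.smul_apply, PiLp.sub_apply, smul_eq_mul]
  ring

theorem isAffine_sar (σ : ℝ) (a b : Plane) : IsAffine (sar σ a b) :=
  ⟨-σ * (b 1 - a 1), σ * (b 0 - a 0), σ * ((b 1 - a 1) * a 0 - (b 0 - a 0) * a 1), fun y => by
    simp only [sar, orientation]; ring⟩

theorem IsAffine.add {f g : Plane → ℝ} (hf : IsAffine f) (hg : IsAffine g) :
    IsAffine (fun y => f y + g y) := by
  obtain ⟨p, q, r, h⟩ := hf
  obtain ⟨p', q', r', h'⟩ := hg
  exact ⟨p + p', q + q', r + r', fun y => by simp only [h, h']; ring⟩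

theorem IsAffine.const_mul {f : Plane → ℝ} (hf : IsAffine f) (s : ℝ) :
    IsAffine (fun y => s * f y) := by
  obtain ⟨p, q, r, h⟩ := hf
  exact ⟨s * p, s * q, s * r, fun y => by simp only [h]; ring⟩

/-- Seen from a point `v` on the line `f = 0`, the orientations of points `a`, `b`, `c` are related
by their distances from the line. -/
theorem IsAffine.sar_relation {f : Plane → ℝ} (hf : IsAffine f) (σ : ℝ) {v : Plane}
    (hv : f v = 0) (a b c : Plane) :
    f b * sar σ v a c = f a * sar σ v b c + f c * sar σ v a b := by
  obtain ⟨p, q, r, h⟩ := hf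
  rw [h] at hv
  obtain rfl : r = - (p * v 0 + q * v 1) := by linarith
  simp only [h, sar, orientation]
  ring

/-- Around a point on the boundary of a half-plane, the angular order of the points in the open
half-plane is transitive. -/
theorem IsAffine.sar_trans {f : Plane → ℝ} (hf : IsAffine f) {σ : ℝ} {v : Plane}
    (hv : f v = 0) {a b c : Plane} (ha : 0 < f a) (hb : 0 < f b) (hc : 0 < f c)
    (h₁ : 0 < sar σ v a b) (h₂ : 0 < sar σ v b c) : 0 < sar σ v a c := by
  have := hf.sar_relation σ hv a b c
  have h3 : 0 < f b * sar σ v a c := by rw [this]; positivity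
  exact (mul_pos_iff_of_pos_left hb).1 h3

/-- If all triangles of a polygon are positively oriented, then so is its corner at a vertex `v`
that lies strictly on one side of all others. -/
theorem Tri.sar_head_pos {f : Plane → ℝ} (hf : IsAffine f) {σ : ℝ} {v : Plane} (hv : f v = 0)
    {l : List Plane} (h : Tri (fun a b c => 0 < sar σ a b c) (v :: l)) (hpos : ∀ x ∈ l, 0 < f x)
    (hl : 2 ≤ l.length) : ∀ a ∈ l.head?, ∀ b ∈ l.getLast?, 0 < sar σ v a b := by
  generalize hL : v :: l = L at h
  induction h generalizing l with
  | edge a b => simp only [List.cons.injEq] at hL; simp [hL.2] at hl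
  | @tri A B a k b hA hB h h₁ h₂ ih₁ ih₂ =>
    obtain ⟨A', rfl⟩ := List.head?_eq_some_iff.1 hA
    obtain ⟨B', rfl⟩ := List.getLast?_eq_some_iff.1 hB
    simp only [List.cons_append, List.cons.injEq] at hL
    obtain ⟨rfl, rfl⟩ := hL
    intro x hx y hy
    have hy' : b = y := by
      rw [show A' ++ k :: (B' ++ [b]) = (A' ++ k :: B') ++ [b] by simp] at hy
      rw [List.getLast?_concat] at hy; simpa using hy
    subst hy'
    cases A' with
    | nil => simp at hx; subst hx; exact h
    | cons u A'' =>
      simp at hx; subst hx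
      have := ih₁ (l := u :: A'' ++ [k]) (fun z hz => hpos z (by
          simp only [List.mem_append, List.mem_cons] at hz ⊢; tauto)) (by simp) (by simp) u (by simp) k List.getLast?_concat
      exact hf.sar_trans hv (hpos _ (by simp)) (hpos _ (by simp)) (hpos _ (by simp)) this h

/-! ### Simple polygons have triangulations -/

section Edges
variable {α : Type*}

/-- `x`, `y` are consecutive entries of a list. -/
def PEdge : List α → α → α → Prop
  | a :: b :: l, x, y => (x = a ∧ y = b) ∨ PEdge (b :: l) x y
  | _, _, _ => False

@[simp] theorem pEdge_nil (x y : α) : ¬ PEdge [] x y := by simp [PEdge]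
@[simp] theorem pEdge_singleton (a x y : α) : ¬ PEdge [a] x y := by simp [PEdge]
@[simp] theorem pEdge_cons_cons (a b : α) (l : List α) (x y : α) :
    PEdge (a :: b :: l) x y ↔ (x = a ∧ y = b) ∨ PEdge (b :: l) x y := Iff.rfl

theorem pEdge_append (A B : List α) (x y : α) :
    PEdge (A ++ B) x y ↔
      PEdge A x y ∨ PEdge B x y ∨ (A.getLast? = some x ∧ B.head? = some y) := by
  induction A with
  | nil => simp
  | cons a A ih =>
    cases A with
    | nil =>
      cases B with
      | nil => simp
      | cons b B => simp; tauto
    | cons a' A =>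
      simp only [List.cons_append, pEdge_cons_cons] at ih ⊢
      rw [ih, List.getLast?_cons_cons]
      tauto

theorem PEdge.mem {l : List α} {x y : α} (h : PEdge l x y) : x ∈ l ∧ y ∈ l := by
  induction l with
  | nil => simp at h
  | cons a l ih =>
    cases l with
    | nil => simp at h
    | cons b l =>
      rcases h with ⟨rfl, rfl⟩ | h
      · simp
      · have := ih h
        exact ⟨List.mem_cons_of_mem _ this.1, List.mem_cons_of_mem _ this.2⟩

theorem PEdge.ne {l : List α} (hl : l.Nodup) {x y : α} (h : PEdge l x y) : x ≠ y := by
  induction l with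
  | nil => simp at h
  | cons a l ih =>
    cases l with
    | nil => simp at h
    | cons b l =>
      rcases h with ⟨rfl, rfl⟩ | h
      · rintro rfl; simp at hl
      · exact ih (List.nodup_cons.1 hl).2 h

theorem PEdge.ne_last {l : List α} {u x y : α} (hl : (l ++ [u]).Nodup)
    (h : PEdge (l ++ [u]) x y) : x ≠ u := by
  rintro rfl
  have hx : x ∉ l := by
    intro hx
    exact (List.nodup_append.1 hl).2.2 x hx x (by simp) rfl
  rw [pEdge_append] at h
  rcases h with h | h | ⟨h, -⟩
  · exact hx h.mem.1
  · simp at h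
  · exact hx (List.mem_of_getLast? h)

/-- The edges of the closed polygon with vertex list `l`. -/
def CEdge (l : List α) (x y : α) : Prop :=
  PEdge l x y ∨ (l.getLast? = some x ∧ l.head? = some y)

theorem CEdge.mem {l : List α} {x y : α} (h : CEdge l x y) : x ∈ l ∧ y ∈ l := by
  rcases h with h | ⟨h1, h2⟩
  · exact h.mem
  · exact ⟨List.mem_of_getLast? h1, List.mem_of_head? h2⟩

theorem CEdge.rotate {A B : List α} {x y : α} (h : CEdge (A ++ B) x y) : CEdge (B ++ A) x y := by
  rcases A.eq_nil_or_concat with rfl | ⟨A, a, rfl⟩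
  · simpa using h
  rcases B.eq_nil_or_concat with rfl | ⟨B, b, rfl⟩
  · simpa using h
  have e1 : (A ++ [a] ++ (B ++ [b])).getLast? = some b := by
    rw [← List.append_assoc]; exact List.getLast?_concat
  have e2 : (B ++ [b] ++ (A ++ [a])).getLast? = some a := by
    rw [← List.append_assoc]; exact List.getLast?_concat
  have e3 : (A ++ [a] ++ (B ++ [b])).head? = (A ++ [a]).head? := by
    cases A <;> simp
  have e4 : (B ++ [b] ++ (A ++ [a])).head? = (B ++ [b]).head? := by
    cases B <;> simp
  simp only [List.concat_eq_append] at h ⊢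
  rw [CEdge, pEdge_append, e1, e3] at h
  rw [CEdge, pEdge_append, e2, e4]
  rw [List.getLast?_concat] at h ⊢
  tauto

end Edges

/-- The edges of the closed polygon `l` do not cross. -/
def Fair (l : List Plane) : Prop := ∀ a b c d, CEdge l a b → CEdge l c d → ¬ Cross a b c d

theorem Fair.rotate {A B : List Plane} (h : Fair (A ++ B)) : Fair (B ++ A) :=
  fun a b c d h1 h2 => h a b c d h1.rotate h2.rotate

theorem IsAffine.bary {f : Plane → ℝ} (hf : IsAffine f) (σ : ℝ) (x s y z : Plane) :
    sar σ x s y * f z = sar σ z s y * f x + sar σ x z y * f s + sar σ x s z * f y := by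
  obtain ⟨p, q, r, h⟩ := hf
  simp only [h, sar, orientation]
  ring

theorem sar_sum (σ : ℝ) (x s y z : Plane) :
    sar σ x s y = sar σ z s y + sar σ x z y + sar σ x s z := by
  simp only [sar, orientation]; ring

/-- Among finitely many points, a linear functional attains its minimum only once, for a suitable
choice of the functional. -/
theorem exists_extreme (l : List Plane) (hl : l ≠ []) :
    ∃ v ∈ l, ∃ f, IsAffine f ∧ f v = 0 ∧ ∀ x ∈ l, x ≠ v → 0 < f x := by
  classical
  set bad : Set ℝ := (fun t : Plane × Plane => (t.2 0 - t.1 0) / (t.1 1 - t.2 1)) ''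
    ({x | x ∈ l} ×ˢ {x | x ∈ l})
  have hbad : bad.Finite := ((List.finite_toSet l).prod (List.finite_toSet l)).image _
  obtain ⟨δ, hδ⟩ := hbad.infinite_compl.nonempty
  obtain ⟨v, hv, hmin⟩ := l.toFinset.exists_min_image (fun x => x 0 + δ * x 1)
    (by simpa using hl)
  refine ⟨v, by simpa using hv, fun x => (x 0 + δ * x 1) - (v 0 + δ * v 1),
    ⟨1, δ, -(v 0 + δ * v 1), fun y => by ring⟩, by simp, fun x hx hxv => ?_⟩
  have h1 := hmin x (by simpa using hx)
  refine lt_of_le_of_ne (by simpa using h1) fun h => ?_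
  have h2 : (x 0 - v 0) + δ * (x 1 - v 1) = 0 := by simp only at h; linarith
  by_cases h3 : x 1 - v 1 = 0
  · exact hxv (plane_ext (by rw [h3] at h2; linarith) (by linarith))
  · refine hδ ⟨(x, v), ⟨hx, by simpa using hv⟩, ?_⟩
    simp only
    rw [div_eq_iff h3]; linarith

/-- A segment `c d` that leaves the closed left side of the line `a b`, and whose line separates `a` from
`b`, meets the segment `a b`. -/
theorem exists_lineMap_eq {a b c d : Plane} {σ : ℝ} (h1 : 0 ≤ sar σ a b c)
    (h2 : sar σ a b d < 0) (h3 : sar σ c d a * sar σ c d b < 0) :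
    ∃ s t : ℝ, 0 ≤ s ∧ s < 1 ∧ 0 ≤ t ∧ t ≤ 1 ∧
      AffineMap.lineMap c d s = (AffineMap.lineMap a b t : Plane) := by
  have e1 : 0 < sar σ a b c - sar σ a b d := by linarith
  have e3 : sar σ c d a - sar σ c d b = -(sar σ a b c - sar σ a b d) := by
    simp only [sar, orientation]; ring
  refine ⟨sar σ a b c / (sar σ a b c - sar σ a b d), sar σ c d a / (sar σ c d a - sar σ c d b),
    div_nonneg h1 e1.le, (div_lt_one e1).2 (by linarith), ?_, ?_, ?_⟩
  · rcases mul_neg_iff.1 h3 with ⟨p, q⟩ | ⟨p, q⟩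
    · exact div_nonneg p.le (by linarith)
    · exact div_nonneg_of_nonpos p.le (by linarith)
  · rcases mul_neg_iff.1 h3 with ⟨p, q⟩ | ⟨p, q⟩
    · exact (div_le_one (by linarith)).2 (by linarith)
    · exact (div_le_one_of_neg (by linarith)).2 (by linarith)
  · rw [e3]
    have e1' := e1.ne'
    apply plane_ext <;>
    · simp only [AffineMap.lineMap_apply, vsub_eq_sub, vadd_eq_add,
        PiLp.add_apply, PiLp.smul_apply, PiLp.sub_apply, smul_eq_mul]
      field_simp
      simp only [sar, orientation]; ring

/-- A segment `a b` through a point `y` of the triangle `v w u` that starts outside the triangle,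
on the inner side of `w u`, enters the triangle through `v w` or `u v`. -/
theorem cross_of_enter {S : Set Plane} (hS : Generic S) {σ : ℝ} (hσ : IsSign σ)
    {v w u a b : Plane} (hv : v ∈ S) (hw : w ∈ S) (hu : u ∈ S) (ha : a ∈ S) (hb : b ∈ S)
    (hab : a ≠ b) (hva : v ≠ a) (hvb : v ≠ b) (h : 0 < sar σ v w u) {t : ℝ} (ht0 : 0 ≤ t)
    (ht1 : t ≤ 1) (h1 : 0 < sar σ v w (AffineMap.lineMap a b t))
    (h2 : 0 < sar σ u v (AffineMap.lineMap a b t)) (h3 : 0 ≤ sar σ w u (AffineMap.lineMap a b t))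
    (h4 : 0 < sar σ w u a) (h5 : ¬ (0 < sar σ v w a ∧ 0 < sar σ u v a)) :
    Cross v w a b ∨ Cross u v a b := by
  have hvw : v ≠ w := by rintro rfl; simp at h
  have hwu : w ≠ u := by rintro rfl; simp at h
  have hvu : v ≠ u := by rintro rfl; simp at h
  have haw : a ≠ w := by rintro rfl; simp at h4
  have hau : a ≠ u := by rintro rfl; simp at h4
  have hsv : sar σ a b v ≠ 0 := hS.sar_ne hσ ha hb hv hab hva.symm hvb.symm
  have hg1 : sar σ v w a ≠ 0 := hS.sar_ne hσ hv hw ha hvw hva haw.symm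
  have hg2 : sar σ u v a ≠ 0 := hS.sar_ne hσ hu hv ha hvu.symm hau.symm hva
  set y : Plane := AffineMap.lineMap a b t with hy
  have ey : 0 = sar σ w u y * sar σ a b v + sar σ u v y * sar σ a b w +
      sar σ v w y * sar σ a b u := by
    have := sar_bary σ a b v w u y
    rw [show sar σ a b y = 0 by rw [hy, sar_lineMap]; simp, sar_cyc σ y w u, sar_cyc' σ v y u] at this
    linarith
  have ea : 0 = sar σ w u a * sar σ a b v + sar σ u v a * sar σ a b w +
      sar σ v w a * sar σ a b u := by
    have := sar_bary σ a b v w u a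
    rw [sar_self_outer, sar_cyc σ a w u, sar_cyc' σ v a u] at this
    linarith
  have fin1 : sar σ v w a < 0 → 0 < sar σ v w b := fun hn => by
    rw [hy, sar_lineMap] at h1
    by_contra hb'
    have := mul_nonneg ht0 (neg_nonneg.2 (not_lt.1 hb'))
    have := mul_nonneg (sub_nonneg.2 ht1) (neg_nonneg.2 hn.le)
    linarith
  have fin2 : sar σ u v a < 0 → 0 < sar σ u v b := fun hn => by
    rw [hy, sar_lineMap] at h2
    by_contra hb'
    have := mul_nonneg ht0 (neg_nonneg.2 (not_lt.1 hb'))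
    have := mul_nonneg (sub_nonneg.2 ht1) (neg_nonneg.2 hn.le)
    linarith
  -- for either sign `ε` of `v` relative to the line `a b`
  have main : ∀ ε : ℝ, ε = 1 ∨ ε = -1 → 0 < ε * sar σ a b v →
      (sar σ v w a < 0 ∧ ε * sar σ a b w < 0) ∨ (sar σ u v a < 0 ∧ ε * sar σ a b u < 0) := by
    intro ε hε hpos
    have ey' : 0 = sar σ w u y * (ε * sar σ a b v) + sar σ u v y * (ε * sar σ a b w) +
      sar σ v w y * (ε * sar σ a b u) := by linear_combination ε * ey
    have ea' : 0 = sar σ w u a * (ε * sar σ a b v) + sar σ u v a * (ε * sar σ a b w) +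
      sar σ v w a * (ε * sar σ a b u) := by linear_combination ε * ea
    have hnot : ¬ (0 ≤ ε * sar σ a b w ∧ 0 ≤ ε * sar σ a b u) := by
      rintro ⟨q1, q2⟩
      have r1 := mul_nonneg h3 hpos.le
      have r2 := mul_nonneg h2.le q1
      have r3 := mul_nonneg h1.le q2
      have z1 : sar σ u v y * (ε * sar σ a b w) = 0 := by linarith
      have z2 : sar σ v w y * (ε * sar σ a b u) = 0 := by linarith
      have hε0 : ε ≠ 0 := by rcases hε with rfl | rfl <;> norm_num
      have z1 : sar σ a b w = 0 := by simpa [h2.ne', hε0] using z1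
      have z2 : sar σ a b u = 0 := by simpa [h1.ne', hε0] using z2
      have : b = w := by
        by_contra hbw; exact hS.sar_ne hσ ha hb hw hab haw hbw z1
      have : b = u := by
        by_contra hbu; exact hS.sar_ne hσ ha hb hu hab hau hbu z2
      exact hwu (by rw [← this]; exact (Eq.symm ‹b = w›))
    by_contra hcon
    rw [not_or, not_and, not_and, not_lt, not_lt] at hcon
    obtain ⟨c1, c2⟩ := hcon
    have p1 := mul_pos h4 hpos
    rcases lt_or_ge (ε * sar σ a b w) 0 with hw0 | hw0
    · have k1 : 0 < sar σ v w a := by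
        rcases lt_or_gt_of_ne hg1 with k | k
        · exact absurd hw0 (not_lt.2 (c1 k))
        · exact k
      have k2 : sar σ u v a < 0 := by
        rcases lt_or_gt_of_ne hg2 with k | k
        · exact k
        · exact absurd ⟨k1, k⟩ h5
      have k3 := c2 k2
      have := mul_nonneg k1.le k3
      have := mul_pos_of_neg_of_neg k2 hw0
      linarith
    · have hu0 : ε * sar σ a b u < 0 := not_le.1 fun hu0 => hnot ⟨hw0, hu0⟩
      have k1 : 0 < sar σ u v a := by
        rcases lt_or_gt_of_ne hg2 with k | k
        · exact absurd hu0 (not_lt.2 (c2 k))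
        · exact k
      have k2 : sar σ v w a < 0 := by
        rcases lt_or_gt_of_ne hg1 with k | k
        · exact k
        · exact absurd ⟨k, k1⟩ h5
      have := mul_nonneg k1.le hw0
      have := mul_pos_of_neg_of_neg k2 hu0
      linarith
  rcases lt_or_gt_of_ne hsv with hv0 | hv0
  · rcases main (-1) (Or.inr rfl) (by linarith) with ⟨k1, k2⟩ | ⟨k1, k2⟩
    · exact Or.inl ((cross_iff_sar hσ).2 ⟨mul_neg_of_neg_of_pos k1 (fin1 k1),
        mul_neg_of_neg_of_pos hv0 (by linarith)⟩)
    · exact Or.inr ((cross_iff_sar hσ).2 ⟨mul_neg_of_neg_of_pos k1 (fin2 k1),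
        mul_neg_of_pos_of_neg (by linarith) hv0⟩)
  · rcases main 1 (Or.inl rfl) (by linarith) with ⟨k1, k2⟩ | ⟨k1, k2⟩
    · exact Or.inl ((cross_iff_sar hσ).2 ⟨mul_neg_of_neg_of_pos k1 (fin1 k1),
        mul_neg_of_pos_of_neg hv0 (by linarith)⟩)
    · exact Or.inr ((cross_iff_sar hσ).2 ⟨mul_neg_of_neg_of_pos k1 (fin2 k1),
        mul_neg_of_neg_of_pos (by linarith) hv0⟩)

/-- Barycentric coordinates `X` and `V` of two points with respect to a triangle, and the signs `sa`,
`sk`, `sb` of its corners relative to the line through these points: a ray entering through the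
second side leaves through the first or the third. -/
theorem exit_side {D X1 X2 X3 V1 V2 V3 sa sk sb : ℝ} (hD : 0 < D) (hX2 : X2 ≤ 0) (hV2 : 0 ≤ V2)
    (hX : X1 + X2 + X3 = D) (hXs : X1 * sa + X2 * sk + X3 * sb = 0)
    (hVs : V1 * sa + V2 * sk + V3 * sb = 0)
    (hn : ¬ (0 ≤ V1 ∧ 0 ≤ V3)) (hab : sa * sb < 0) (hk : sk ≠ 0) :
    (sa * sk < 0 ∧ 0 ≤ X3 ∧ V3 ≤ 0) ∨ (sk * sb < 0 ∧ 0 ≤ X1 ∧ V1 ≤ 0) := by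
  wlog ha : 0 < sa generalizing sa sk sb
  · have ha' : sa < 0 := lt_of_le_of_ne (not_lt.1 ha) (by rintro rfl; simp at hab)
    have := this (sa := -sa) (sk := -sk) (sb := -sb) (by linarith) (by linarith) (by linarith)
      (neg_ne_zero.2 hk) (by linarith)
    simpa using this
  have hb : sb < 0 := by
    by_contra hb
    exact absurd hab (not_lt.2 (mul_nonneg ha.le (not_lt.1 hb)))
  rcases lt_or_gt_of_ne hk with pk | pk
  · refine Or.inl ⟨mul_neg_of_pos_of_neg ha pk, ?_, ?_⟩
    · by_contra hc
      have h3 := mul_pos_of_neg_of_neg (not_le.1 hc) hb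
      have h2 := mul_nonneg_of_nonpos_of_nonpos hX2 pk.le
      have h1 : X1 ≤ 0 := by
        by_contra h1
        have := mul_pos (not_le.1 h1) ha
        linarith
      linarith [not_le.1 hc]
    · by_contra hc
      refine hn ⟨?_, (not_le.1 hc).le⟩
      by_contra h1
      have := mul_neg_of_neg_of_pos (not_le.1 h1) ha
      have := mul_neg_of_pos_of_neg (not_le.1 hc) hb
      have := mul_nonpos_of_nonneg_of_nonpos hV2 pk.le
      linarith
  · refine Or.inr ⟨mul_neg_of_pos_of_neg pk hb, ?_, ?_⟩
    · by_contra hc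
      have h3 := mul_neg_of_neg_of_pos (not_le.1 hc) ha
      have h2 := mul_nonpos_of_nonpos_of_nonneg hX2 pk.le
      have h1 : X3 ≤ 0 := by
        by_contra h1
        have := mul_neg_of_pos_of_neg (not_le.1 h1) hb
        linarith
      linarith [not_le.1 hc]
    · by_contra hc
      refine hn ⟨(not_le.1 hc).le, ?_⟩
      by_contra h1
      have := mul_pos_of_neg_of_neg (not_le.1 h1) hb
      have := mul_pos (not_le.1 hc) ha
      have := mul_nonneg hV2 pk.le
      linarith

/-- A ray that enters a positively triangulated polygon through the edge from its last to its first
vertex, towards a point `v` outside all triangles, leaves it through another edge. -/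
theorem Tri.exists_exit {f : Plane → ℝ} (hf : IsAffine f) {σ : ℝ} {v x : Plane} (hv : f v = 0)
    {l : List Plane} (h : Tri (fun a b c => 0 < sar σ a b c) l) (hpos : ∀ z ∈ l, 0 < f z)
    (hs : ∀ z ∈ l, sar σ x v z ≠ 0) :
    ∀ p ∈ l.head?, ∀ q ∈ l.getLast?, sar σ q p x ≤ 0 → 0 ≤ sar σ q p v →
      sar σ x v p * sar σ x v q < 0 →
      ∃ a b, PEdge l a b ∧ 0 ≤ sar σ a b x ∧ sar σ a b v ≤ 0 ∧
        sar σ x v a * sar σ x v b < 0 := by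
  induction h with
  | edge a b =>
    intro p hp q hq h1 h2 h3
    simp at hp hq
    subst hp hq
    exact ⟨a, b, by simp, by rw [sar_swap]; linarith, by rw [sar_swap]; linarith, h3⟩
  | @tri A B a k b hA hB h h₁ h₂ ih₁ ih₂ =>
    obtain ⟨A', rfl⟩ := List.head?_eq_some_iff.1 hA
    obtain ⟨B', rfl⟩ := List.getLast?_eq_some_iff.1 hB
    intro p hp q hq h1 h2 h3
    have hp' : a = p := by simpa using hp
    have hq' : b = q := by
      rw [show a :: A' ++ k :: (B' ++ [b]) = (a :: A' ++ k :: B') ++ [b] by simp] at hq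
      rw [List.getLast?_concat] at hq; simpa using hq
    subst hp' hq'
    have sub₁ : ∀ z ∈ a :: A' ++ [k], z ∈ a :: A' ++ k :: (B' ++ [b]) := by
      intro z hz
      rcases List.mem_append.1 hz with hz | hz
      · exact List.mem_append_left _ hz
      · rw [List.mem_singleton.1 hz]; simp
    have hfa := hpos a (by simp)
    have hfk := hpos k (by simp)
    have hfb := hpos b (by simp)
    have bv := hf.bary σ a k b v
    rw [hv] at bv
    have sx := sar_sum σ a k b x
    have sv := sar_sum σ a k b v
    have bx := sar_bary σ x v a k b x
    have bsv := sar_bary σ x v a k b v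
    rw [sar_self_outer] at bx
    rw [sar_self_right] at bsv
    rw [sar_cyc' σ a x b] at bx sx
    rw [sar_cyc' σ a v b] at bv sv bsv
    have hk := hs k (by simp)
    -- `v` is not in the triangle
    have notin : ¬ (0 ≤ sar σ v k b ∧ 0 ≤ sar σ a k v) := by
      rintro ⟨q1, q2⟩
      have r1 := mul_nonneg q1 hfa.le
      have r2 := mul_nonneg h2 hfk.le
      have r3 := mul_nonneg q2 hfb.le
      have z1 : sar σ v k b * f a = 0 := by linarith
      have z2 : sar σ b a v * f k = 0 := by linarith
      have z3 : sar σ a k v * f b = 0 := by linarith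
      have z1 := (mul_eq_zero.1 z1).resolve_right hfa.ne'
      have z2 := (mul_eq_zero.1 z2).resolve_right hfk.ne'
      have z3 := (mul_eq_zero.1 z3).resolve_right hfb.ne'
      linarith
    have e1 : ∀ z, sar σ k a z = - sar σ a k z := fun z => sar_swap σ a k z
    have e2 : ∀ z, sar σ b k z = - sar σ z k b := fun z => by
      rw [sar_rev σ b k z, sar_rev σ z k b]; simp only [sar, orientation]; ring
    -- it suffices to continue in the piece whose edge is crossed
    have left : sar σ x v a * sar σ x v k < 0 → 0 ≤ sar σ a k x → sar σ a k v ≤ 0 →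
        ∃ a' b', PEdge (a :: A' ++ k :: (B' ++ [b])) a' b' ∧ 0 ≤ sar σ a' b' x ∧
          sar σ a' b' v ≤ 0 ∧ sar σ x v a' * sar σ x v b' < 0 := by
      intro q1 q2 q3
      obtain ⟨a', b', hE, hh⟩ := ih₁ (fun z hz => hpos z (sub₁ z hz)) (fun z hz => hs z (sub₁ z hz))
        a (by simp) k List.getLast?_concat (by rw [e1]; linarith) (by rw [e1]; linarith) q1
      refine ⟨a', b', ?_, hh⟩
      rw [show a :: A' ++ k :: (B' ++ [b]) = (a :: A' ++ [k]) ++ (B' ++ [b]) by simp, pEdge_append]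
      exact Or.inl hE
    have right : sar σ x v k * sar σ x v b < 0 → 0 ≤ sar σ x k b → sar σ v k b ≤ 0 →
        ∃ a' b', PEdge (a :: A' ++ k :: (B' ++ [b])) a' b' ∧ 0 ≤ sar σ a' b' x ∧
          sar σ a' b' v ≤ 0 ∧ sar σ x v a' * sar σ x v b' < 0 := by
      intro q1 q2 q3
      obtain ⟨a', b', hE, hh⟩ := ih₂ (fun z hz => hpos z (List.mem_append_right _ hz))
        (fun z hz => hs z (List.mem_append_right _ hz))
        k (by simp) b (by rw [show k :: (B' ++ [b]) = (k :: B') ++ [b] by simp]; exact List.getLast?_concat)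
        (by rw [e2]; linarith) (by rw [e2]; linarith) q1
      refine ⟨a', b', ?_, hh⟩
      rw [pEdge_append]
      exact Or.inr (Or.inl hE)
    rcases exit_side h h1 h2 sx.symm (by linarith) (by linarith) notin h3 hk with
      ⟨q1, q2, q3⟩ | ⟨q1, q2, q3⟩
    · exact left q1 q2 q3
    · exact right q1 q2 q3

theorem Cross.exists_lineMap {a b c d : Plane} (h : Cross a b c d) :
    ∃ s t : ℝ, 0 < s ∧ s < 1 ∧ 0 < t ∧ t < 1 ∧
      AffineMap.lineMap a b s = (AffineMap.lineMap c d t : Plane) := by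
  obtain ⟨x, hx1, hx2⟩ := h.mem_segments
  rw [segment_eq_image_lineMap] at hx1 hx2
  obtain ⟨s, ⟨s0, s1⟩, rfl⟩ := hx1
  obtain ⟨t, ⟨t0, t1⟩, ht⟩ := hx2
  have z : ∀ p q : Plane, orientation p q p = 0 ∧ orientation p q q = 0 := fun p q => by
    constructor <;> (unfold orientation; ring)
  have e1 : orientation c d (AffineMap.lineMap a b s) = 0 := by
    rw [← ht, orientation_lineMap, (z c d).1, (z c d).2]; ring
  have e2 : orientation a b (AffineMap.lineMap c d t) = 0 := by
    rw [ht, orientation_lineMap, (z a b).1, (z a b).2]; ring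
  rw [orientation_lineMap] at e1 e2
  have h1 := h.1
  have h2 := h.2
  refine ⟨s, t, lt_of_le_of_ne s0 ?_, lt_of_le_of_ne s1 ?_, lt_of_le_of_ne t0 ?_,
    lt_of_le_of_ne t1 ?_, ht.symm⟩
  · rintro rfl; rw [show orientation c d a = 0 by linarith] at h2; simp at h2
  · rintro rfl; rw [show orientation c d b = 0 by linarith] at h2; simp at h2
  · rintro rfl; rw [show orientation a b c = 0 by linarith] at h1; simp at h1
  · rintro rfl; rw [show orientation a b d = 0 by linarith] at h1; simp at h1

theorem Fair.of_diagonal {l p : List Plane} (hl : Fair l) (r s : Plane)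
    (hp : ∀ a b, CEdge p a b → CEdge l a b ∨ (a = r ∧ b = s))
    (hrs : ∀ a b, CEdge l a b → ¬ Cross r s a b) : Fair p := by
  intro a b c d h1 h2 hc
  rcases hp a b h1 with h1 | ⟨rfl, rfl⟩ <;> rcases hp c d h2 with h2 | ⟨rfl, rfl⟩
  · exact hl a b c d h1 h2 hc
  · exact hrs a b h1 hc.symm
  · exact hrs c d h2 hc
  · exact not_cross_of_mem (Or.inl rfl) hc

theorem sar_cyc_pos {σ : ℝ} (a b c : Plane) (h : 0 < sar σ a b c) : 0 < sar σ b c a := by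
  rwa [← sar_cyc]

/-- A simple polygon in general position can be triangulated by diagonals, all triangles being
oriented alike. -/
theorem Fair.exists_tri {l : List Plane} (hl : 3 ≤ l.length) (hnd : l.Nodup)
    (hgen : Generic {x | x ∈ l}) (hfair : Fair l) :
    ∃ σ, IsSign σ ∧ Tri (fun a b c => 0 < sar σ a b c) l := by
  induction hn : l.length using Nat.strong_induction_on generalizing l with
  | _ n ih =>
  subst hn
  -- list the polygon starting from an extreme vertex `v`
  obtain ⟨v, hv, f, hf, hfv, hfpos⟩ := exists_extreme l (by rintro rfl; simp at hl)
  obtain ⟨A, B, rfl⟩ := List.append_of_mem hv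
  suffices H : ∃ σ, IsSign σ ∧ Tri (fun a b c => 0 < sar σ a b c) ((v :: B) ++ A) by
    obtain ⟨σ, hσ, h⟩ := H
    exact ⟨σ, hσ, h.rotate sar_cyc_pos⟩
  have hfair := hfair.rotate
  have hnd : (v :: (B ++ A)).Nodup := by
    have : (A ++ v :: B).Perm ((v :: B) ++ A) := List.perm_append_comm
    simpa using this.nodup_iff.1 hnd
  have hmem : ∀ x, x ∈ v :: (B ++ A) → x ∈ A ++ v :: B := by
    intro x hx; simp only [List.mem_cons, List.mem_append] at hx ⊢; tauto
  have hgen : Generic {x | x ∈ v :: (B ++ A)} := hgen.mono fun x hx => hmem x hx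
  have hfpos : ∀ x ∈ B ++ A, 0 < f x := fun x hx =>
    hfpos x (hmem x (List.mem_cons_of_mem _ hx)) (by
      rintro rfl; exact (List.nodup_cons.1 hnd).1 hx)
  have hlen : (A ++ v :: B).length = (B ++ A).length + 1 := by simp; omega
  rw [hlen] at hl ih
  rw [List.cons_append] at hfair ⊢
  clear hmem hlen hv
  generalize B ++ A = m at *
  obtain ⟨w, m', rfl⟩ : ∃ w m', m = w :: m' := by
    cases m with
    | nil => simp at hl
    | cons w m' => exact ⟨w, m', rfl⟩
  rcases m'.eq_nil_or_concat with rfl | ⟨mid, u, rfl⟩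
  · simp at hl
  simp only [List.concat_eq_append] at *
  obtain ⟨hvm, hndm⟩ := List.nodup_cons.1 hnd
  have hwu : w ≠ u := by rintro rfl; simp at hndm
  have hvw : v ≠ w := by rintro rfl; simp at hvm
  have hvu : v ≠ u := by rintro rfl; simp at hvm
  set S : Set Plane := {x | x ∈ v :: w :: (mid ++ [u])} with hS
  have hvS : v ∈ S := by simp [hS]
  have hwS : w ∈ S := by simp [hS]
  have huS : u ∈ S := by simp [hS]
  have hmS : ∀ x ∈ w :: (mid ++ [u]), x ∈ S := fun x hx => List.mem_cons_of_mem _ hx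
  obtain ⟨σ, hσ, hD⟩ : ∃ σ, IsSign σ ∧ 0 < sar σ v w u := by
    rcases hgen.pos_or_neg isSign_one hvS hwS huS hvw hvu hwu with h | h
    · exact ⟨1, isSign_one, h⟩
    · exact ⟨-1, Or.inr rfl, by rw [sar_neg]; linarith⟩
  have hDc : sar σ w u v = sar σ v w u := (sar_cyc σ v w u).symm
  have hPE : ∀ a b, PEdge (w :: (mid ++ [u])) a b → CEdge (v :: w :: (mid ++ [u])) a b :=
    fun a b h => Or.inl (Or.inr h)
  have hvwE : CEdge (v :: w :: (mid ++ [u])) v w := Or.inl (Or.inl ⟨rfl, rfl⟩)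
  have huvE : CEdge (v :: w :: (mid ++ [u])) u v := Or.inr ⟨by
    rw [show v :: w :: (mid ++ [u]) = (v :: w :: mid) ++ [u] by simp]
    exact List.getLast?_concat, rfl⟩
  have hCE : ∀ a b, CEdge (v :: w :: (mid ++ [u])) a b → PEdge (w :: (mid ++ [u])) a b ∨
      (a = v ∧ b = w) ∨ (a = u ∧ b = v) := by
    rintro a b ((⟨rfl, rfl⟩ | h) | ⟨h1, h2⟩)
    · exact Or.inr (Or.inl ⟨rfl, rfl⟩)
    · exact Or.inl h
    · rw [show v :: w :: (mid ++ [u]) = (v :: w :: mid) ++ [u] by simp,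
        List.getLast?_concat] at h1
      simp only [List.head?_cons, Option.some.injEq] at h1 h2
      exact Or.inr (Or.inr ⟨h1.symm, h2.symm⟩)
  -- no edge can enter the triangle `v w u` from outside, except through `w u`
  have K : ∀ a b, (PEdge (w :: (mid ++ [u])) a b ∨ PEdge (w :: (mid ++ [u])) b a) → ∀ t : ℝ,
      0 ≤ t → t ≤ 1 → 0 < sar σ v w (AffineMap.lineMap a b t) →
      0 < sar σ u v (AffineMap.lineMap a b t) → 0 ≤ sar σ w u (AffineMap.lineMap a b t) →
      0 < sar σ w u a → ¬ (0 < sar σ v w a ∧ 0 < sar σ u v a) → False := by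
    intro a b hab t ht0 ht1 h1 h2 h3 h4 h5
    have ha : a ∈ w :: (mid ++ [u]) := hab.elim (fun h => h.mem.1) (fun h => h.mem.2)
    have hb : b ∈ w :: (mid ++ [u]) := hab.elim (fun h => h.mem.2) (fun h => h.mem.1)
    have hne : a ≠ b := hab.elim (fun h => h.ne hndm) (fun h => (h.ne hndm).symm)
    have hva : v ≠ a := by rintro rfl; exact hvm ha
    have hvb : v ≠ b := by rintro rfl; exact hvm hb
    rcases cross_of_enter hgen hσ hvS hwS huS (hmS a ha) (hmS b hb) hne hva hvb hD ht0 ht1 h1 h2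
      h3 h4 h5 with h | h <;> rcases hab with hab | hab
    · exact hfair _ _ _ _ hvwE (hPE _ _ hab) h
    · exact hfair _ _ _ _ hvwE (hPE _ _ hab) h.swap_right
    · exact hfair _ _ _ _ huvE (hPE _ _ hab) h
    · exact hfair _ _ _ _ huvE (hPE _ _ hab) h.swap_right
  by_cases hE : ∃ z ∈ w :: (mid ++ [u]), 0 < sar σ v w z ∧ 0 < sar σ w u z ∧ 0 < sar σ u v z
  · -- split along the diagonal from `v` to the point of the triangle farthest from `w u`
    classical
    obtain ⟨z, hz, hzmax⟩ := ((w :: (mid ++ [u])).toFinset.filter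
      (fun z => 0 < sar σ v w z ∧ 0 < sar σ w u z ∧ 0 < sar σ u v z)).exists_max_image
      (fun z => sar σ w u z) (by
        obtain ⟨z, hz, h⟩ := hE
        exact ⟨z, by rw [Finset.mem_filter, List.mem_toFinset]; exact ⟨hz, h⟩⟩)
    rw [Finset.mem_filter, List.mem_toFinset] at hz
    obtain ⟨hzm, hz1, hz2, hz3⟩ := hz
    have hzw : z ≠ w := by rintro rfl; simp at hz1
    have hzu : z ≠ u := by rintro rfl; simp at hz2
    have hvz : ∀ a b, CEdge (v :: w :: (mid ++ [u])) a b → ¬ Cross v z a b := by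
      intro a b hab hc
      rcases hCE a b hab with hab | ⟨rfl, rfl⟩ | ⟨rfl, rfl⟩
      · obtain ⟨s, t, s0, s1, t0, t1, e⟩ := hc.exists_lineMap
        have y1 : 0 < sar σ v w (AffineMap.lineMap a b t) := by
          rw [← e, sar_lineMap, sar_self_outer]; simp only [mul_zero, zero_add]; positivity
        have y2 : 0 < sar σ u v (AffineMap.lineMap a b t) := by
          rw [← e, sar_lineMap, sar_self_right]; simp only [mul_zero, zero_add]; positivity
        have y3 : sar σ w u z < sar σ w u (AffineMap.lineMap a b t) := by
          rw [← e, sar_lineMap, hDc]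
          have := sar_sum σ v w u z
          rw [sar_cyc σ z w u, sar_cyc' σ v z u] at this
          nlinarith [mul_pos (sub_pos.2 s1) (show 0 < sar σ v w u - sar σ w u z by linarith)]
        have out : ∀ c ∈ w :: (mid ++ [u]), sar σ w u z < sar σ w u c →
            ¬ (0 < sar σ v w c ∧ 0 < sar σ u v c) := by
          rintro c hc1 hc2 ⟨hc3, hc4⟩
          have := hzmax c (by
            rw [Finset.mem_filter, List.mem_toFinset]; exact ⟨hc1, hc3, hz2.trans hc2, hc4⟩)
          exact absurd hc2 (not_lt.2 this)
        rcases lt_or_ge (sar σ w u z) (sar σ w u a) with ha | ha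
        · exact K a b (Or.inl hab) t t0.le t1.le y1 y2 (hz2.trans y3).le (hz2.trans ha)
            (out a hab.mem.1 ha)
        · have hb : sar σ w u z < sar σ w u b := by
            rw [sar_lineMap] at y3
            by_contra hb
            nlinarith [mul_nonneg (sub_pos.2 t1).le (sub_nonneg.2 ha),
              mul_nonneg t0.le (sub_nonneg.2 (not_lt.1 hb))]
          rw [← AffineMap.lineMap_apply_one_sub] at y1 y2 y3
          exact K b a (Or.inr hab) (1 - t) (by linarith) (by linarith) y1 y2 (hz2.trans y3).le
            (hz2.trans hb) (out b hab.mem.2 hb)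
      · exact not_cross_of_mem (Or.inl rfl) hc
      · exact not_cross_of_mem (Or.inr (Or.inr (Or.inl rfl))) hc
    obtain ⟨X, Y, hXY⟩ := List.append_of_mem hzm
    obtain ⟨X, rfl⟩ : ∃ X', X = w :: X' := by
      cases X with
      | nil => simp at hXY; exact absurd hXY.1.symm hzw
      | cons w' X' => simp at hXY; exact ⟨X', by rw [hXY.1]⟩
    obtain ⟨Y, rfl⟩ : ∃ Y', Y = Y' ++ [u] := by
      rcases Y.eq_nil_or_concat with rfl | ⟨Y', u', rfl⟩
      · have := congrArg List.getLast? hXY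
        rw [show w :: (mid ++ [u]) = (w :: mid) ++ [u] by simp, List.getLast?_concat,
          List.getLast?_concat] at this
        exact absurd (Option.some.inj this).symm hzu
      · have := congrArg List.getLast? hXY
        rw [show w :: (mid ++ [u]) = (w :: mid) ++ [u] by simp, List.getLast?_concat,
          List.concat_eq_append,
          show w :: X ++ z :: (Y' ++ [u']) = (w :: X ++ z :: Y') ++ [u'] by simp,
          List.getLast?_concat] at this
        exact ⟨Y', by rw [List.concat_eq_append, Option.some.inj this]⟩
    rw [hXY] at hfair hnd hvz hndm hfpos hCE ih ⊢
    have hSeq : S = {x | x ∈ v :: (w :: X ++ z :: (Y ++ [u]))} := by rw [hS, hXY]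
    rw [hSeq] at hgen
    have fair₁ : Fair (v :: (w :: X) ++ [z]) := by
      refine hfair.of_diagonal z v ?_ fun a b h => fun hc => hvz a b h hc.swap_left
      rintro a b (h | ⟨h1, h2⟩)
      · refine Or.inl (Or.inl ?_)
        rw [show v :: (w :: X ++ z :: (Y ++ [u])) = (v :: (w :: X) ++ [z]) ++ (Y ++ [u]) by simp,
          pEdge_append]
        exact Or.inl h
      · rw [List.getLast?_concat] at h1
        simp only [List.cons_append, List.head?_cons, Option.some.injEq] at h1 h2
        exact Or.inr ⟨h1.symm, h2.symm⟩
    have fair₂ : Fair (v :: z :: (Y ++ [u])) := by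
      refine hfair.of_diagonal v z ?_ hvz
      rintro a b ((⟨rfl, rfl⟩ | h) | ⟨h1, h2⟩)
      · exact Or.inr ⟨rfl, rfl⟩
      · refine Or.inl (Or.inl ?_)
        rw [show v :: (w :: X ++ z :: (Y ++ [u])) = (v :: w :: X) ++ (z :: (Y ++ [u])) by simp,
          pEdge_append]
        exact Or.inr (Or.inl h)
      · refine Or.inl (Or.inr ⟨?_, ?_⟩)
        · rw [show v :: z :: (Y ++ [u]) = (v :: z :: Y) ++ [u] by simp, List.getLast?_concat] at h1
          rw [show v :: (w :: X ++ z :: (Y ++ [u])) = (v :: w :: X ++ z :: Y) ++ [u] by simp,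
            List.getLast?_concat, h1]
        · simpa using h2
    have sub₁ : List.Sublist (v :: (w :: X) ++ [z]) (v :: (w :: X ++ z :: (Y ++ [u]))) := by
      rw [show v :: (w :: X ++ z :: (Y ++ [u])) = (v :: (w :: X) ++ [z]) ++ (Y ++ [u]) by simp]
      exact List.sublist_append_left _ _
    have sub₂ : List.Sublist (v :: z :: (Y ++ [u])) (v :: (w :: X ++ z :: (Y ++ [u]))) :=
      List.Sublist.cons_cons _ (List.sublist_append_right _ _)
    obtain ⟨σ₁, hσ₁, t₁⟩ := ih _ (by simp) (by simp) (sub₁.nodup hnd)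
      (hgen.mono fun x hx => sub₁.subset hx) fair₁ rfl
    obtain ⟨σ₂, hσ₂, t₂⟩ := ih _ (by simp) (by simp) (sub₂.nodup hnd)
      (hgen.mono fun x hx => sub₂.subset hx) fair₂ rfl
    have flip : ∀ τ, IsSign τ → τ = σ ∨ τ = -σ := by
      rintro τ (rfl | rfl) <;> rcases hσ with rfl | rfl <;> simp
    have e₁ : σ₁ = σ := by
      refine (flip σ₁ hσ₁).resolve_right ?_
      rintro rfl
      have := t₁.sar_head_pos hf hfv (fun x hx => hfpos x (by
        rcases List.mem_append.1 hx with hx | hx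
        · exact List.mem_append_left _ hx
        · rw [List.mem_singleton.1 hx]; simp)) (by simp) w (by simp) z
        List.getLast?_concat
      rw [sar_neg] at this; linarith
    have e₂ : σ₂ = σ := by
      refine (flip σ₂ hσ₂).resolve_right ?_
      rintro rfl
      have := t₂.sar_head_pos hf hfv (fun x hx => hfpos x (List.mem_append_right _ hx)) (by simp)
        z (by simp) u (by
          rw [show z :: (Y ++ [u]) = (z :: Y) ++ [u] by simp]; exact List.getLast?_concat)
      rw [sar_neg, ← sar_cyc] at this; linarith
    rw [e₁] at t₁
    rw [e₂] at t₂
    exact ⟨σ, hσ, Tri.graft (l₁ := []) (x := v) (y := z) (m := w :: X) t₂ t₁⟩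
  · -- cut off the ear at `v`
    push Not at hE
    have hout : ∀ c ∈ w :: (mid ++ [u]), 0 < sar σ w u c →
        ¬ (0 < sar σ v w c ∧ 0 < sar σ u v c) := fun c hc h1 h2 =>
      absurd h2.2 (not_lt.2 (hE c hc h2.1 h1))
    have hear : ∀ a b, CEdge (v :: w :: (mid ++ [u])) a b → ¬ Cross u w a b := by
      intro a b hab hc
      rcases hCE a b hab with hab | ⟨rfl, rfl⟩ | ⟨rfl, rfl⟩
      · obtain ⟨s, t, s0, s1, t0, t1, e⟩ := hc.exists_lineMap
        have y1 : 0 < sar σ v w (AffineMap.lineMap a b t) := by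
          rw [← e, sar_lineMap, sar_self_right]
          have := mul_pos (sub_pos.2 s1) hD
          linarith
        have y2 : 0 < sar σ u v (AffineMap.lineMap a b t) := by
          rw [← e, sar_lineMap, sar_self_outer, ← sar_cyc' σ v w u]
          have := mul_pos s0 hD
          linarith
        have y3 : 0 ≤ sar σ w u (AffineMap.lineMap a b t) := by
          rw [← e, sar_lineMap]; simp
        have hpn := ((cross_iff_sar hσ).1 hc).1
        rw [sar_swap σ w u, sar_swap σ w u] at hpn
        rcases mul_neg_iff.1 hpn with ⟨ha, hb⟩ | ⟨ha, hb⟩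
        · rw [← AffineMap.lineMap_apply_one_sub] at y1 y2 y3
          exact K b a (Or.inr hab) (1 - t) (by linarith) (by linarith) y1 y2 y3 (by linarith)
            (hout b hab.mem.2 (by linarith))
        · exact K a b (Or.inl hab) t t0.le t1.le y1 y2 y3 (by linarith)
            (hout a hab.mem.1 (by linarith))
      · exact not_cross_of_mem (Or.inr (Or.inr (Or.inr rfl))) hc
      · exact not_cross_of_mem (Or.inl rfl) hc
    suffices H : Tri (fun a b c => 0 < sar σ a b c) (w :: (mid ++ [u])) from
      ⟨σ, hσ, Tri.tri (A := [v]) (k := w) (B := mid ++ [u]) rfl List.getLast?_concat hD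
        (.edge v w) H⟩
    cases mid with
    | nil => exact .edge w u
    | cons m₀ mid =>
    have hfair' : Fair (w :: (m₀ :: mid ++ [u])) := by
      refine hfair.of_diagonal u w ?_ hear
      rintro a b (h | ⟨h1, h2⟩)
      · exact Or.inl (hPE a b h)
      · rw [show w :: (m₀ :: mid ++ [u]) = (w :: m₀ :: mid) ++ [u] by simp,
          List.getLast?_concat] at h1
        simp only [List.cons_append, List.head?_cons, Option.some.injEq] at h1 h2
        exact Or.inr ⟨h1.symm, h2.symm⟩
    obtain ⟨σ', hσ', t'⟩ := ih _ (by simp) (by simp) hndm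
      (hgen.mono fun x hx => hmS x hx) hfair' rfl
    have : σ' = σ ∨ σ' = -σ := by
      rcases hσ' with rfl | rfl <;> rcases hσ with rfl | rfl <;> simp
    rcases this with rfl | rfl
    · exact t'
    exfalso
    -- a ray from a generic point of `w u` to `v` would have to leave the remaining polygon
    set bad : Set ℝ := (fun z => sar σ v z w / (sar σ v z w - sar σ v z u)) ''
      {z | z ∈ w :: (m₀ :: mid ++ [u])} with hbad
    have hbf : bad.Finite := (List.finite_toSet _).image _
    obtain ⟨τ, ⟨hτ0, hτ1⟩, hτ⟩ := ((Set.Ioo_infinite (show (0 : ℝ) < 1 by norm_num)).sdiff hbf).nonempty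
    set x : Plane := AffineMap.lineMap w u τ with hx
    have hxv : ∀ ρ z, sar ρ x v z = (1 - τ) * sar ρ v z w + τ * sar ρ v z u := fun ρ z => by
      rw [sar_cyc, hx, sar_lineMap]
    have hs : ∀ z ∈ w :: (m₀ :: mid ++ [u]), sar σ x v z ≠ 0 := by
      intro z hz h0
      rw [hxv] at h0
      have hvz : v ≠ z := by rintro rfl; exact hvm hz
      by_cases hd : sar σ v z w - sar σ v z u = 0
      · have h1 : sar σ v z w = 0 := by linear_combination h0 + τ * hd
        have h2 : sar σ v z u = 0 := by linarith
        have : z = w := by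
          by_contra hzw; exact hgen.sar_ne hσ hvS (hmS z hz) hwS hvz hvw hzw h1
        have : z = u := by
          by_contra hzw; exact hgen.sar_ne hσ hvS (hmS z hz) huS hvz hvu hzw h2
        exact hwu (by rw [← this]; exact Eq.symm ‹z = w›)
      · exact hτ ⟨z, hz, by simp only; rw [div_eq_iff hd]; linarith⟩
    have xw : sar σ x v w = τ * sar σ v w u := by rw [hxv]; simp
    have xu : sar σ x v u = -((1 - τ) * sar σ v w u) := by rw [hxv, sar_swap' σ v w u]; simp
    obtain ⟨a, b, hab, ha1, ha2, ha3⟩ := t'.exists_exit (x := x) hf hfv hfpos (fun z hz => by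
      rw [sar_neg]; exact neg_ne_zero.2 (hs z hz)) w rfl u (by
        rw [show w :: (m₀ :: mid ++ [u]) = (w :: m₀ :: mid) ++ [u] by simp]
        exact List.getLast?_concat) (by rw [hx, sar_lineMap]; simp)
        (by rw [sar_neg, sar_swap σ w u, hDc]; linarith)
        (by rw [sar_neg, sar_neg, xw, xu]
            nlinarith [mul_pos (mul_pos hτ0 hD) (mul_pos (sub_pos.2 hτ1) hD)])
    have hane := hab.ne hndm
    have hva : v ≠ a := by rintro rfl; exact hvm hab.mem.1
    have hvb : v ≠ b := by rintro rfl; exact hvm hab.mem.2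
    have ha2 := lt_of_le_of_ne ha2 (hgen.sar_ne hσ.neg (hmS a hab.mem.1) (hmS b hab.mem.2) hvS hane
      hva.symm hvb.symm)
    obtain ⟨s, t, s0, s1, t0, t1, e⟩ := exists_lineMap_eq ha1 ha2 ha3
    have x1 : sar σ v w x = τ * sar σ v w u := by rw [hx, sar_lineMap]; simp
    have x2 : sar σ u v x = (1 - τ) * sar σ v w u := by
      rw [hx, sar_lineMap, ← sar_cyc' σ v w u]; simp
    have x3 : sar σ w u x = 0 := by rw [hx, sar_lineMap]; simp
    have y1 : 0 < sar σ v w (AffineMap.lineMap a b t) := by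
      rw [← e, sar_lineMap, x1, sar_self_outer]
      have := mul_pos (sub_pos.2 s1) (mul_pos hτ0 hD)
      linarith
    have y2 : 0 < sar σ u v (AffineMap.lineMap a b t) := by
      rw [← e, sar_lineMap, x2, sar_self_right]
      have := mul_pos (sub_pos.2 s1) (mul_pos (sub_pos.2 hτ1) hD)
      linarith
    have y3 : 0 ≤ sar σ w u (AffineMap.lineMap a b t) := by
      rw [← e, sar_lineMap, x3, hDc]
      have := mul_nonneg s0 hD.le
      linarith
    rcases lt_or_ge 0 (sar σ w u a) with ha | ha
    · exact K a b (Or.inl hab) t t0 t1 y1 y2 y3 ha (hout a hab.mem.1 ha)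
    rcases lt_or_ge 0 (sar σ w u b) with hb | hb
    · rw [← AffineMap.lineMap_apply_one_sub] at y1 y2 y3
      exact K b a (Or.inr hab) (1 - t) (by linarith) (by linarith) y1 y2 y3 hb
        (hout b hab.mem.2 hb)
    -- otherwise the edge `a b` lies on the line `w u`
    have ha3' := ha3
    have ey : sar (-σ) x v (AffineMap.lineMap a b t) = 0 := by rw [← e, sar_lineMap]; simp
    rw [sar_lineMap] at ey y3
    have t0' : t ≠ 0 := by
      rintro rfl
      rw [show sar (-σ) x v a = 0 by linarith] at ha3; simp at ha3
    have t1' : t ≠ 1 := by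
      rintro rfl
      rw [show sar (-σ) x v b = 0 by linarith] at ha3; simp at ha3
    have t0 := lt_of_le_of_ne t0 t0'.symm
    have t1 := lt_of_le_of_ne t1 t1'
    have q1 := mul_nonneg (sub_pos.2 t1).le (neg_nonneg.2 ha)
    have q2 := mul_nonneg t0.le (neg_nonneg.2 hb)
    have z1 : (1 - t) * sar σ w u a = 0 := by linarith
    have z2 : t * sar σ w u b = 0 := by linarith
    have z1 := (mul_eq_zero.1 z1).resolve_left (sub_pos.2 t1).ne'
    have z2 := (mul_eq_zero.1 z2).resolve_left t0.ne'
    have hau : a ≠ u := by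
      have h1 : (w :: m₀ :: mid ++ [u]).Nodup := by simpa using hndm
      exact PEdge.ne_last h1 (by simpa using hab)
    have haw : a = w := by
      by_contra haw
      exact hgen.sar_ne hσ hwS huS (hmS a hab.mem.1) hwu (Ne.symm haw) (Ne.symm hau) z1
    subst haw
    have hbu : b = u := by
      by_contra hbu
      exact hgen.sar_ne hσ hwS huS (hmS b hab.mem.2) hwu hane (Ne.symm hbu) z2
    subst hbu
    rcases hab with ⟨-, h⟩ | h
    · subst h; simp at hndm
    · exact (List.nodup_cons.1 hndm).1 h.mem.1

/-! ### Triangles filling the convex hull -/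

/-- The points `w 0, …, w (n - 1)` of `P` form a cycle around all of `P`: with respect to the
orientation `σ`, all other points lie to the left of each edge. -/
structure IsHullCycle (σ : ℝ) (P : Finset Plane) {n : ℕ} (w : Fin n → Plane) : Prop where
  isSign : IsSign σ
  three_le : 3 ≤ n
  injective : Function.Injective w
  mem : ∀ i, w i ∈ P
  left : ∀ i, ∀ q ∈ P, q ≠ w i → q ≠ w (finRotate n i) → 0 < sar σ (w i) (w (finRotate n i)) q

theorem finRotate_finRotate_ne {n : ℕ} (hn : 3 ≤ n) (i : Fin n) :
    finRotate n (finRotate n i) ≠ i := by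
  obtain ⟨k, rfl⟩ : ∃ k, n = k + 3 := ⟨n - 3, by omega⟩
  rw [finRotate_apply, finRotate_apply, add_assoc]
  intro h
  have := add_eq_left.1 h
  have := congrArg Fin.val this
  simp only [Fin.val_add, Fin.val_one, Fin.val_zero] at this
  rw [Nat.mod_eq_of_lt (by omega)] at this
  omega

theorem finRotate_ne {n : ℕ} (hn : 2 ≤ n) (i : Fin n) : finRotate n i ≠ i := by
  obtain ⟨k, rfl⟩ : ∃ k, n = k + 2 := ⟨n - 2, by omega⟩
  rw [finRotate_apply]
  intro h
  have := add_eq_left.1 h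
  have := congrArg Fin.val this
  simp at this

theorem finRotate_induction {n : ℕ} (hn : 2 ≤ n) {p : Fin n → Prop}
    (h : ∀ i, p i → p (finRotate n i)) {i : Fin n} (hi : p i) (j : Fin n) : p j := by
  obtain ⟨k, rfl⟩ : ∃ k, n = k + 2 := ⟨n - 2, by omega⟩
  obtain ⟨m, rfl⟩ := isCycle_finRotate.exists_pow_eq (finRotate_ne (by omega) i)
    (finRotate_ne (by omega) j)
  clear hn
  induction m with
  | zero => simpa using hi
  | succ m ih => rw [pow_succ']; exact h _ ih

theorem IsHullCycle.nonneg {σ : ℝ} {P : Finset Plane} {n : ℕ} {w : Fin n → Plane}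
    (h : IsHullCycle σ P w) (i : Fin n) {q : Plane} (hq : q ∈ P) :
    0 ≤ sar σ (w i) (w (finRotate n i)) q := by
  by_cases h1 : q = w i
  · rw [h1]; simp
  by_cases h2 : q = w (finRotate n i)
  · rw [h2]; simp
  exact (h.left i q hq h1 h2).le

theorem IsHullCycle.eq_or_eq {σ : ℝ} {P : Finset Plane} {n : ℕ} {w : Fin n → Plane}
    (h : IsHullCycle σ P w) {i : Fin n} {q : Plane} (hq : q ∈ P)
    (h0 : sar σ (w i) (w (finRotate n i)) q = 0) : q = w i ∨ q = w (finRotate n i) := by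
  by_contra hn
  rw [not_or] at hn
  exact (h.left i q hq hn.1 hn.2).ne' h0

open Classical in
/-- The contribution of the directed edge `a b` to the number of signed crossings of the ray from
`x` through `y`. An endpoint on the line `x y` counts as lying on its right. -/
noncomputable def crossNum (σ : ℝ) (x y a b : Plane) : ℤ :=
  if sar σ x y a ≤ 0 ∧ 0 < sar σ x y b ∧ 0 < sar σ a b x then 1
  else if 0 < sar σ x y a ∧ sar σ x y b ≤ 0 ∧ sar σ a b x < 0 then -1 else 0

section crossNum
variable {σ : ℝ} {x y a b : Plane}

theorem crossNum_right (ha : sar σ x y a ≤ 0) (hb : sar σ x y b ≤ 0) : crossNum σ x y a b = 0 := by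
  simp [crossNum, ha, not_lt.2 ha, not_lt.2 hb]

theorem crossNum_left (ha : 0 < sar σ x y a) (hb : 0 < sar σ x y b) : crossNum σ x y a b = 0 := by
  simp [crossNum, not_le.2 ha, not_le.2 hb]

theorem crossNum_up (ha : sar σ x y a ≤ 0) (hb : 0 < sar σ x y b) :
    crossNum σ x y a b = if 0 < sar σ a b x then 1 else 0 := by
  simp [crossNum, ha, hb, not_lt.2 ha]

theorem crossNum_down (ha : 0 < sar σ x y a) (hb : sar σ x y b ≤ 0) :
    crossNum σ x y a b = if sar σ a b x < 0 then -1 else 0 := by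
  simp [crossNum, hb, ha, not_lt.2 hb]

end crossNum

theorem crossNum_antisymm (σ : ℝ) (x y a b : Plane) :
    crossNum σ x y b a = - crossNum σ x y a b := by
  rcases le_or_gt (sar σ x y a) 0 with ha | ha <;> rcases le_or_gt (sar σ x y b) 0 with hb | hb
  · rw [crossNum_right ha hb, crossNum_right hb ha]; rfl
  · rw [crossNum_up ha hb, crossNum_down hb ha, sar_swap σ a b x]; simp only [neg_lt_zero]
    split_ifs <;> rfl
  · rw [crossNum_up hb ha, crossNum_down ha hb, sar_swap σ a b x]; simp only [neg_pos]
    split_ifs <;> rfl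
  · rw [crossNum_left ha hb, crossNum_left hb ha]; rfl

/-- The open triangle with corners `t`, which should be in counterclockwise order. -/
def Inside (σ : ℝ) (t : Plane × Plane × Plane) (x : Plane) : Prop :=
  0 < sar σ t.1 t.2.1 x ∧ 0 < sar σ t.2.1 t.2.2 x ∧ 0 < sar σ t.2.2 t.1 x

theorem isOpen_inside (σ : ℝ) (t : Plane × Plane × Plane) : IsOpen {x | Inside σ t x} :=
  (isOpen_lt continuous_const (continuous_sar σ _ _)).inter
    ((isOpen_lt continuous_const (continuous_sar σ _ _)).inter
      (isOpen_lt continuous_const (continuous_sar σ _ _)))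

theorem exists_sar_ne_zero {σ : ℝ} (hσ : IsSign σ) {x y : Plane} (hxy : x ≠ y) :
    ∃ z, sar σ x y z ≠ 0 := by
  by_contra hn
  push Not at hn
  refine hxy (plane_ext ?_ ?_)
  · have := hn (!₂[x 0, x 1 + 1])
    simp only [sar, orientation, mul_eq_zero, hσ.ne_zero, false_or] at this
    simp at this; linarith
  · have := hn (!₂[x 0 + 1, x 1])
    simp only [sar, orientation, mul_eq_zero, hσ.ne_zero, false_or] at this
    simp at this; linarith

theorem not_all_zero {σ : ℝ} (hσ : IsSign σ) {x y a b c : Plane} (hxy : x ≠ y)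
    (h : sar σ a b c ≠ 0) (ha : sar σ x y a = 0) (hb : sar σ x y b = 0) (hc : sar σ x y c = 0) :
    False := by
  obtain ⟨z, hz⟩ := exists_sar_ne_zero hσ hxy
  have := sar_bary σ x y a b c z
  rw [ha, hb, hc] at this
  simp [h, hz] at this

theorem sar_bary_self (σ : ℝ) (x y a b c : Plane) :
    sar σ b c x * sar σ x y a + sar σ c a x * sar σ x y b + sar σ a b x * sar σ x y c = 0 := by
  have := sar_bary σ x y a b c x
  rw [sar_self_outer, sar_cyc σ x b c, sar_cyc' σ a x c] at this
  linarith

/-- A ray from inside a counterclockwise triangle leaves it exactly once. -/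
theorem triSum_of_inside {σ : ℝ} (hσ : IsSign σ) {x y : Plane} (hxy : x ≠ y)
    {t : Plane × Plane × Plane} (hx : Inside σ t x) : triSum (crossNum σ x y) t = 1 := by
  obtain ⟨a, b, c⟩ := t
  obtain ⟨h1, h2, h3⟩ := hx
  simp only at h1 h2 h3
  have hD : sar σ a b c ≠ 0 := by
    have := sar_sum σ a b c x
    rw [sar_cyc σ x b c, sar_cyc' σ a x c] at this
    linarith
  have key := sar_bary_self σ x y a b c
  simp only [triSum]
  rcases le_or_gt (sar σ x y a) 0 with ha | ha <;> rcases le_or_gt (sar σ x y b) 0 with hb | hb <;>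
    rcases le_or_gt (sar σ x y c) 0 with hc | hc
  · exfalso
    have p1 := mul_nonneg h2.le (neg_nonneg.2 ha)
    have p2 := mul_nonneg h3.le (neg_nonneg.2 hb)
    have p3 := mul_nonneg h1.le (neg_nonneg.2 hc)
    have z1 : sar σ b c x * sar σ x y a = 0 := by linarith
    have z2 : sar σ c a x * sar σ x y b = 0 := by linarith
    have z3 : sar σ a b x * sar σ x y c = 0 := by linarith
    exact not_all_zero hσ hxy hD ((mul_eq_zero.1 z1).resolve_left h2.ne')
      ((mul_eq_zero.1 z2).resolve_left h3.ne') ((mul_eq_zero.1 z3).resolve_left h1.ne')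
  · rw [crossNum_right ha hb, crossNum_up hb hc, crossNum_down hc ha, if_pos h2, if_neg h3.not_gt]
    rfl
  · rw [crossNum_up ha hb, crossNum_down hb hc, crossNum_right hc ha, if_pos h1, if_neg h2.not_gt]
    rfl
  · rw [crossNum_up ha hb, crossNum_left hb hc, crossNum_down hc ha, if_pos h1, if_neg h3.not_gt]
    rfl
  · rw [crossNum_down ha hb, crossNum_right hb hc, crossNum_up hc ha, if_pos h3, if_neg h1.not_gt]
    rfl
  · rw [crossNum_down ha hb, crossNum_up hb hc, crossNum_left hc ha, if_pos h2, if_neg h1.not_gt]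
    rfl
  · rw [crossNum_left ha hb, crossNum_down hb hc, crossNum_up hc ha, if_pos h3, if_neg h2.not_gt]
    rfl
  · exfalso
    have p1 := mul_pos h2 ha
    have p2 := mul_pos h3 hb
    have p3 := mul_pos h1 hc
    linarith

/-- Barycentric coordinates of a point outside a triangle, one corner of which is separated from the other
two by a line through the point: the coordinates opposite to these two have opposite signs. -/
theorem isolated_side {X Y Z sa sb sc D : ℝ} (hD : 0 < D) (hsum : X + Y + Z = D)
    (hs : X * sa + Y * sb + Z * sc = 0) (hX : X ≠ 0) (hZ : Z ≠ 0)
    (hn : ¬ (0 < X ∧ 0 ≤ Y ∧ 0 < Z))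
    (h : (sa ≤ 0 ∧ 0 < sb ∧ sc ≤ 0) ∨ (0 < sa ∧ sb ≤ 0 ∧ 0 < sc)) : 0 < Z ↔ X < 0 := by
  constructor
  · intro hz
    by_contra hx
    have hx := lt_of_le_of_ne (not_lt.1 hx) hX.symm
    have hy : Y < 0 := by
      by_contra hy; exact hn ⟨hx, not_lt.1 hy, hz⟩
    rcases h with ⟨h1, h2, h3⟩ | ⟨h1, h2, h3⟩
    · nlinarith [mul_nonneg hx.le (neg_nonneg.2 h1), mul_pos (neg_pos.2 hy) h2,
        mul_nonneg hz.le (neg_nonneg.2 h3)]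
    · nlinarith [mul_pos hx h1, mul_nonneg (neg_pos.2 hy).le (neg_nonneg.2 h2), mul_pos hz h3]
  · intro hx
    by_contra hz
    have hz := lt_of_le_of_ne (not_lt.1 hz) hZ
    have hy : 0 < Y := by linarith
    rcases h with ⟨h1, h2, h3⟩ | ⟨h1, h2, h3⟩
    · nlinarith [mul_nonneg (neg_pos.2 hx).le (neg_nonneg.2 h1), mul_pos hy h2,
        mul_nonneg (neg_pos.2 hz).le (neg_nonneg.2 h3)]
    · nlinarith [mul_pos (neg_pos.2 hx) h1, mul_nonneg hy.le (neg_nonneg.2 h2),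
        mul_pos (neg_pos.2 hz) h3]

/-- The crossings of a ray at the two edges of a triangle that leave and reach one side of the ray
cancel, if the ray starts outside. -/
theorem crossNum_cancel {σ : ℝ} {x y a b c : Plane} (hD : 0 < sar σ a b c)
    (hX : sar σ b c x ≠ 0) (hZ : sar σ a b x ≠ 0)
    (hn : ¬ (0 < sar σ b c x ∧ 0 ≤ sar σ c a x ∧ 0 < sar σ a b x))
    (h : (sar σ x y a ≤ 0 ∧ 0 < sar σ x y b ∧ sar σ x y c ≤ 0) ∨
      (0 < sar σ x y a ∧ sar σ x y b ≤ 0 ∧ 0 < sar σ x y c)) :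
    crossNum σ x y a b + crossNum σ x y b c + crossNum σ x y c a = 0 := by
  have e := isolated_side (X := sar σ b c x) (Y := sar σ c a x) (Z := sar σ a b x) hD (by
    have := sar_sum σ a b c x
    rw [sar_cyc σ x b c, sar_cyc' σ a x c] at this
    linarith) (sar_bary_self σ x y a b c) hX hZ hn h
  have hX' : sar σ b c x < 0 ↔ ¬ 0 < sar σ b c x :=
    ⟨fun h => h.not_gt, fun h => lt_of_le_of_ne (not_lt.1 h) hX⟩
  have hZ' : sar σ a b x < 0 ↔ ¬ 0 < sar σ a b x :=
    ⟨fun h => h.not_gt, fun h => lt_of_le_of_ne (not_lt.1 h) hZ⟩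
  rcases h with ⟨h1, h2, h3⟩ | ⟨h1, h2, h3⟩
  · rw [crossNum_up h1 h2, crossNum_down h2 h3, crossNum_right h3 h1]
    by_cases k : 0 < sar σ a b x
    · rw [if_pos k, if_pos (e.1 k)]; rfl
    · rw [if_neg k, if_neg (fun h => k (e.2 h))]; rfl
  · rw [crossNum_down h1 h2, crossNum_up h2 h3, crossNum_left h3 h1]
    by_cases k : 0 < sar σ a b x
    · rw [if_neg k.not_gt, if_neg (e.1 k).not_gt]; rfl
    · rw [if_pos (hZ'.2 k), if_pos (not_not.1 fun h => k (e.2 (hX'.2 h)))]; rfl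

/-- A ray from outside a triangle enters it as often as it leaves it. -/
theorem triSum_of_outside {σ : ℝ} {x y : Plane} {t : Plane × Plane × Plane}
    (ht : 0 < sar σ t.1 t.2.1 t.2.2) (h1 : sar σ t.1 t.2.1 x ≠ 0) (h2 : sar σ t.2.1 t.2.2 x ≠ 0)
    (h3 : sar σ t.2.2 t.1 x ≠ 0) (hx : ¬ Inside σ t x) : triSum (crossNum σ x y) t = 0 := by
  obtain ⟨a, b, c⟩ := t
  simp only [Inside] at ht h1 h2 h3 hx
  have c1 := fun h => crossNum_cancel (x := x) (y := y) ht h2 h1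
    (fun hh => hx ⟨hh.2.2, hh.1, lt_of_le_of_ne hh.2.1 h3.symm⟩) h
  have c2 := fun h => crossNum_cancel (x := x) (y := y) (sar_cyc_pos _ _ _ ht) h3 h2
    (fun hh => hx ⟨lt_of_le_of_ne hh.2.1 h1.symm, hh.2.2, hh.1⟩) h
  have c3 := fun h => crossNum_cancel (x := x) (y := y) (sar_cyc_pos _ _ _ (sar_cyc_pos _ _ _ ht))
    h1 h3 (fun hh => hx ⟨hh.1, lt_of_le_of_ne hh.2.1 h2.symm, hh.2.2⟩) h
  simp only [triSum]
  rcases le_or_gt (sar σ x y a) 0 with ha | ha <;> rcases le_or_gt (sar σ x y b) 0 with hb | hb <;>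
    rcases le_or_gt (sar σ x y c) 0 with hc | hc
  · rw [crossNum_right ha hb, crossNum_right hb hc, crossNum_right hc ha]; rfl
  · have := c2 (Or.inl ⟨hb, hc, ha⟩); linarith
  · exact c1 (Or.inl ⟨ha, hb, hc⟩)
  · have := c3 (Or.inr ⟨hc, ha, hb⟩); linarith
  · have := c3 (Or.inl ⟨hc, ha, hb⟩); linarith
  · exact c1 (Or.inr ⟨ha, hb, hc⟩)
  · have := c2 (Or.inr ⟨hb, hc, ha⟩); linarith
  · rw [crossNum_left ha hb, crossNum_left hb hc, crossNum_left hc ha]; rfl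

theorem triSum_of_corner {σ : ℝ} {x y b c : Plane} :
    triSum (crossNum σ x y) (x, b, c) = crossNum σ x y b c := by
  simp [triSum, crossNum]

/-- A ray crosses the hull cycle at most once from right to left. -/
theorem IsHullCycle.crossNum_unique {σ : ℝ} {P : Finset Plane} {n : ℕ} {w : Fin n → Plane}
    (h : IsHullCycle σ P w) {x y : Plane} {i j : Fin n}
    (hi : crossNum σ x y (w i) (w (finRotate n i)) = 1)
    (hj : crossNum σ x y (w j) (w (finRotate n j)) = 1) : i = j := by
  have get : ∀ a b, crossNum σ x y a b = 1 →
      sar σ x y a ≤ 0 ∧ 0 < sar σ x y b ∧ 0 < sar σ a b x := by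
    intro a b hab
    unfold crossNum at hab
    split_ifs at hab with h1 h2
    · exact h1
    · simp at hab
  obtain ⟨i1, i2, i3⟩ := get _ _ hi
  obtain ⟨j1, j2, j3⟩ := get _ _ hj
  have n1 := h.nonneg i (h.mem j)
  have n2 := h.nonneg i (h.mem (finRotate n j))
  have n3 := h.nonneg j (h.mem i)
  have n4 := h.nonneg j (h.mem (finRotate n i))
  have e : ∀ a b c d : Plane, sar σ a b x * (sar σ x y d - sar σ x y c) -
      sar σ c d x * (sar σ x y b - sar σ x y a) =
      sar σ x y d * sar σ a b c - sar σ x y c * sar σ a b d := by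
    intro a b c d; simp only [sar, orientation]; ring
  have e1 := e (w i) (w (finRotate n i)) (w j) (w (finRotate n j))
  have e2 := e (w j) (w (finRotate n j)) (w i) (w (finRotate n i))
  have p1 := mul_nonneg j2.le n1
  have p2 := mul_nonneg (neg_nonneg.2 j1) n2
  have p3 := mul_nonneg i2.le n3
  have p4 := mul_nonneg (neg_nonneg.2 i1) n4
  have z1 : sar σ x y (w (finRotate n j)) * sar σ (w i) (w (finRotate n i)) (w j) = 0 := by linarith
  have z1 := (mul_eq_zero.1 z1).resolve_left j2.ne'
  rcases h.eq_or_eq (h.mem j) z1 with hh | hh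
  · exact (h.injective hh).symm
  · rw [hh] at j1; linarith

theorem crossNum_le_one (σ : ℝ) (x y a b : Plane) : crossNum σ x y a b ≤ 1 := by
  unfold crossNum; split_ifs <;> simp

theorem IsHullCycle.sum_le_one {σ : ℝ} {P : Finset Plane} {n : ℕ} {w : Fin n → Plane}
    (h : IsHullCycle σ P w) (x y : Plane) :
    ∑ i, crossNum σ x y (w i) (w (finRotate n i)) ≤ 1 := by
  by_cases hex : ∃ i, crossNum σ x y (w i) (w (finRotate n i)) = 1
  · obtain ⟨i, hi⟩ := hex
    calc ∑ j, crossNum σ x y (w j) (w (finRotate n j)) ≤ ∑ j, if j = i then 1 else 0 := by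
          refine Finset.sum_le_sum fun j _ => ?_
          split_ifs with hji
          · exact crossNum_le_one _ _ _ _ _
          · have h1 := crossNum_le_one σ x y (w j) (w (finRotate n j))
            have h2 : crossNum σ x y (w j) (w (finRotate n j)) ≠ 1 := fun hj =>
              hji (h.crossNum_unique hj hi)
            omega
      _ = 1 := by simp
  · push Not at hex
    refine (Finset.sum_nonpos fun j _ => ?_).trans zero_le_one
    have h1 := crossNum_le_one σ x y (w j) (w (finRotate n j))
    have h2 := hex j
    omega

/-- A ray from a point of `P` into the hull leaves the hull. -/
theorem IsHullCycle.one_le_sum {σ : ℝ} {P : Finset Plane} {n : ℕ} {w : Fin n → Plane}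
    (h : IsHullCycle σ P w) {x y : Plane} (hx : x ∈ P) (hy : y ∈ P) (hxy : x ≠ y)
    (hadj : ∀ i, x = w (finRotate n i) → y ≠ w i) (hadj' : ∀ i, x = w i → y ≠ w (finRotate n i)) :
    1 ≤ ∑ i, crossNum σ x y (w i) (w (finRotate n i)) := by
  have hn := h.three_le
  have hnn : ∀ i, 0 ≤ crossNum σ x y (w i) (w (finRotate n i)) := by
    intro i
    unfold crossNum
    split_ifs with h1 h2
    · simp
    · exact absurd h2.2.2 (not_lt.2 (h.nonneg i hx))
    · simp
  obtain ⟨i, hi⟩ : ∃ i, crossNum σ x y (w i) (w (finRotate n i)) = 1 := by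
    -- it suffices to find corners on both sides of the line `x y`
    suffices H : (∃ i, sar σ x y (w i) ≤ 0 ∧ (∀ j, x = w j → i = finRotate n j)) ∧
        ∃ i, 0 < sar σ x y (w i) by
      obtain ⟨⟨i, hi, -⟩, ⟨j, hj⟩⟩ := H
      have : ∃ i, sar σ x y (w i) ≤ 0 ∧ 0 < sar σ x y (w (finRotate n i)) := by
        by_contra hno
        push Not at hno
        exact absurd hj (not_lt.2 (finRotate_induction (by omega)
          (p := fun i => sar σ x y (w i) ≤ 0) hno hi j))
      obtain ⟨k, hk1, hk2⟩ := this
      refine ⟨k, ?_⟩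
      have hk3 : 0 < sar σ (w k) (w (finRotate n k)) x := by
        refine h.left k x hx ?_ ?_
        · rintro rfl
          have h1 := h.left k y hy hxy.symm (hadj' k rfl)
          rw [sar_swap'] at hk2; linarith
        · rintro rfl; simp at hk2
      rw [crossNum_up hk1 hk2, if_pos hk3]
    by_cases hc : ∃ k, x = w k
    · obtain ⟨k, rfl⟩ := hc
      obtain ⟨l, rfl⟩ := (finRotate n).surjective k
      refine ⟨⟨finRotate n (finRotate n l), ?_, fun j hj => by rw [h.injective hj]⟩, ⟨l, ?_⟩⟩
      · have := h.left (finRotate n l) y hy hxy.symm (hadj' _ rfl)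
        rw [sar_swap']; linarith
      · have := h.left l y hy (hadj l rfl) hxy.symm
        rwa [← sar_cyc]
    · push Not at hc
      have hpos : ∀ i, 0 < sar σ (w i) (w (finRotate n i)) x := fun i =>
        h.left i x hx (hc i) (hc _)
      have hD : ∀ i, 0 < sar σ (w i) (w (finRotate n i)) (w (finRotate n (finRotate n i))) :=
        fun i => h.left i _ (h.mem _) (fun e => finRotate_finRotate_ne hn i (h.injective e))
          (fun e => finRotate_ne (by omega) _ (h.injective e))
      have rel : ∀ i, sar σ (w (finRotate n i)) (w (finRotate n (finRotate n i))) x *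
          (sar σ x y (w i) - sar σ x y (w (finRotate n i))) +
          sar σ (w i) (w (finRotate n i)) x * (sar σ x y (w (finRotate n (finRotate n i))) -
            sar σ x y (w (finRotate n i))) +
          sar σ (w i) (w (finRotate n i)) (w (finRotate n (finRotate n i))) *
            sar σ x y (w (finRotate n i)) = 0 := by
        intro i
        have := sar_bary_self σ x y (w i) (w (finRotate n i)) (w (finRotate n (finRotate n i)))
        have h2 := sar_sum σ (w i) (w (finRotate n i)) (w (finRotate n (finRotate n i))) x
        rw [sar_cyc σ x, sar_cyc' σ (w i) x] at h2
        linear_combination this + sar σ x y (w (finRotate n i)) * h2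
      have hne : (Finset.univ : Finset (Fin n)).Nonempty := ⟨⟨0, by omega⟩, by simp⟩
      constructor
      · by_contra hno
        have hno : ∀ i, 0 < sar σ x y (w i) := by
          intro i; by_contra hi; exact hno ⟨i, not_lt.1 hi, fun j hj => absurd hj (hc j)⟩
        obtain ⟨m, -, hm⟩ := Finset.univ.exists_min_image (fun i => sar σ x y (w i)) hne
        obtain ⟨l, rfl⟩ := (finRotate n).surjective m
        have h1 := mul_nonneg (hpos (finRotate n l)).le (sub_nonneg.2 (hm l (by simp)))
        have h2 := mul_nonneg (hpos l).le
          (sub_nonneg.2 (hm (finRotate n (finRotate n l)) (by simp)))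
        have h3 := mul_pos (hD l) (hno (finRotate n l))
        linarith [rel l]
      · by_contra hno
        push Not at hno
        obtain ⟨m, -, hm⟩ := Finset.univ.exists_max_image (fun i => sar σ x y (w i)) hne
        obtain ⟨l, rfl⟩ := (finRotate n).surjective m
        have h1 := mul_nonneg (hpos (finRotate n l)).le (sub_nonneg.2 (hm l (by simp)))
        have h2 := mul_nonneg (hpos l).le
          (sub_nonneg.2 (hm (finRotate n (finRotate n l)) (by simp)))
        have h3 := mul_nonneg (hD l).le (neg_nonneg.2 (hno (finRotate n l)))
        have r := rel l
        have z1 : sar σ (w l) (w (finRotate n l)) (w (finRotate n (finRotate n l))) *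
          sar σ x y (w (finRotate n l)) = 0 := by linarith
        have z2 : sar σ (w (finRotate n l)) (w (finRotate n (finRotate n l))) x *
          (sar σ x y (w l) - sar σ x y (w (finRotate n l))) = 0 := by linarith
        have z3 : sar σ (w l) (w (finRotate n l)) x *
          (sar σ x y (w (finRotate n (finRotate n l))) -
            sar σ x y (w (finRotate n l))) = 0 := by linarith
        have z1 := (mul_eq_zero.1 z1).resolve_left (hD l).ne'
        have z2 := (mul_eq_zero.1 z2).resolve_left (hpos _).ne'
        have z3 := (mul_eq_zero.1 z3).resolve_left (hpos _).ne'
        exact not_all_zero h.isSign hxy (hD l).ne' (by linarith) z1 (by linarith)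
  calc (1 : ℤ) = crossNum σ x y (w i) (w (finRotate n i)) := hi.symm
    _ ≤ _ := Finset.single_le_sum (fun j _ => hnn j) (Finset.mem_univ i)

/-! ### Triangulations from triangles with the right boundary -/

/-- `p` is a corner of the triangle `t`. -/
def Corner (p : Plane) (t : Plane × Plane × Plane) : Prop := p = t.1 ∨ p = t.2.1 ∨ p = t.2.2

/-- `a b c` is the triangle `t`, up to a cyclic shift of the corners. -/
def Rot (a b c : Plane) (t : Plane × Plane × Plane) : Prop :=
  t = (a, b, c) ∨ t = (c, a, b) ∨ t = (b, c, a)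

section Rot
variable {σ : ℝ} {a b c p : Plane} {t : Plane × Plane × Plane}

theorem Rot.shift (h : Rot a b c t) : Rot b c a t := by
  rcases h with h | h | h
  · exact Or.inr (Or.inl h)
  · exact Or.inr (Or.inr h)
  · exact Or.inl h

theorem Rot.inside (h : Rot a b c t) {x : Plane} : Inside σ t x ↔ Inside σ (a, b, c) x := by
  rcases h with rfl | rfl | rfl <;> simp only [Inside] <;> tauto

theorem Rot.pos (h : Rot a b c t) (ht : 0 < sar σ t.1 t.2.1 t.2.2) : 0 < sar σ a b c := by
  rcases h with rfl | rfl | rfl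
  · exact ht
  · exact sar_cyc_pos _ _ _ ht
  · exact sar_cyc_pos _ _ _ (sar_cyc_pos _ _ _ ht)

theorem Rot.triSum (h : Rot a b c t) (f : Plane → Plane → ℤ) :
    triSum f t = PointSet.triSum f (a, b, c) := by
  rcases h with rfl | rfl | rfl <;> simp only [PointSet.triSum] <;> ring

theorem Rot.corner (h : Rot a b c t) : Corner p t ↔ p = a ∨ p = b ∨ p = c := by
  rcases h with rfl | rfl | rfl <;> simp only [Corner] <;> tauto

theorem Corner.exists_rot (h : Corner p t) : ∃ b c, Rot p b c t := by
  obtain ⟨x, y, z⟩ := t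
  rcases h with rfl | rfl | rfl
  · exact ⟨y, z, Or.inl rfl⟩
  · exact ⟨z, x, Or.inr (Or.inl rfl)⟩
  · exact ⟨x, y, Or.inr (Or.inr rfl)⟩

theorem Corner.exists_rot₂ {q : Plane} (hp : Corner p t) (hq : Corner q t) (hpq : p ≠ q) :
    ∃ c, Rot p q c t ∨ Rot q p c t := by
  obtain ⟨b, c, h⟩ := hp.exists_rot
  rcases h.corner.1 hq with rfl | rfl | rfl
  · exact absurd rfl hpq
  · exact ⟨c, Or.inl h⟩
  · exact ⟨b, Or.inr h.shift.shift⟩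

theorem not_inside_corner (h : Corner p t) : ¬ Inside σ t p := by
  rintro ⟨h1, h2, h3⟩
  rcases h with rfl | rfl | rfl
  · simp at h1
  · simp at h1
  · simp at h2

end Rot

/-- Close to `x`, the segment from `x` to `z` runs in the open half-plane `0 < sar σ a b`. -/
def Enters (σ : ℝ) (a b x z : Plane) : Prop :=
  0 < sar σ a b x ∨ (sar σ a b x = 0 ∧ 0 < sar σ a b z)

theorem Enters.eventually {σ : ℝ} {a b x z : Plane} (h : Enters σ a b x z) :
    ∀ᶠ ε : ℝ in nhdsWithin 0 (Set.Ioi 0), 0 < sar σ a b (AffineMap.lineMap x z ε) := by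
  rcases h with h | ⟨h0, h⟩
  · have hc : Continuous fun ε : ℝ => (1 - ε) * sar σ a b x + ε * sar σ a b z := by fun_prop
    have : ∀ᶠ ε : ℝ in nhds 0, 0 < (1 - ε) * sar σ a b x + ε * sar σ a b z :=
      hc.continuousAt.eventually (isOpen_Ioi.mem_nhds (by simpa using h))
    filter_upwards [this.filter_mono nhdsWithin_le_nhds] with ε hε
    rwa [sar_lineMap]
  · filter_upwards [self_mem_nhdsWithin] with ε hε
    rw [sar_lineMap, h0]
    have : 0 < ε := hε
    have := mul_pos this h
    linarith

/-- Close to `x`, the segment from `x` to `z` runs inside the triangle `t`. -/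
def EntersTri (σ : ℝ) (t : Plane × Plane × Plane) (x z : Plane) : Prop :=
  Enters σ t.1 t.2.1 x z ∧ Enters σ t.2.1 t.2.2 x z ∧ Enters σ t.2.2 t.1 x z

theorem exists_inside_both {σ : ℝ} {t t' : Plane × Plane × Plane} {x z : Plane}
    (h : EntersTri σ t x z) (h' : EntersTri σ t' x z) : ∃ y, Inside σ t y ∧ Inside σ t' y := by
  obtain ⟨ε, h⟩ := (h.1.eventually.and (h.2.1.eventually.and (h.2.2.eventually.and
    (h'.1.eventually.and (h'.2.1.eventually.and h'.2.2.eventually))))).exists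
  exact ⟨_, ⟨h.1, h.2.1, h.2.2.1⟩, h.2.2.2⟩

theorem Inside.entersTri {σ : ℝ} {t : Plane × Plane × Plane} {x : Plane} (h : Inside σ t x)
    (z : Plane) : EntersTri σ t x z := ⟨Or.inl h.1, Or.inl h.2.1, Or.inl h.2.2⟩

/-- An open set contains points outside finitely many given lines. -/
theorem exists_off_lines {σ : ℝ} (hσ : IsSign σ) (L : List (Plane × Plane))
    (hL : ∀ e ∈ L, e.1 ≠ e.2) {U : Set Plane} (hU : IsOpen U) (hne : U.Nonempty) :
    ∃ x ∈ U, ∀ e ∈ L, sar σ e.1 e.2 x ≠ 0 := by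
  induction L generalizing U with
  | nil => obtain ⟨x, hx⟩ := hne; exact ⟨x, hx, by simp⟩
  | cons e L ih =>
    have hopen : IsOpen (U ∩ {x | sar σ e.1 e.2 x ≠ 0}) :=
      hU.inter (isOpen_ne_fun (continuous_sar σ _ _) continuous_const)
    obtain ⟨x, hx, h⟩ := ih (fun e he => hL e (List.mem_cons_of_mem _ he)) hopen (by
      obtain ⟨x, hx⟩ := hne
      by_cases h0 : sar σ e.1 e.2 x = 0
      · obtain ⟨z, hz⟩ := exists_sar_ne_zero hσ (hL e (by simp))
        have hc : Continuous fun ε : ℝ => (AffineMap.lineMap x z ε : Plane) := AffineMap.lineMap_continuous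
        have h1 : ∀ᶠ ε : ℝ in nhdsWithin 0 (Set.Ioi 0), (AffineMap.lineMap x z ε : Plane) ∈ U :=
          (hc.continuousAt.eventually (hU.mem_nhds (by simpa using hx))).filter_mono
            nhdsWithin_le_nhds
        have h2 : ∀ᶠ ε : ℝ in nhdsWithin 0 (Set.Ioi 0), 0 < ε := self_mem_nhdsWithin
        obtain ⟨ε, h3, h4⟩ := (h1.and h2).exists
        refine ⟨_, h3, ?_⟩
        rw [Set.mem_ofPred_eq, sar_lineMap, h0]
        simp [h4.ne', hz]
      · exact ⟨x, hx, h0⟩)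
    exact ⟨x, hx.1, fun e' he' => by
      rcases List.mem_cons.1 he' with rfl | he'
      · exact hx.2
      · exact h e' he'⟩

theorem list_sum_nonpos {α : Type*} {l : List α} {f : α → ℤ} (h : ∀ a ∈ l, f a ≤ 0) :
    (l.map f).sum ≤ 0 := by
  induction l with
  | nil => simp
  | cons a l ih =>
    rw [List.map_cons, List.sum_cons]
    have h1 := ih fun x hx => h x (List.mem_cons_of_mem _ hx)
    have h2 := h a (by simp)
    omega

theorem add_le_list_sum {α : Type*} {l : List α} {f : α → ℤ} (h : ∀ a ∈ l, 0 ≤ f a) {a b : α}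
    (ha : a ∈ l) (hb : b ∈ l) (hab : a ≠ b) : f a + f b ≤ (l.map f).sum := by
  classical
  have p1 := List.perm_cons_erase ha
  have hb' : b ∈ l.erase a := (List.mem_erase_of_ne hab.symm).2 hb
  have p2 := List.perm_cons_erase hb'
  have p := (p1.trans (p2.cons a)).map f
  rw [p.sum_eq, List.map_cons, List.map_cons, List.sum_cons, List.sum_cons]
  have h1 : 0 ≤ (((l.erase a).erase b).map f).sum := by
    refine List.sum_nonneg fun y hy => ?_
    obtain ⟨x, hx, rfl⟩ := List.mem_map.1 hy
    exact h x (List.mem_of_mem_erase (List.mem_of_mem_erase hx))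
  omega

/-- Positively oriented triangles with corners in `P` whose boundaries add up to the hull cycle. -/
structure IsFilling (σ : ℝ) (P : Finset Plane) {n : ℕ} (w : Fin n → Plane)
    (F : List (Plane × Plane × Plane)) : Prop where
  hull : IsHullCycle σ P w
  generic : Generic (P : Set Plane)
  mem : ∀ t ∈ F, ∀ p, Corner p t → p ∈ P
  pos : ∀ t ∈ F, 0 < sar σ t.1 t.2.1 t.2.2
  sum : ∀ c : Plane → Plane → ℤ, (∀ x y, c y x = - c x y) →
    (F.map (triSum c)).sum = ∑ i, c (w i) (w (finRotate n i))

namespace IsFilling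
variable {σ : ℝ} {P : Finset Plane} {n : ℕ} {w : Fin n → Plane}
  {F : List (Plane × Plane × Plane)}

/-- The triangles do not overlap: the triangles containing a point off all sides contribute one each to
the number of crossings of a ray from this point with the hull cycle, which is at most one. -/
theorem disjoint (h : IsFilling σ P w F) {t t' : Plane × Plane × Plane} (ht : t ∈ F)
    (ht' : t' ∈ F) (hne : t ≠ t') {x : Plane} (hx : Inside σ t x) (hx' : Inside σ t' x) :
    False := by
  have hσ := h.hull.isSign
  obtain ⟨x, ⟨hx, hx'⟩, hoff⟩ := exists_off_lines hσ
    (F.flatMap fun t => [(t.1, t.2.1), (t.2.1, t.2.2), (t.2.2, t.1)]) (by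
      intro e he
      rw [List.mem_flatMap] at he
      obtain ⟨s, hs, he⟩ := he
      have hp := h.pos s hs
      simp only [List.mem_cons, List.not_mem_nil, or_false] at he
      rcases he with rfl | rfl | rfl <;> intro hh <;> simp only at hh <;> rw [hh] at hp <;>
        simp at hp)
    ((isOpen_inside σ t).inter (isOpen_inside σ t')) ⟨x, hx, hx'⟩
  have hoff : ∀ s ∈ F, sar σ s.1 s.2.1 x ≠ 0 ∧ sar σ s.2.1 s.2.2 x ≠ 0 ∧
      sar σ s.2.2 s.1 x ≠ 0 := fun s hs =>
    ⟨hoff (s.1, s.2.1) (List.mem_flatMap.2 ⟨s, hs, by simp⟩),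
      hoff (s.2.1, s.2.2) (List.mem_flatMap.2 ⟨s, hs, by simp⟩),
      hoff (s.2.2, s.1) (List.mem_flatMap.2 ⟨s, hs, by simp⟩)⟩
  have hxy : x ≠ t.1 := by
    rintro rfl
    have := hx.1
    simp at this
  have hs := h.sum _ (crossNum_antisymm σ x t.1)
  have h1 := h.hull.sum_le_one x t.1
  have h2 := add_le_list_sum (l := F) (f := triSum (crossNum σ x t.1)) (fun s hs => by
    by_cases hin : Inside σ s x
    · rw [triSum_of_inside hσ hxy hin]; simp
    · obtain ⟨k1, k2, k3⟩ := hoff s hs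
      rw [triSum_of_outside (h.pos s hs) k1 k2 k3 hin]) ht ht' hne
  rw [triSum_of_inside hσ hxy hx, triSum_of_inside hσ hxy hx'] at h2
  omega

theorem not_enters (h : IsFilling σ P w F) {t t' : Plane × Plane × Plane} (ht : t ∈ F)
    (ht' : t' ∈ F) (hne : t ≠ t') {x z : Plane} (hx : EntersTri σ t x z)
    (hx' : EntersTri σ t' x z) : False := by
  obtain ⟨y, h1, h2⟩ := exists_inside_both hx hx'
  exact h.disjoint ht ht' hne h1 h2

/-- A point that is a corner of some triangle is inside no triangle. -/
theorem not_inside (h : IsFilling σ P w F) (hcov : ∀ p ∈ P, ∃ t ∈ F, Corner p t) {p : Plane}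
    (hp : p ∈ P) {t : Plane × Plane × Plane} (ht : t ∈ F) : ¬ Inside σ t p := by
  intro hin
  obtain ⟨s, hs, hc⟩ := hcov p hp
  have hne : s ≠ t := by rintro rfl; exact not_inside_corner hc hin
  obtain ⟨b, c, hr⟩ := hc.exists_rot
  have hpos := hr.pos (h.pos s hs)
  have e : EntersTri σ (p, b, c) p (AffineMap.lineMap b c (1 / 2 : ℝ)) := by
    refine ⟨Or.inr ⟨by simp, ?_⟩, Or.inl (sar_cyc_pos _ _ _ hpos), Or.inr ⟨by simp, ?_⟩⟩ <;>
      simp only [sar_lineMap, sar_self_right, sar_self_outer]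
    · linarith
    · rw [sar_cyc σ c p b]; linarith
  obtain ⟨y, h1, h2⟩ := exists_inside_both e (hin.entersTri _)
  exact h.disjoint hs ht hne (hr.inside.2 h1) h2

/-- Each hull edge is a side of a triangle: otherwise the sum over the boundaries of the triangles
would not see this edge. -/
theorem exists_corners_of_edge (h : IsFilling σ P w F) (i : Fin n) :
    ∃ t ∈ F, Corner (w i) t ∧ Corner (w (finRotate n i)) t := by
  classical
  set a := w i with ha
  set b := w (finRotate n i) with hb
  have hn := h.hull.three_le
  have hab : a ≠ b := fun e => finRotate_ne (by omega) i (h.hull.injective e).symm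
  set c : Plane → Plane → ℤ := fun u v =>
    (if u = a ∧ v = b then 1 else 0) - (if u = b ∧ v = a then 1 else 0) with hc
  have hs := h.sum c (fun x y => by
    simp only [hc, neg_sub]
    congr 1 <;> exact if_congr and_comm rfl rfl)
  have h1 : ∑ j, c (w j) (w (finRotate n j)) = 1 := by
    rw [Finset.sum_eq_single i]
    · simp only [hc]; rw [if_pos ⟨ha.symm, hb.symm⟩, if_neg (fun hh => hab (ha.trans hh.1))]; rfl
    · intro j _ hji
      simp only [hc]
      rw [if_neg (fun hh => hji (h.hull.injective hh.1)), if_neg]; · rfl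
      rintro ⟨h2, h3⟩
      have h2 := h.hull.injective h2
      have h3 := h.hull.injective h3
      rw [h2] at h3
      exact finRotate_finRotate_ne hn i h3
    · simp
  rw [h1] at hs
  by_contra hno
  push Not at hno
  have : (F.map (triSum c)).sum ≤ 0 := list_sum_nonpos fun t ht => by
    have hz : ∀ u v, Corner u t → Corner v t → c u v = 0 := by
      intro u v hu hv
      simp only [hc]
      rw [if_neg, if_neg]; · rfl
      · rintro ⟨rfl, rfl⟩; exact hno t ht hv hu
      · rintro ⟨rfl, rfl⟩; exact hno t ht hu hv
    simp only [triSum]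
    rw [hz _ _ (Or.inl rfl) (Or.inr (Or.inl rfl)), hz _ _ (Or.inr (Or.inl rfl)) (Or.inr (Or.inr rfl)),
      hz _ _ (Or.inr (Or.inr rfl)) (Or.inl rfl)]; simp
  omega

/-- Two triangles with crossing sides overlap. -/
theorem _root_.PointSet.Cross.exists_inside {σ : ℝ} (hσ : IsSign σ) {a b e c d g : Plane}
    (hc : Cross a b c d) (h1 : 0 < sar σ a b e) (h2 : 0 < sar σ c d g) :
    ∃ y, Inside σ (a, b, e) y ∧ Inside σ (c, d, g) y := by
  obtain ⟨s, t, s0, s1, t0, t1, hst⟩ := hc.exists_lineMap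
  obtain ⟨k1, k2⟩ := (cross_iff_sar hσ).1 hc
  obtain ⟨l, hl, hl'⟩ : ∃ l, 0 < sar σ c d l ∧ sar σ a b l = 0 := by
    rcases mul_neg_iff.1 k2 with ⟨k, -⟩ | ⟨-, k⟩
    · exact ⟨a, k, by simp⟩
    · exact ⟨b, k, by simp⟩
  obtain ⟨m, hm, hm'⟩ : ∃ l, 0 < sar σ a b l ∧ sar σ c d l = 0 := by
    rcases mul_neg_iff.1 k1 with ⟨k, -⟩ | ⟨-, k⟩
    · exact ⟨c, k, by simp⟩
    · exact ⟨d, k, by simp⟩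
  have core : ∀ a b e : Plane, ∀ s : ℝ, 0 < s → s < 1 → 0 < sar σ a b e →
      ∀ z, 0 < sar σ a b z → EntersTri σ (a, b, e) (AffineMap.lineMap a b s) z := by
    intro a b e s s0 s1 he z hz
    refine ⟨Or.inr ⟨by simp [sar_lineMap], hz⟩, Or.inl ?_, Or.inl ?_⟩ <;>
      simp only [sar_lineMap, sar_self_outer, sar_self_right]
    · rw [sar_cyc' σ b e a]
      have := mul_pos (sub_pos.2 s1) he
      linarith
    · rw [sar_cyc σ e a b]
      have := mul_pos s0 he
      linarith
  have e1 := core a b e s s0 s1 h1 (AffineMap.lineMap l m (1 / 2 : ℝ)) (by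
    rw [sar_lineMap, hl']; linarith)
  have e2 := core c d g t t0 t1 h2 (AffineMap.lineMap l m (1 / 2 : ℝ)) (by
    rw [sar_lineMap, hm']; linarith)
  rw [← hst] at e2
  exact exists_inside_both e1 e2

/-- Sides of the triangles do not cross. -/
theorem not_cross (h : IsFilling σ P w F) {t t' : Plane × Plane × Plane} (ht : t ∈ F)
    (ht' : t' ∈ F) {a b c d : Plane} (ha : Corner a t) (hb : Corner b t) (hab : a ≠ b)
    (hc : Corner c t') (hd : Corner d t') (hcd : c ≠ d) : ¬ Cross a b c d := by
  intro hx
  have hσ := h.hull.isSign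
  by_cases hne : t = t'
  · subst hne
    have hx' := fun hh => not_cross_of_mem (a := a) (b := b) (c := c) (d := d) hh hx
    obtain ⟨e, hr⟩ := ha.exists_rot₂ hb hab
    have key : ∀ p, Corner p t → p = a ∨ p = b ∨ p = e := by
      intro p hp
      rcases hr with hr | hr
      · exact hr.corner.1 hp
      · have := hr.corner.1 hp; tauto
    rcases key c hc with rfl | rfl | rfl
    · exact hx' (Or.inl rfl)
    · exact hx' (Or.inr (Or.inl rfl))
    · rcases key d hd with rfl | rfl | rfl
      · exact hx' (Or.inr (Or.inr (Or.inl rfl)))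
      · exact hx' (Or.inr (Or.inr (Or.inr rfl)))
      · exact hcd rfl
  · obtain ⟨e, hr⟩ := ha.exists_rot₂ hb hab
    obtain ⟨g, hr'⟩ := hc.exists_rot₂ hd hcd
    have fin : ∀ a b c d, Rot a b e t → Rot c d g t' → Cross a b c d → False := by
      intro a b c d hr hr' hx
      obtain ⟨y, h1, h2⟩ := hx.exists_inside hσ (hr.pos (h.pos t ht)) (hr'.pos (h.pos t' ht'))
      exact h.disjoint ht ht' hne (hr.inside.2 h1) (hr'.inside.2 h2)
    rcases hr with hr | hr <;> rcases hr' with hr' | hr'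
    · exact fin _ _ _ _ hr hr' hx
    · exact fin _ _ _ _ hr hr' hx.swap_right
    · exact fin _ _ _ _ hr hr' hx.swap_left
    · exact fin _ _ _ _ hr hr' hx.swap_left.swap_right

/-- The graph of the sides of the given triangles. -/
def _root_.PointSet.sideGraph (F : List (Plane × Plane × Plane)) : SimpleGraph Plane where
  Adj a b := a ≠ b ∧ ∃ t ∈ F, Corner a t ∧ Corner b t
  symm := ⟨fun _ _ h => ⟨h.1.symm, by obtain ⟨t, ht, h1, h2⟩ := h.2; exact ⟨t, ht, h2, h1⟩⟩⟩
  loopless := ⟨fun _ h => h.1 rfl⟩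

/-- If positively oriented triangles have boundaries that add up to the hull cycle and use all
points, then their sides form a triangulation. -/
theorem isTriangulation (h : IsFilling σ P w F) (hcov : ∀ p ∈ P, ∃ t ∈ F, Corner p t) :
    IsTriangulation P (sideGraph F) := by
  have hσ := h.hull.isSign
  have hg := h.generic
  refine ⟨(isNonCrossing_iff hg).2 ⟨?_, ?_⟩, ?_⟩
  · rintro a b ⟨-, t, ht, ha, hb⟩
    exact ⟨h.mem t ht a ha, h.mem t ht b hb⟩
  · rintro a b c d ⟨hab, t, ht, ha, hb⟩ ⟨hcd, t', ht', hc, hd⟩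
    exact h.not_cross ht ht' ha hb hab hc hd hcd
  · intro G hG hle p q hpq
    have hGc := (isNonCrossing_iff hg).1 hG
    obtain ⟨hp, hq⟩ := hGc.1 p q hpq
    by_contra hnadj
    have hne : p ≠ q := hpq.ne
    have hna : ∀ t ∈ F, Corner p t → ¬ Corner q t := fun t ht h1 h2 => hnadj ⟨hne, t, ht, h1, h2⟩
    have h1 := h.hull.one_le_sum hp hq hne (fun i hi hi' => by
      obtain ⟨t, ht, k1, k2⟩ := h.exists_corners_of_edge i
      exact hna t ht (hi ▸ k2) (hi' ▸ k1)) (fun i hi hi' => by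
      obtain ⟨t, ht, k1, k2⟩ := h.exists_corners_of_edge i
      exact hna t ht (hi ▸ k1) (hi' ▸ k2))
    rw [← h.sum _ (crossNum_antisymm σ p q)] at h1
    obtain ⟨t, ht, hpos⟩ : ∃ t ∈ F, 0 < triSum (crossNum σ p q) t := by
      by_contra hno
      push Not at hno
      have := list_sum_nonpos hno
      omega
    by_cases hc : Corner p t
    · obtain ⟨b, c, hr⟩ := hc.exists_rot
      have hcb : Corner b t := hr.corner.2 (Or.inr (Or.inl rfl))
      have hcc : Corner c t := hr.corner.2 (Or.inr (Or.inr rfl))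
      have htp := hr.pos (h.pos t ht)
      have hqb : q ≠ b := by rintro rfl; exact hna t ht hc hcb
      have hqc : q ≠ c := by rintro rfl; exact hna t ht hc hcc
      have hpb : p ≠ b := by rintro rfl; simp at htp
      have hpc : p ≠ c := by rintro rfl; simp at htp
      have hbc : b ≠ c := by rintro rfl; simp at htp
      have hbP := h.mem t ht b hcb
      have hcP := h.mem t ht c hcc
      rw [hr.triSum, triSum_of_corner] at hpos
      obtain ⟨k1, k2, k3⟩ : sar σ p q b ≤ 0 ∧ 0 < sar σ p q c ∧ 0 < sar σ b c p := by
        unfold crossNum at hpos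
        split_ifs at hpos with k k'
        · exact k
        · simp at hpos
        · simp at hpos
      have k1 := lt_of_le_of_ne k1 (hg.sar_ne hσ hp hq hbP hne hpb hqb)
      rcases hg.pos_or_neg hσ hbP hcP hq hbc hqb.symm hqc.symm with k4 | k4
      · refine h.not_inside hcov hq ht (hr.inside.2 ⟨?_, k4, ?_⟩)
        · simp only; rw [sar_swap']; linarith
        · simp only; rwa [sar_cyc]
      · refine hGc.2 p q b c hpq (hle ⟨hbc, t, ht, hcb, hcc⟩) ((cross_iff_sar hσ).2 ⟨?_, ?_⟩)
        · exact mul_neg_of_neg_of_pos k1 k2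
        · exact mul_neg_of_pos_of_neg k3 k4
    · have hin : ¬ Inside σ t p := h.not_inside hcov hp ht
      have htp := h.pos t ht
      have m1 := h.mem t ht t.1 (Or.inl rfl)
      have m2 := h.mem t ht t.2.1 (Or.inr (Or.inl rfl))
      have m3 := h.mem t ht t.2.2 (Or.inr (Or.inr rfl))
      simp only [Corner, not_or] at hc
      have n1 : t.1 ≠ t.2.1 := fun e => by rw [e] at htp; simp at htp
      have n2 : t.2.1 ≠ t.2.2 := fun e => by rw [e] at htp; simp at htp
      have n3 : t.2.2 ≠ t.1 := fun e => by rw [e] at htp; simp at htp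
      rw [triSum_of_outside htp (hg.sar_ne hσ m1 m2 hp n1 (Ne.symm hc.1) (Ne.symm hc.2.1))
        (hg.sar_ne hσ m2 m3 hp n2 (Ne.symm hc.2.1) (Ne.symm hc.2.2))
        (hg.sar_ne hσ m3 m1 hp n3 (Ne.symm hc.2.2) (Ne.symm hc.1)) hin] at hpos
      exact lt_irrefl _ hpos

end IsFilling

/-! ### The convex hull -/

theorem mem_convexHull_of_nonneg {σ : ℝ} {S : Set Plane} {a b c x : Plane} (ha : a ∈ S)
    (hb : b ∈ S) (hc : c ∈ S) (hD : 0 < sar σ a b c) (h1 : 0 ≤ sar σ a b x)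
    (h2 : 0 ≤ sar σ b c x) (h3 : 0 ≤ sar σ c a x) : x ∈ convexHull ℝ S := by
  set D := sar σ a b c with hDdef
  have hs : sar σ b c x + sar σ c a x + sar σ a b x = D := by
    have := sar_sum σ a b c x
    rw [sar_cyc σ x b c, sar_cyc' σ a x c] at this
    linarith
  have hmem := (convex_convexHull ℝ S).sum_mem (t := Finset.univ)
    (w := ![sar σ b c x / D, sar σ c a x / D, sar σ a b x / D]) (z := ![a, b, c])
    (by
      intro i _
      fin_cases i
      · exact div_nonneg h2 hD.le
      · exact div_nonneg h3 hD.le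
      · exact div_nonneg h1 hD.le)
    (by
      simp only [Fin.sum_univ_three]
      simp only [Matrix.cons_val]
      rw [← add_div, ← add_div, hs, div_self hD.ne'])
    (by
      intro i _
      fin_cases i
      · exact subset_convexHull ℝ S ha
      · exact subset_convexHull ℝ S hb
      · exact subset_convexHull ℝ S hc)
  convert hmem using 1
  have hD' := hD.ne'
  rw [hDdef] at hD' ⊢
  apply plane_ext <;>
  · simp only [Fin.sum_univ_three, Matrix.cons_val, PiLp.add_apply, PiLp.smul_apply, smul_eq_mul]
    field_simp
    simp only [sar, orientation]
    ring

/-- All points of `P` lie on one side of a hull edge. -/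
theorem IsHullEdge.same_side {P : Finset Plane} (hP : Generic (P : Set Plane)) {p q : Plane}
    (h : IsHullEdge P p q) {σ : ℝ} (hσ : IsSign σ) {r s : Plane} (hr : r ∈ P) (hs : s ∈ P)
    (hpos : 0 < sar σ p q r) (hsp : s ≠ p) (hsq : s ≠ q) : 0 < sar σ p q s := by
  have hp : p ∈ P := extremePoints_convexHull_subset h.1
  have hq : q ∈ P := extremePoints_convexHull_subset h.2.1
  rcases hP.pos_or_neg hσ hp hq hs h.2.2.1 hsp.symm hsq.symm with hc | hc
  · exact hc
  exfalso
  have hm : AffineMap.lineMap p q (1 / 2 : ℝ) ∈ frontier (convexHull ℝ (P : Set Plane)) := by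
    apply h.2.2.2
    rw [segment_eq_image_lineMap]
    exact Set.mem_image_of_mem _ ⟨by norm_num, by norm_num⟩
  refine hm.2 (mem_interior.2 ⟨{x | 0 < sar σ q r x} ∩ {x | 0 < sar σ r p x} ∩
    ({x | 0 < sar σ s q x} ∩ {x | 0 < sar σ p s x}), ?_, ?_, ?_⟩)
  · rintro x ⟨⟨h1, h2⟩, h3, h4⟩
    have h1 : 0 < sar σ q r x := h1
    have h2 : 0 < sar σ r p x := h2
    have h3 : 0 < sar σ s q x := h3
    have h4 : 0 < sar σ p s x := h4
    rcases le_or_gt 0 (sar σ p q x) with h0 | h0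
    · exact mem_convexHull_of_nonneg hp hq hr hpos h0 h1.le h2.le
    · refine mem_convexHull_of_nonneg (σ := σ) hq hp hs ?_ ?_ h4.le h3.le
      · rw [sar_swap]; linarith
      · rw [sar_swap]; linarith
  · exact ((isOpen_lt continuous_const (continuous_sar σ _ _)).inter
      (isOpen_lt continuous_const (continuous_sar σ _ _))).inter
      ((isOpen_lt continuous_const (continuous_sar σ _ _)).inter
      (isOpen_lt continuous_const (continuous_sar σ _ _)))
  · have e1 : sar σ q r p = sar σ p q r := (sar_cyc σ p q r).symm
    have e2 : sar σ r p q = sar σ p q r := (sar_cyc' σ p q r).symm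
    have e3 : sar σ s q p = - sar σ p q s := by simp only [sar, orientation]; ring
    have e4 : sar σ p s q = - sar σ p q s := by simp only [sar, orientation]; ring
    refine ⟨⟨?_, ?_⟩, ?_, ?_⟩ <;> rw [Set.mem_ofPred_eq, sar_lineMap] <;>
      simp only [e1, e2, e3, e4, sar_self_right, sar_self_outer] <;> linarith

/-- A closed cycle of hull edges runs around the whole point set. The sign is that of the first edge,
and is handed on from each edge to the next. -/
theorem exists_isHullCycle {P : Finset Plane} (hP : Generic (P : Set Plane)) {n : ℕ} (hn : 3 ≤ n)
    {w : Fin n → Plane} (hw : Function.Injective w)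
    (hedge : ∀ i, IsHullEdge P (w i) (w (finRotate n i))) : ∃ σ, IsHullCycle σ P w := by
  have hmem : ∀ i, w i ∈ P := fun i => extremePoints_convexHull_subset (hedge i).1
  have ne1 : ∀ i, finRotate n i ≠ i := fun i => finRotate_ne (by omega) i
  have ne2 : ∀ i, finRotate n (finRotate n i) ≠ i := fun i => finRotate_finRotate_ne hn i
  let i₀ : Fin n := ⟨0, by omega⟩
  obtain ⟨σ, hσ, h0⟩ : ∃ σ, IsSign σ ∧
      0 < sar σ (w i₀) (w (finRotate n i₀)) (w (finRotate n (finRotate n i₀))) := by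
    rcases hP.pos_or_neg isSign_one (hmem i₀) (hmem (finRotate n i₀))
      (hmem (finRotate n (finRotate n i₀))) (hw.ne (ne1 _).symm) (hw.ne (ne2 _).symm)
      (hw.ne (ne1 _).symm) with h | h
    · exact ⟨1, isSign_one, h⟩
    · exact ⟨-1, Or.inr rfl, by rw [sar_neg]; linarith⟩
  refine ⟨σ, hσ, hn, hw, hmem, fun i => finRotate_induction (by omega) (i := i₀)
    (p := fun i => ∀ q ∈ P, q ≠ w i → q ≠ w (finRotate n i) →
      0 < sar σ (w i) (w (finRotate n i)) q) ?_ ?_ i⟩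
  · intro i hi q hq h1 h2
    have := hi _ (hmem (finRotate n (finRotate n i))) (hw.ne (ne2 i)) (hw.ne (ne1 _))
    exact (hedge (finRotate n i)).same_side hP hσ (hmem i) hq (sar_cyc_pos _ _ _ this) h1 h2
  · intro q hq h1 h2
    exact (hedge i₀).same_side hP hσ (hmem _) hq h0 h1 h2

theorem finRotate_val {n : ℕ} (i : Fin n) (h : i.val + 1 < n) : (finRotate n i).val = i.val + 1 := by
  obtain ⟨k, rfl⟩ : ∃ k, n = k + 1 := ⟨n - 1, by omega⟩
  exact congrArg Fin.val (finRotate_of_lt (by omega : i.val < k))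

namespace IsHullCycle
variable {σ : ℝ} {P : Finset Plane} {n : ℕ} {w : Fin n → Plane}

/-- No vertex of the hull cycle lies inside a triangle. -/
theorem not_inside (h : IsHullCycle σ P w) {t : Plane × Plane × Plane}
    (ht : ∀ p, Corner p t → p ∈ P) (i : Fin n) : ¬ Inside σ t (w i) := by
  obtain ⟨a, b, c⟩ := t
  intro hin
  obtain ⟨h1, h2, h3⟩ := hin
  simp only at h1 h2 h3
  have ha := ht a (Or.inl rfl)
  have hb := ht b (Or.inr (Or.inl rfl))
  have hc := ht c (Or.inr (Or.inr rfl))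
  have key := (isAffine_sar σ (w i) (w (finRotate n i))).bary σ a b c (w i)
  have hD := sar_sum σ a b c (w i)
  rw [sar_self_outer, sar_cyc σ (w i) b c, sar_cyc' σ a (w i) c] at key
  rw [sar_cyc σ (w i) b c, sar_cyc' σ a (w i) c] at hD
  have p1 := mul_nonneg h2.le (h.nonneg i ha)
  have p2 := mul_nonneg h3.le (h.nonneg i hb)
  have p3 := mul_nonneg h1.le (h.nonneg i hc)
  have z1 : sar σ b c (w i) * sar σ (w i) (w (finRotate n i)) a = 0 := by linarith
  have z2 : sar σ c a (w i) * sar σ (w i) (w (finRotate n i)) b = 0 := by linarith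
  have z3 : sar σ a b (w i) * sar σ (w i) (w (finRotate n i)) c = 0 := by linarith
  have z1 := (mul_eq_zero.1 z1).resolve_left h2.ne'
  have z2 := (mul_eq_zero.1 z2).resolve_left h3.ne'
  have z3 := (mul_eq_zero.1 z3).resolve_left h1.ne'
  have hn := h.three_le
  exact not_all_zero h.isSign (h.injective.ne (finRotate_ne (by omega) i).symm)
    (by rw [hD]; positivity) z1 z2 z3

/-- A supporting line of the hull that touches it only in `w i`. -/
theorem exists_support (h : IsHullCycle σ P w) (i : Fin n) :
    ∃ f, IsAffine f ∧ f (w i) = 0 ∧ ∀ x ∈ P, x ≠ w i → 0 < f x := by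
  obtain ⟨l, rfl⟩ := (finRotate n).surjective i
  have hn := h.three_le
  refine ⟨fun y => sar σ (w l) (w (finRotate n l)) y +
    sar σ (w (finRotate n l)) (w (finRotate n (finRotate n l))) y,
    (isAffine_sar _ _ _).add (isAffine_sar _ _ _), by simp, fun x hx hne => ?_⟩
  have h1 := h.nonneg l hx
  have h2 := h.nonneg (finRotate n l) hx
  by_contra hle
  have z1 : sar σ (w l) (w (finRotate n l)) x = 0 := by linarith
  have z2 : sar σ (w (finRotate n l)) (w (finRotate n (finRotate n l))) x = 0 := by linarith
  have e1 := (h.eq_or_eq hx z1).resolve_right hne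
  have e2 := (h.eq_or_eq hx z2).resolve_left hne
  exact finRotate_finRotate_ne hn l (h.injective (e2.symm.trans e1))

/-- The hull cycle is a convex polygon. -/
theorem triple_pos (h : IsHullCycle σ P w) {i j k : Fin n} (hij : i < j) (hjk : j < k) :
    0 < sar σ (w i) (w j) (w k) := by
  obtain ⟨f, hf, hfi, hfpos⟩ := h.exists_support i
  have hpos : ∀ j, i < j → 0 < f (w j) := fun j hj =>
    hfpos _ (h.mem j) (h.injective.ne hj.ne')
  have step : ∀ j k : Fin n, i < j → k.val = j.val + 1 → 0 < sar σ (w i) (w j) (w k) := by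
    intro j k hj hk
    have hkr : finRotate n j = k := Fin.ext (by rw [finRotate_val j (by omega), hk])
    have := h.left j (w i) (h.mem i) (h.injective.ne hj.ne) (h.injective.ne (by
      rw [hkr]; intro e; rw [← e] at hk; have : i.val < j.val := hj; omega))
    rw [hkr] at this
    rwa [sar_cyc]
  obtain ⟨d, hd⟩ : ∃ d, k.val = j.val + 1 + d := ⟨k.val - j.val - 1, by
    have : j.val < k.val := hjk; omega⟩
  induction d generalizing k with
  | zero => exact step j k hij (by omega)
  | succ d ih =>
    have hlt : j.val + 1 + d < n := by omega
    have h1 := ih (k := ⟨j.val + 1 + d, hlt⟩) (by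
      show j.val < j.val + 1 + d; omega) rfl
    have hi' : i < ⟨j.val + 1 + d, hlt⟩ := by
      show i.val < j.val + 1 + d
      have : i.val < j.val := hij
      omega
    exact hf.sar_trans hfi (hpos j hij) (hpos _ hi') (hpos k (hij.trans hjk)) h1
      (step _ k hi' (by show k.val = j.val + 1 + d + 1; omega))

end IsHullCycle

/-! ### Signs in a generalized double circle -/

/-- Every non-crossing set of edges extends to a triangulation. -/
theorem exists_isTriangulation_ge {P : Finset Plane} {G : SimpleGraph Plane}
    (hG : IsNonCrossing P G) : ∃ T, G ≤ T ∧ IsTriangulation P T := by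
  have hfin : {T : SimpleGraph Plane | IsNonCrossing P T}.Finite := by
    refine Set.Finite.of_finite_image (f := fun T => {e : P × P | T.Adj e.1 e.2})
      (Set.toFinite _) ?_
    intro T hT T' hT' he
    ext a b
    have hT : IsNonCrossing P T := hT
    have hT' : IsNonCrossing P T' := hT'
    constructor
    · intro h
      obtain ⟨ha, hb⟩ := hT.1 a b h
      have : ((⟨a, ha⟩, ⟨b, hb⟩) : P × P) ∈ {e : P × P | T.Adj e.1 e.2} := h
      simp only at he
      rw [he] at this
      exact this
    · intro h
      obtain ⟨ha, hb⟩ := hT'.1 a b h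
      have : ((⟨a, ha⟩, ⟨b, hb⟩) : P × P) ∈ {e : P × P | T'.Adj e.1 e.2} := h
      simp only at he
      rw [← he] at this
      exact this
  obtain ⟨T, h1, h2⟩ := hfin.exists_le_maximal (show G ∈ _ from hG)
  exact ⟨T, h1, h2⟩

/-- An unavoidable edge is crossed by no segment between points of the set. -/
theorem IsUnavoidableEdge.not_cross {P : Finset Plane} (hP : Generic (P : Set Plane))
    {a b p q : Plane} (h : IsUnavoidableEdge P a b) (hp : p ∈ P) (hq : q ∈ P) :
    ¬ Cross p q a b := by
  intro hc
  have hpq : p ≠ q := by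
    rintro rfl
    have := hc.1
    simp [orientation] at this
  have hG : IsNonCrossing P (SimpleGraph.edge p q) := by
    rw [isNonCrossing_iff hP]
    constructor
    · intro x y hxy
      rw [SimpleGraph.edge_adj] at hxy
      rcases hxy.1 with ⟨rfl, rfl⟩ | ⟨rfl, rfl⟩
      · exact ⟨hp, hq⟩
      · exact ⟨hq, hp⟩
    · intro x y z u hxy hzu
      rw [SimpleGraph.edge_adj] at hxy hzu
      apply not_cross_of_mem
      rcases hxy.1 with ⟨rfl, rfl⟩ | ⟨rfl, rfl⟩ <;> rcases hzu.1 with ⟨rfl, rfl⟩ | ⟨rfl, rfl⟩ <;>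
        simp
  obtain ⟨T, hGT, hT⟩ := exists_isTriangulation_ge hG
  have h1 : T.Adj p q := hGT (by rw [SimpleGraph.edge_adj]; exact ⟨Or.inl ⟨rfl, rfl⟩, hpq⟩)
  exact ((isNonCrossing_iff hP).1 hT.prop).2 p q a b h1 (h T hT) hc

/-- A segment from a point inside a triangle to a point outside crosses a side. -/
theorem Generic.exists_exit {S : Set Plane} (hS : Generic S) {σ : ℝ} (hσ : IsSign σ)
    {A B C y z : Plane} (hA : A ∈ S) (hB : B ∈ S) (hC : C ∈ S) (hy : y ∈ S) (hz : z ∈ S)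
    (hin : Inside σ (A, B, C) y) (hzA : z ≠ A) (hzB : z ≠ B) (hzC : z ≠ C)
    (hout : ¬ Inside σ (A, B, C) z) : Cross A B y z ∨ Cross B C y z ∨ Cross C A y z := by
  obtain ⟨h1, h2, h3⟩ := hin
  simp only at h1 h2 h3
  have hyz : y ≠ z := by rintro rfl; exact hout ⟨h1, h2, h3⟩
  have hyA : y ≠ A := by rintro rfl; simp at h1
  have hyB : y ≠ B := by rintro rfl; simp at h1
  have hyC : y ≠ C := by rintro rfl; simp at h2
  have hAB : A ≠ B := by rintro rfl; simp at h1
  have hBC : B ≠ C := by rintro rfl; simp at h2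
  have hCA : C ≠ A := by rintro rfl; simp at h3
  have k1 := hS.sar_ne hσ hA hB hz hAB hzA.symm hzB.symm
  have k2 := hS.sar_ne hσ hB hC hz hBC hzB.symm hzC.symm
  have k3 := hS.sar_ne hσ hC hA hz hCA hzC.symm hzA.symm
  have sA := hS.sar_ne hσ hy hz hA hyz hyA hzA
  have sB := hS.sar_ne hσ hy hz hB hyz hyB hzB
  have sC := hS.sar_ne hσ hy hz hC hyz hyC hzC
  have by1 := sar_bary_self σ y z A B C
  have bz := sar_bary σ y z A B C z
  rw [sar_self_right, mul_zero, sar_cyc σ z B C, sar_cyc' σ A z C] at bz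
  have mk : ∀ A B : Plane, 0 < sar σ A B y → sar σ A B z < 0 →
      sar σ y z A * sar σ y z B < 0 → Cross A B y z := fun A B q1 q2 q3 =>
    (cross_iff_sar hσ).2 ⟨mul_neg_of_pos_of_neg q1 q2, q3⟩
  by_contra hno
  simp only [not_or] at hno
  obtain ⟨n1, n2, n3⟩ := hno
  have m1 : sar σ A B z < 0 → 0 < sar σ y z A * sar σ y z B := fun q =>
    lt_of_le_of_ne (not_lt.1 fun q' => n1 (mk _ _ h1 q q')) (mul_ne_zero sA sB).symm
  have m2 : sar σ B C z < 0 → 0 < sar σ y z B * sar σ y z C := fun q =>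
    lt_of_le_of_ne (not_lt.1 fun q' => n2 (mk _ _ h2 q q')) (mul_ne_zero sB sC).symm
  have m3 : sar σ C A z < 0 → 0 < sar σ y z C * sar σ y z A := fun q =>
    lt_of_le_of_ne (not_lt.1 fun q' => n3 (mk _ _ h3 q q')) (mul_ne_zero sC sA).symm
  -- a vertex `A` alone on its side of the line `y z` leads to a contradiction
  have iso : ∀ A B C : Plane, ∀ ε : ℝ, 0 < sar σ B C y → 0 < sar σ C A y → 0 < sar σ A B y →
      ¬ Inside σ (A, B, C) z → sar σ A B z ≠ 0 → sar σ B C z ≠ 0 → sar σ C A z ≠ 0 →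
      sar σ B C z * sar σ y z A + sar σ C A z * sar σ y z B + sar σ A B z * sar σ y z C = 0 →
      (sar σ A B z < 0 → 0 < sar σ y z A * sar σ y z B) →
      (sar σ C A z < 0 → 0 < sar σ y z C * sar σ y z A) →
      0 < ε * sar σ y z A → ε * sar σ y z B < 0 → ε * sar σ y z C < 0 → False := by
    intro A B C ε _ _ _ hout k1 k2 k3 bz m1 m3 qA qB qC
    have hε : ε ≠ 0 := by rintro rfl; simp at qA
    have hε2 : 0 < ε * ε := mul_self_pos.2 hε
    have p1 : 0 < sar σ A B z := by
      refine lt_of_le_of_ne (not_lt.1 fun q => ?_) k1.symm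
      have := mul_pos hε2 (m1 q)
      have := mul_neg_of_pos_of_neg qA qB
      nlinarith
    have p3 : 0 < sar σ C A z := by
      refine lt_of_le_of_ne (not_lt.1 fun q => ?_) k3.symm
      have := mul_pos hε2 (m3 q)
      have := mul_neg_of_pos_of_neg qA qC
      nlinarith
    have p2 : sar σ B C z < 0 := by
      refine lt_of_le_of_ne (not_lt.1 fun q => hout ⟨p1, q, p3⟩) k2
    have t1 := mul_neg_of_neg_of_pos p2 qA
    have t2 := mul_neg_of_pos_of_neg p3 qB
    have t3 := mul_neg_of_pos_of_neg p1 qC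
    have : ε * (sar σ B C z * sar σ y z A + sar σ C A z * sar σ y z B +
      sar σ A B z * sar σ y z C) < 0 := by linarith
    rw [bz] at this; simp at this
  have bz' : sar σ B C z * sar σ y z A + sar σ C A z * sar σ y z B + sar σ A B z * sar σ y z C = 0 := by
    linarith
  have out2 : ¬ Inside σ (B, C, A) z := fun q => hout ⟨q.2.2, q.1, q.2.1⟩
  have out3 : ¬ Inside σ (C, A, B) z := fun q => hout ⟨q.2.1, q.2.2, q.1⟩
  rcases lt_or_gt_of_ne sA with a | a <;> rcases lt_or_gt_of_ne sB with b | b <;>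
    rcases lt_or_gt_of_ne sC with c | c
  · have := mul_neg_of_pos_of_neg h2 a
    have := mul_neg_of_pos_of_neg h3 b
    have := mul_neg_of_pos_of_neg h1 c
    linarith
  · exact iso C A B 1 h1 h2 h3 out3 k3 k1 k2 (by linarith) m3 m2 (by linarith) (by linarith)
      (by linarith)
  · exact iso B C A 1 h3 h1 h2 out2 k2 k3 k1 (by linarith) m2 m1 (by linarith) (by linarith)
      (by linarith)
  · exact iso A B C (-1) h2 h3 h1 hout k1 k2 k3 (by linarith) m1 m3 (by linarith) (by linarith)
      (by linarith)
  · exact iso A B C 1 h2 h3 h1 hout k1 k2 k3 (by linarith) m1 m3 (by linarith) (by linarith)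
      (by linarith)
  · exact iso B C A (-1) h3 h1 h2 out2 k2 k3 k1 (by linarith) m2 m1 (by linarith) (by linarith)
      (by linarith)
  · exact iso C A B (-1) h1 h2 h3 out3 k3 k1 k2 (by linarith) m3 m2 (by linarith) (by linarith)
      (by linarith)
  · have := mul_pos h2 a
    have := mul_pos h3 b
    have := mul_pos h1 c
    linarith

/-! ### Labels of a generalized double circle -/

/-- Labels of the points of a generalized double circle: `⟨i, 0⟩` is the `i`-th hull vertex, and
`⟨i, j⟩` with `0 < j` is the `j`-th inner point of the `i`-th chain. -/
abbrev Lab {n : ℕ} (c : Fin n → ℕ) : Type := (i : Fin n) × Fin (c i + 1)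

section Labels
variable {n : ℕ} {c : Fin n → ℕ}

/-- The label of the `t`-th point of the `i`-th chain, whose last point is the next hull vertex. -/
def lab (c : Fin n → ℕ) (i : Fin n) (t : ℕ) : Lab c :=
  if h : t < c i + 1 then ⟨i, ⟨t, h⟩⟩ else ⟨finRotate n i, 0⟩

/-- The label `x` belongs to the `i`-th chain, including its two hull vertices. -/
def InChain (i : Fin n) (x : Lab c) : Prop := x.1 = i ∨ (x.1 = finRotate n i ∧ x.2.val = 0)

/-- The cyclic order of the labels, cut before the hull vertex `0`. -/
def LabLt (x y : Lab c) : Prop := x.1 < y.1 ∨ (x.1 = y.1 ∧ x.2.val < y.2.val)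

theorem lab_of_lt {i : Fin n} {t : ℕ} (h : t < c i + 1) : lab c i t = ⟨i, ⟨t, h⟩⟩ := dif_pos h

theorem lab_last (i : Fin n) : lab c i (c i + 1) = ⟨finRotate n i, 0⟩ := dif_neg (by omega)

theorem lab_zero (i : Fin n) : lab c i 0 = ⟨i, 0⟩ := lab_of_lt (by omega)

theorem lab_fst_snd (x : Lab c) : lab c x.1 x.2.val = x := lab_of_lt x.2.isLt

theorem inChain_lab (i : Fin n) (t : ℕ) : InChain i (lab c i t) := by
  unfold lab
  split_ifs with h
  · exact Or.inl rfl
  · exact Or.inr ⟨rfl, rfl⟩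

theorem inChain_self (x : Lab c) : InChain x.1 x := Or.inl rfl

theorem lab_injective (hn : 2 ≤ n) {i : Fin n} {s t : ℕ} (hs : s ≤ c i + 1) (ht : t ≤ c i + 1)
    (h : lab c i s = lab c i t) : s = t := by
  have hne := finRotate_ne hn i
  unfold lab at h
  split_ifs at h with h1 h2 h2
  · rw [Sigma.mk.injEq] at h
    have := eq_of_heq h.2
    exact congrArg Fin.val this
  · exact absurd (congrArg Sigma.fst h).symm hne
  · exact absurd (congrArg Sigma.fst h) hne
  · omega

end Labels

/-- The point with a given label. -/
def labPos {n : ℕ} (c : Fin n → ℕ) (v : Fin n → Plane) (a : (i : Fin n) → Fin (c i) → Plane)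
    (x : Lab c) : Plane := chain c v a x.1 x.2.castSucc

section DoubleCircle
variable {n : ℕ} {c : Fin n → ℕ} {v : Fin n → Plane} {a : (i : Fin n) → Fin (c i) → Plane}

theorem labPos_zero (i : Fin n) : labPos c v a ⟨i, 0⟩ = v i := rfl

theorem labPos_succ (i : Fin n) (j : Fin (c i)) : labPos c v a ⟨i, j.succ⟩ = a i j := by
  simp only [labPos, chain, Fin.castSucc_succ, Fin.cons_succ, Fin.snoc_castSucc]

theorem labPos_lab (i : Fin n) (t : Fin (c i + 2)) :
    labPos c v a (lab c i t.val) = chain c v a i t := by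
  refine Fin.lastCases ?_ (fun j => ?_) t
  · rw [Fin.val_last, lab_last, labPos_zero, ← Fin.succ_last]
    simp only [chain, Fin.cons_succ, Fin.snoc_last]
  · rw [Fin.val_castSucc, lab_of_lt j.isLt]
    rfl

theorem IsGeneralizedDoubleCircleWith.range_labPos {P : Finset Plane}
    (h : IsGeneralizedDoubleCircleWith c P v a) : Set.range (labPos c v a) = P := by
  rw [h.points]
  ext x
  simp only [Set.mem_range, Set.mem_union, Set.mem_iUnion]
  constructor
  · rintro ⟨⟨i, s⟩, rfl⟩
    refine Fin.cases ?_ (fun j => ?_) s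
    · exact Or.inl ⟨i, rfl⟩
    · exact Or.inr ⟨i, j, (labPos_succ i j).symm⟩
  · rintro (⟨i, rfl⟩ | ⟨i, j, rfl⟩)
    · exact ⟨⟨i, 0⟩, rfl⟩
    · exact ⟨⟨i, j.succ⟩, labPos_succ i j⟩

theorem IsGeneralizedDoubleCircleWith.labPos_injective {P : Finset Plane}
    (h : IsGeneralizedDoubleCircleWith c P v a) : Function.Injective (labPos c v a) := by
  classical
  have himg : (Finset.univ : Finset (Lab c)).image (labPos c v a) = P := by
    rw [← Finset.coe_inj, Finset.coe_image, Finset.coe_univ, Set.image_univ, h.range_labPos]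
  have hcard : (Finset.univ : Finset (Lab c)).card = P.card := by
    rw [h.card_eq, Finset.card_univ, Fintype.card_sigma]
    simp [Finset.sum_add_distrib, add_comm]
  rw [← himg] at hcard
  have := Finset.card_image_iff.1 hcard.symm
  intro x y hxy
  exact this (by simp) (by simp) hxy

end DoubleCircle

/-- The order information on the points of a generalized double circle that is used to place the
triangulation: the hull cycle, the position of all points on the left of the hull cycle, the
reflex chains, and the fact that no segment crosses the cycle of chains. -/
structure IsDoubleCircleSign (σ : ℝ) (P : Finset Plane) {n : ℕ} (c : Fin n → ℕ)
    (p : Lab c → Plane) : Prop where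
  hull : IsHullCycle σ P (fun i => p ⟨i, 0⟩)
  generic : Generic (P : Set Plane)
  injective : Function.Injective p
  mem : ∀ x, p x ∈ P
  reflex : ∀ i s t u, s < t → t < u → u ≤ c i + 1 →
    sar σ (p (lab c i s)) (p (lab c i t)) (p (lab c i u)) < 0
  not_cross : ∀ x y i t, t ≤ c i → ¬ Cross (p x) (p y) (p (lab c i t)) (p (lab c i (t + 1)))

/-- The points of a generalized double circle, with their labels, have the required signs. The convexity
of the chains does not say on which side they bend; the position on the left of the hull edge does. -/
theorem IsGeneralizedDoubleCircleWith.exists_isDoubleCircleSign {n : ℕ} {c : Fin n → ℕ}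
    {v : Fin n → Plane} {a : (i : Fin n) → Fin (c i) → Plane} {P : Finset Plane}
    (h : IsGeneralizedDoubleCircleWith c P v a) :
    ∃ σ, IsDoubleCircleSign σ P c (labPos c v a) := by
  have hg := h.generalPosition.generic
  have hinj := h.labPos_injective
  have hn := h.three_le
  have hmem : ∀ x, labPos c v a x ∈ P := fun x => by
    have : labPos c v a x ∈ Set.range (labPos c v a) := ⟨x, rfl⟩
    rw [h.range_labPos] at this
    exact this
  obtain ⟨σ, hσ⟩ := exists_isHullCycle hg h.three_le (w := v) (fun i j hij => by
    have := hinj (a₁ := ⟨i, 0⟩) (a₂ := ⟨j, 0⟩) hij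
    exact congrArg Sigma.fst this) h.hullEdge
  refine ⟨σ, hσ, hg, hinj, hmem, ?_, ?_⟩
  · intro i s t u hst htu hu
    have key := h.convex i
    have e : ∀ t : ℕ, (ht : t < c i + 2) → labPos c v a (lab c i t) = chain c v a i ⟨t, ht⟩ :=
      fun t ht => labPos_lab i ⟨t, ht⟩
    rw [e s (by omega), e t (by omega), e u (by omega)]
    -- the hull edge fixes the sense in which the chain is convex
    have h0 : 0 < sar σ (chain c v a i ⟨0, by omega⟩) (chain c v a i ⟨c i + 1, by omega⟩)
        (chain c v a i ⟨1, by omega⟩) := by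
      rw [← e 0, ← e (c i + 1), ← e 1, lab_zero, lab_last]
      refine hσ.left i _ (hmem _) ?_ ?_
      · intro hh
        have := lab_injective (c := c) (by omega) (by omega) (by omega) (hinj (hh.trans (by rw [lab_zero]; rfl) : labPos c v a (lab c i 1) = labPos c v a (lab c i 0)))
        omega
      · intro hh
        have := lab_injective (c := c) (by omega) (by omega) (by omega) (hinj (hh.trans (by rw [lab_last]; rfl) : labPos c v a (lab c i 1) = labPos c v a (lab c i (c i + 1))))
        omega
    rw [sar_swap'] at h0
    have f1 : (⟨0, by omega⟩ : Fin (c i + 2)) < ⟨1, by omega⟩ := by simp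
    have f2 : (⟨1, by omega⟩ : Fin (c i + 2)) < ⟨c i + 1, by omega⟩ := by
      simp only [Fin.mk_lt_mk]; omega
    have f3 : (⟨s, by omega⟩ : Fin (c i + 2)) < ⟨t, by omega⟩ := by simpa using hst
    have f4 : (⟨t, by omega⟩ : Fin (c i + 2)) < ⟨u, by omega⟩ := by simpa using htu
    unfold sar at h0 ⊢
    rcases key with key | key
    · have k1 := key _ _ _ f1 f2
      have k2 := key _ _ _ f3 f4
      rcases hσ.isSign with rfl | rfl
      · linarith
      · linarith
    · have k1 := key _ _ _ f1 f2
      have k2 := key _ _ _ f3 f4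
      rcases hσ.isSign with rfl | rfl
      · linarith
      · linarith
  · intro x y i t ht
    have := (h.unavoidable i ⟨t, by omega⟩).not_cross hg (hmem x) (hmem y)
    rwa [← labPos_lab, ← labPos_lab] at this

namespace IsDoubleCircleSign
variable {σ : ℝ} {P : Finset Plane} {n : ℕ} {c : Fin n → ℕ} {p : Lab c → Plane}

/-- A point whose label is an inner label of the chain `k` is not inside a triangle whose corners
are not among the points of the chain `k`, except for one end of that chain. -/
theorem not_inside_of_inner (h : IsDoubleCircleSign σ P c p) {x A B C : Lab c}
    (hx : x.2.val ≠ 0)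
    (hend : (∀ z, z = A ∨ z = B ∨ z = C → InChain x.1 z → z = lab c x.1 0) ∨
      (∀ z, z = A ∨ z = B ∨ z = C → InChain x.1 z → z = lab c x.1 (c x.1 + 1))) :
    ¬ Inside σ (p A, p B, p C) (p x) := by
  have hn := h.hull.three_le
  have hσ := h.hull.isSign
  obtain ⟨k, s⟩ := x
  simp only at hx hend
  have hcor : ∀ i, ¬ Inside σ (p A, p B, p C) (p ⟨i, 0⟩) := fun i =>
    h.hull.not_inside (fun q hq => by
      rcases hq with rfl | rfl | rfl <;> exact h.mem _) i
  -- walking along the chain one cannot leave the triangle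
  have step : ∀ y z : Lab c, Inside σ (p A, p B, p C) (p y) → z ≠ A → z ≠ B → z ≠ C →
      (∀ u w, ¬ Cross (p u) (p w) (p y) (p z)) → Inside σ (p A, p B, p C) (p z) := by
    intro y z hy h1 h2 h3 hc
    by_contra hout
    rcases h.generic.exists_exit hσ (h.mem A) (h.mem B) (h.mem C) (h.mem y) (h.mem z) hy
      (h.injective.ne h1) (h.injective.ne h2) (h.injective.ne h3) hout with q | q | q
    · exact hc _ _ q
    · exact hc _ _ q
    · exact hc _ _ q
  intro hin
  have hs : (⟨k, s⟩ : Lab c) = lab c k s.val := (lab_of_lt s.isLt).symm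
  rw [hs] at hin
  have hslt := s.isLt
  rcases hend with hend | hend
  · have hup : ∀ d, s.val + d ≤ c k + 1 → Inside σ (p A, p B, p C) (p (lab c k (s.val + d))) := by
      intro d
      induction d with
      | zero => intro _; exact hin
      | succ d ih =>
        intro hd
        have hne : ∀ z, z = A ∨ z = B ∨ z = C → lab c k (s.val + (d + 1)) ≠ z := by
          intro z hz e
          have := hend z hz (e ▸ inChain_lab k _)
          rw [← e] at this
          have := lab_injective (by omega) hd (by omega) this
          omega
        exact step _ _ (ih (by omega)) (hne _ (Or.inl rfl)) (hne _ (Or.inr (Or.inl rfl)))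
          (hne _ (Or.inr (Or.inr rfl))) fun u w => h.not_cross u w k (s.val + d) (by omega)
    have := hup (c k + 1 - s.val) (by omega)
    rw [show s.val + (c k + 1 - s.val) = c k + 1 by omega, lab_last] at this
    exact hcor _ this
  · have hdown : ∀ d, d ≤ s.val → Inside σ (p A, p B, p C) (p (lab c k (s.val - d))) := by
      intro d
      induction d with
      | zero => intro _; exact hin
      | succ d ih =>
        intro hd
        have hne : ∀ z, z = A ∨ z = B ∨ z = C → lab c k (s.val - (d + 1)) ≠ z := by
          intro z hz e
          have := hend z hz (e ▸ inChain_lab k _)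
          rw [← e] at this
          have := lab_injective (by omega) (by omega) (by omega) this
          omega
        refine step _ _ (ih (by omega)) (hne _ (Or.inl rfl)) (hne _ (Or.inr (Or.inl rfl)))
          (hne _ (Or.inr (Or.inr rfl))) fun u w hc => ?_
        have := h.not_cross u w k (s.val - (d + 1)) (by omega)
        rw [show s.val - (d + 1) + 1 = s.val - d by omega] at this
        exact this hc.swap_right
    have := hdown s.val le_rfl
    rw [Nat.sub_self, lab_zero] at this
    exact hcor _ this

/-- No point is inside a triangle two of whose corners are on a chain `i` not containing the point,
provided the third corner is on the chain `i` as well or is separated from the point by the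
chains. -/
theorem not_inside (h : IsDoubleCircleSign σ P c p) {i : Fin n} {x A B C : Lab c}
    (hx : ¬ InChain i x) (hA : InChain i A) (hB : InChain i B)
    (hC : InChain i C ∨ (x.2.val ≠ 0 → ¬ InChain x.1 C)) :
    ¬ Inside σ (p A, p B, p C) (p x) := by
  have hn := h.hull.three_le
  by_cases hx0 : x.2.val = 0
  · have : x = ⟨x.1, 0⟩ := by
      obtain ⟨k, s⟩ := x
      congr 1
      exact Fin.ext hx0
    rw [this]
    exact h.hull.not_inside (fun q hq => by
      rcases hq with rfl | rfl | rfl <;> exact h.mem _) _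
  have hik : x.1 ≠ i := fun e => hx (Or.inl e)
  -- a common label of the chains is the first of one and the last of the other
  have shared : ∀ z, InChain i z → InChain x.1 z →
      (z = lab c x.1 0 ∧ x.1 = finRotate n i) ∨
        (z = lab c x.1 (c x.1 + 1) ∧ i = finRotate n x.1) := by
    rintro ⟨k, s⟩ h1 h2
    rcases h1 with h1 | ⟨h1, h1'⟩ <;> rcases h2 with h2 | ⟨h2, h2'⟩
    · exact absurd (h2.symm.trans h1) hik
    · right
      refine ⟨?_, h1.symm.trans h2⟩
      rw [lab_last]
      simp only at h2 h2'
      subst h2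
      congr 1
      exact Fin.ext h2'
    · left
      refine ⟨?_, h2.symm.trans h1⟩
      rw [lab_zero]
      simp only at h2 h1'
      subst h2
      congr 1
      exact Fin.ext h1'
    · exact absurd ((finRotate n).injective (h2.symm.trans h1)) hik
  have all : ∀ z, z = A ∨ z = B ∨ z = C → InChain x.1 z → InChain i z := by
    rintro z (rfl | rfl | rfl) hz
    · exact hA
    · exact hB
    · rcases hC with hC | hC
      · exact hC
      · exact absurd hz (hC hx0)
  refine h.not_inside_of_inner hx0 ?_
  by_cases hxi : x.1 = finRotate n i
  · left
    intro z hz hzx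
    refine ((shared z (all z hz hzx) hzx).resolve_right ?_).1
    rintro ⟨-, e⟩
    rw [hxi] at e
    exact finRotate_finRotate_ne hn i e.symm
  · right
    intro z hz hzx
    exact ((shared z (all z hz hzx) hzx).resolve_left fun e => hxi e.2).1

/-- A point off a chain is not in the angle under which an edge of the chain is seen from another point
of the chain: it would be inside a triangle of chain points, or be seen through that edge. -/
theorem not_in_angle (h : IsDoubleCircleSign σ P c p) {i : Fin n} {q : Lab c} {z t : ℕ}
    (hq : ¬ InChain i q) (ht : t ≤ c i)
    (h0 : sar σ (p (lab c i z)) (p (lab c i t)) (p (lab c i (t + 1))) < 0)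
    (h1 : sar σ (p (lab c i z)) (p (lab c i t)) (p q) < 0)
    (h2 : 0 < sar σ (p (lab c i z)) (p (lab c i (t + 1))) (p q)) : False := by
  have hn := h.hull.three_le
  have hσ := h.hull.isSign
  have hne : ∀ t, lab c i t ≠ q := fun t e => hq (e ▸ inChain_lab i t)
  have hgg : lab c i t ≠ lab c i (t + 1) := fun e => by
    have := lab_injective (by omega) (by omega) (by omega) e
    omega
  rcases h.generic.pos_or_neg hσ (h.mem (lab c i t)) (h.mem (lab c i (t + 1))) (h.mem q)
    (h.injective.ne hgg) (h.injective.ne (hne _)) (h.injective.ne (hne _)) with k | k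
  · refine h.not_cross (lab c i z) q i t ht ((cross_iff_sar hσ).2 ⟨?_, ?_⟩)
    · rw [sar_swap' σ (p (lab c i z)) (p (lab c i t)), sar_swap' σ (p (lab c i z)) (p (lab c i (t + 1)))]
      nlinarith [mul_pos (neg_pos.2 h1) h2]
    · rw [← sar_cyc σ (p (lab c i z))]
      exact mul_neg_of_neg_of_pos h0 k
  · refine h.not_inside (x := q) (A := lab c i z) (B := lab c i (t + 1)) (C := lab c i t) hq
      (inChain_lab _ _) (inChain_lab _ _) (Or.inl (inChain_lab _ _)) ⟨h2, ?_, ?_⟩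
    · rw [sar_swap]; linarith
    · rw [sar_swap]; linarith

theorem exists_sign_change {f : ℕ → ℝ} {a b : ℕ} (hab : a ≤ b) (ha : f a < 0) (hb : 0 < f b)
    (hne : ∀ t, a ≤ t → t ≤ b → f t ≠ 0) : ∃ t, a ≤ t ∧ t < b ∧ f t < 0 ∧ 0 < f (t + 1) := by
  by_contra hno
  push Not at hno
  have : ∀ d, a + d ≤ b → f (a + d) < 0 := by
    intro d
    induction d with
    | zero => intro _; exact ha
    | succ d ih =>
      intro hd
      exact lt_of_le_of_ne (hno (a + d) (by omega) (by omega) (ih (by omega)))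
        (hne _ (by omega) hd)
  have := this (b - a) (by omega)
  rw [show a + (b - a) = b by omega] at this
  linarith

/-- All points outside a chain are to the left of all its chords. -/
theorem chord_pos (h : IsDoubleCircleSign σ P c p) {i : Fin n} {q : Lab c} {s t : ℕ}
    (hq : ¬ InChain i q) (hst : s < t) (ht : t ≤ c i + 1) :
    0 < sar σ (p (lab c i s)) (p (lab c i t)) (p q) := by
  have hn := h.hull.three_le
  have hσ := h.hull.isSign
  have hne : ∀ t, lab c i t ≠ q := fun t e => hq (e ▸ inChain_lab i t)
  have hgg : ∀ s t, s ≤ c i + 1 → t ≤ c i + 1 → s ≠ t → p (lab c i s) ≠ p (lab c i t) :=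
    fun s t hs ht hst => h.injective.ne fun e => hst (lab_injective (by omega) hs ht e)
  have nz : ∀ s t, s ≤ c i + 1 → t ≤ c i + 1 → s ≠ t →
      sar σ (p (lab c i s)) (p (lab c i t)) (p q) ≠ 0 := fun s t hs ht hst =>
    h.generic.sar_ne hσ (h.mem _) (h.mem _) (h.mem _) (hgg s t hs ht hst)
      (h.injective.ne (hne _)) (h.injective.ne (hne _))
  have base : 0 < sar σ (p (lab c i 0)) (p (lab c i (c i + 1))) (p q) := by
    have h1 := hne 0
    have h2 := hne (c i + 1)
    rw [lab_zero] at h1 ⊢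
    rw [lab_last] at h2 ⊢
    exact h.hull.left i _ (h.mem q) (h.injective.ne h1.symm) (h.injective.ne h2.symm)
  have fromZero : ∀ t, 0 < t → t ≤ c i + 1 → 0 < sar σ (p (lab c i 0)) (p (lab c i t)) (p q) := by
    intro t ht0 ht
    by_contra hneg
    have hneg := lt_of_le_of_ne (not_lt.1 hneg) (nz 0 t (by omega) ht (by omega))
    obtain ⟨j, hj1, hj2, hj3, hj4⟩ := exists_sign_change
      (f := fun j => sar σ (p (lab c i 0)) (p (lab c i j)) (p q)) ht hneg base
      fun j h1 h2 => nz 0 j (by omega) h2 (by omega)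
    exact h.not_in_angle (z := 0) hq (by omega)
      (h.reflex i 0 j (j + 1) (by omega) (by omega) (by omega)) hj3 hj4
  by_contra hneg
  have hneg := lt_of_le_of_ne (not_lt.1 hneg) (nz s t (by omega) ht (by omega))
  obtain ⟨j, hj1, hj2, hj3, hj4⟩ := exists_sign_change
    (f := fun j => - sar σ (p (lab c i j)) (p (lab c i t)) (p q)) (Nat.zero_le s)
    (by have := fromZero t (by omega) ht; linarith) (by linarith)
    fun j h1 h2 => neg_ne_zero.2 (nz j t (by omega) ht (by omega))
  refine h.not_in_angle (z := t) (t := j) hq (by omega) ?_ ?_ ?_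
  · have := h.reflex i j (j + 1) t (by omega) (by omega) ht
    rwa [sar_cyc]
  · rw [sar_swap]; simpa using hj3
  · rw [sar_swap]; simpa using hj4

/-- Moving one corner of a positive triangle along a chain keeps it positive. -/
theorem slide (h : IsDoubleCircleSign σ P c p) {i : Fin n} {s : ℕ} {y z : Lab c}
    (hs : s ≤ c i + 1) (hy : ¬ InChain i y) (hz : ¬ InChain i z)
    (hyz : ∀ j, InChain j y → ¬ InChain j z)
    (hpos : 0 < sar σ (p (lab c i 0)) (p y) (p z)) : 0 < sar σ (p (lab c i s)) (p y) (p z) := by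
  have hσ := h.hull.isSign
  have hne : ∀ q, ¬ InChain i q → ∀ t, lab c i t ≠ q := fun q hq t e => hq (e ▸ inChain_lab i t)
  have hyz' : y ≠ z := by rintro rfl; exact hyz _ (inChain_self y) (inChain_self y)
  have nz : ∀ t, sar σ (p y) (p z) (p (lab c i t)) ≠ 0 := fun t =>
    h.generic.sar_ne hσ (h.mem _) (h.mem _) (h.mem _) (h.injective.ne hyz')
      (h.injective.ne (hne y hy t).symm) (h.injective.ne (hne z hz t).symm)
  rw [sar_cyc] at hpos ⊢
  by_contra hneg
  have hneg := lt_of_le_of_ne (not_lt.1 hneg) (nz s)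
  obtain ⟨t, ht1, ht2, ht3, ht4⟩ := exists_sign_change
    (f := fun t => - sar σ (p y) (p z) (p (lab c i t))) (Nat.zero_le s)
    (by linarith) (by linarith) fun t _ _ => neg_ne_zero.2 (nz t)
  have k := h.chord_pos (s := t) (t := t + 1) hy (by omega) (by omega)
  refine h.not_inside (x := y) (A := lab c i t) (B := lab c i (t + 1)) (C := z) hy
    (inChain_lab _ _) (inChain_lab _ _) (Or.inr fun _ => hyz _ (inChain_self y)) ⟨k, ?_, ?_⟩
  · rw [sar_rev]; exact ht4
  · rw [← sar_cyc]; linarith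

/-- Two labels of one chain occur along this chain in their cyclic order, except that the last chain ends
in the hull vertex `0`, which precedes all other labels. -/
theorem _root_.PointSet.LabLt.exists_lab {x y : Lab c} (hn : 2 ≤ n) (hxy : LabLt x y) {i : Fin n}
    (hx : InChain i x) (hy : InChain i y) :
    (∃ s t, s < t ∧ t ≤ c i + 1 ∧ x = lab c i s ∧ y = lab c i t) ∨
      ∃ s, s < c i + 1 ∧ x = lab c i (c i + 1) ∧ y = lab c i s ∧ x.1.val = 0 ∧ x.2.val = 0 ∧
        i.val = n - 1 := by
  obtain ⟨k, s⟩ := x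
  obtain ⟨l, t⟩ := y
  have hs := s.isLt
  have ht := t.isLt
  rcases hx with hx | ⟨hx, hx'⟩ <;> rcases hy with hy | ⟨hy, hy'⟩ <;> simp only at hx hy
  · subst hx hy
    left
    refine ⟨s.val, t.val, ?_, by omega, (lab_of_lt s.isLt).symm, (lab_of_lt t.isLt).symm⟩
    rcases hxy with hxy | hxy
    · exact absurd hxy (lt_irrefl _)
    · exact hxy.2
  · subst hx hy
    left
    refine ⟨s.val, c k + 1, hs, le_rfl, (lab_of_lt s.isLt).symm, ?_⟩
    rw [lab_last]
    congr 1
    exact Fin.ext hy'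
  · subst hx hy
    right
    have hlt : (finRotate n l).val < l.val := by
      rcases hxy with hxy | hxy
      · exact hxy
      · exact absurd hxy.1 (finRotate_ne hn l)
    have hl : l.val = n - 1 := by
      by_contra hl
      rw [finRotate_val l (by have := l.isLt; omega)] at hlt
      omega
    refine ⟨t.val, ht, ?_, (lab_of_lt t.isLt).symm, ?_, hx', hl⟩
    · rw [lab_last]
      congr 1
      exact Fin.ext hx'
    · obtain ⟨m, rfl⟩ : ∃ m, n = m + 1 := ⟨n - 1, by omega⟩
      have : l = Fin.last m := Fin.ext (by simpa using hl)
      simp only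
      rw [this, finRotate_last]; rfl
  · subst hx hy
    exfalso
    simp only at hx' hy'
    rcases hxy with hxy | hxy
    · exact absurd hxy (lt_irrefl _)
    · have := hxy.2
      simp only at this
      omega

/-- Three points in cyclic order, not all on one chain, are in counterclockwise order. -/
theorem triple_pos (h : IsDoubleCircleSign σ P c p) {x y z : Lab c} (hxy : LabLt x y)
    (hyz : LabLt y z) (hnc : ¬ ∃ i, InChain i x ∧ InChain i y ∧ InChain i z) :
    0 < sar σ (p x) (p y) (p z) := by
  have hn := h.hull.three_le
  induction hm : x.2.val + y.2.val + z.2.val using Nat.strong_induction_on generalizing x y z with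
  | _ m ih =>
  subst hm
  by_cases h1 : ∃ i, InChain i x ∧ InChain i y
  · obtain ⟨i, hx, hy⟩ := h1
    have hz : ¬ InChain i z := fun hz => hnc ⟨i, hx, hy, hz⟩
    rcases hxy.exists_lab (by omega) hx hy with ⟨s, t, hst, ht, rfl, rfl⟩ | ⟨s, hs, -, rfl, -, -, hi⟩
    · exact h.chord_pos hz hst ht
    · exfalso
      rw [lab_of_lt hs] at hyz
      rcases hyz with k | k
      · have : i.val < z.1.val := k
        have := z.1.isLt
        omega
      · exact hz (Or.inl k.1.symm)
  by_cases h2 : ∃ i, InChain i y ∧ InChain i z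
  · obtain ⟨i, hy, hz⟩ := h2
    have hx : ¬ InChain i x := fun hx => hnc ⟨i, hx, hy, hz⟩
    rw [sar_cyc]
    rcases hyz.exists_lab (by omega) hy hz with ⟨s, t, hst, ht, rfl, rfl⟩ | ⟨s, -, -, -, h3, h4, -⟩
    · exact h.chord_pos hx hst ht
    · exfalso
      rcases hxy with k | k
      · have : x.1.val < y.1.val := k
        omega
      · have := k.2
        omega
  by_cases h3 : ∃ i, InChain i x ∧ InChain i z
  · obtain ⟨i, hx, hz⟩ := h3
    have hy : ¬ InChain i y := fun hy => hnc ⟨i, hx, hy, hz⟩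
    have hxz : LabLt x z := by
      rcases hxy with k | k <;> rcases hyz with k' | k'
      · exact Or.inl (k.trans k')
      · exact Or.inl (k'.1 ▸ k)
      · exact Or.inl (k.1 ▸ k')
      · exact Or.inr ⟨k.1.trans k'.1, k.2.trans k'.2⟩
    rcases hxz.exists_lab (by omega) hx hz with ⟨s, t, hst, ht, rfl, rfl⟩ | ⟨s, hs, rfl, rfl, -, -, -⟩
    · exfalso
      rw [lab_of_lt (by omega : s < c i + 1)] at hxy hxz
      have hy' : i.val ≠ y.1.val := fun e => hy (Or.inl (Fin.ext e.symm))
      have l1 : i.val < y.1.val := by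
        rcases hxy with k | k
        · exact k
        · exact absurd (congrArg Fin.val k.1) hy'
      by_cases htl : t < c i + 1
      · rw [lab_of_lt htl] at hyz
        rcases hyz with k | k
        · have : y.1.val < i.val := k
          omega
        · exact hy' (congrArg Fin.val k.1).symm
      · obtain rfl : t = c i + 1 := by omega
        rw [lab_last] at hyz
        have hyl := y.1.isLt
        have hr := finRotate_val i (by omega)
        rcases hyz with k | k
        · have : y.1.val < (finRotate n i).val := k
          omega
        · have := k.2
          simp at this
    · rw [sar_cyc']
      exact h.chord_pos hy hs le_rfl
  -- no two of the points are on a common chain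
  have lt_of : ∀ {x y : Lab c}, LabLt x y → (¬ ∃ i, InChain i x ∧ InChain i y) → x.1 < y.1 := by
    intro x y hxy hno
    rcases hxy with k | k
    · exact k
    · exact absurd ⟨y.1, Or.inl k.1, Or.inl rfl⟩ hno
  have lxy := lt_of hxy h1
  have lyz := lt_of hyz h2
  have n12 : ∀ i, InChain i x → ¬ InChain i y := fun i k k' => h1 ⟨i, k, k'⟩
  have n23 : ∀ i, InChain i y → ¬ InChain i z := fun i k k' => h2 ⟨i, k, k'⟩
  have n13 : ∀ i, InChain i x → ¬ InChain i z := fun i k k' => h3 ⟨i, k, k'⟩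
  by_cases hx0 : x.2.val ≠ 0
  · have := ih (0 + y.2.val + z.2.val) (by omega) (x := ⟨x.1, 0⟩) (y := y) (z := z)
      (Or.inl lxy) (Or.inl lyz) (fun ⟨i, _, k, k'⟩ => h2 ⟨i, k, k'⟩) rfl
    rw [← lab_zero] at this
    have := h.slide (s := x.2.val) (by omega) (n12 _ (inChain_self x)) (n13 _ (inChain_self x)) n23
      this
    rwa [lab_fst_snd] at this
  by_cases hy0 : y.2.val ≠ 0
  · have := ih (x.2.val + 0 + z.2.val) (by omega) (x := x) (y := ⟨y.1, 0⟩) (z := z)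
      (Or.inl lxy) (Or.inl lyz) (fun ⟨i, k, _, k'⟩ => h3 ⟨i, k, k'⟩) rfl
    rw [← lab_zero, sar_cyc] at this
    have := h.slide (s := y.2.val) (by omega) (n23 _ (inChain_self y))
      (fun k => n12 _ k (inChain_self y)) (fun j k k' => n13 j k' k) this
    rwa [lab_fst_snd, ← sar_cyc] at this
  by_cases hz0 : z.2.val ≠ 0
  · have := ih (x.2.val + y.2.val + 0) (by omega) (x := x) (y := y) (z := ⟨z.1, 0⟩)
      (Or.inl lxy) (Or.inl lyz) (fun ⟨i, k, k', _⟩ => h1 ⟨i, k, k'⟩) rfl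
    rw [← lab_zero, sar_cyc'] at this
    have := h.slide (s := z.2.val) (by omega) (fun k => n13 _ k (inChain_self z))
      (fun k => n23 _ k (inChain_self z)) n12 this
    rwa [lab_fst_snd, ← sar_cyc'] at this
  have e : ∀ x : Lab c, ¬ x.2.val ≠ 0 → x = ⟨x.1, 0⟩ := by
    rintro ⟨k, s⟩ hs
    congr 1
    exact Fin.ext (not_not.1 hs)
  rw [e x hx0, e y hy0, e z hz0]
  exact h.hull.triple_pos lxy lyz

end IsDoubleCircleSign

/-! ### Distributing the inner points to the hull edges -/

/-- The points assigned to the `i`-th hull edge, together with the ends of that edge. -/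
def Cls {n : ℕ} (w : Fin n → Plane) (S : Fin n → Finset Plane) (i : Fin n) (x : Plane) : Prop :=
  x = w i ∨ x = w (finRotate n i) ∨ x ∈ S i

/-- A distribution of the inner points of `Q` to the hull edges. The last condition expresses that
the product of the distances of the points from their hull edges cannot be decreased by exchanging
two points. -/
structure IsDistribution (σ : ℝ) (Q : Finset Plane) {n : ℕ} (w : Fin n → Plane)
    (S : Fin n → Finset Plane) : Prop where
  hull : IsHullCycle σ Q w
  generic : Generic (Q : Set Plane)
  subset : ∀ i, S i ⊆ Q
  ne_corner : ∀ i, ∀ x ∈ S i, ∀ j, x ≠ w j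
  disjoint : ∀ i j x, x ∈ S i → x ∈ S j → i = j
  cover : ∀ x ∈ Q, (∃ i, x = w i) ∨ ∃ i, x ∈ S i
  exchange : ∀ i j x y, Cls w S i x → Cls w S j y →
    sar σ (w i) (w (finRotate n i)) x * sar σ (w j) (w (finRotate n j)) y ≤
      sar σ (w i) (w (finRotate n i)) y * sar σ (w j) (w (finRotate n j)) x

/-- A bijection minimizing a product of positive weights satisfies the exchange condition. -/
theorem exists_equiv_exchange {α β : Type*} [Finite α] (e₀ : α ≃ β) (d : β → α → ℝ)
    (hd : ∀ b a, 0 < d b a) :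
    ∃ e : α ≃ β, ∀ x y, d (e x) x * d (e y) y ≤ d (e x) y * d (e y) x := by
  classical
  have := Fintype.ofFinite α
  have := Fintype.ofEquiv α e₀
  obtain ⟨e, -, he⟩ := (Finset.univ : Finset (α ≃ β)).exists_min_image
    (fun e => ∏ x, d (e x) x) ⟨e₀, by simp⟩
  refine ⟨e, fun x y => ?_⟩
  by_cases hxy : x = y
  · subst hxy; exact le_rfl
  have h1 := he ((Equiv.swap x y).trans e) (by simp)
  have split : ∀ f : α → ℝ, ∏ z, f z = f x * (f y * ∏ z ∈ (Finset.univ.erase x).erase y, f z) := by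
    intro f
    rw [Finset.mul_prod_erase _ _ (Finset.mem_erase.2 ⟨Ne.symm hxy, Finset.mem_univ y⟩),
      Finset.mul_prod_erase _ _ (Finset.mem_univ x)]
  rw [split, split] at h1
  simp only [Equiv.trans_apply, Equiv.swap_apply_left, Equiv.swap_apply_right] at h1
  have h2 : ∏ z ∈ (Finset.univ.erase x).erase y, d (e (Equiv.swap x y z)) z =
      ∏ z ∈ (Finset.univ.erase x).erase y, d (e z) z := by
    refine Finset.prod_congr rfl fun z hz => ?_
    simp only [Finset.mem_erase, Finset.mem_univ, and_true] at hz
    rw [Equiv.swap_apply_of_ne_of_ne hz.2 hz.1]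
  rw [h2] at h1
  have h3 : 0 < ∏ z ∈ (Finset.univ.erase x).erase y, d (e z) z :=
    Finset.prod_pos fun z _ => hd _ _
  have h4 : (d (e x) x * d (e y) y) * ∏ z ∈ (Finset.univ.erase x).erase y, d (e z) z ≤
      (d (e x) y * d (e y) x) * ∏ z ∈ (Finset.univ.erase x).erase y, d (e z) z := by
    linarith
  exact le_of_mul_le_mul_right h4 h3

theorem IsHullCycle.exists_isDistribution {σ : ℝ} {Q : Finset Plane} {n : ℕ} {w : Fin n → Plane}
    (h : IsHullCycle σ Q w) (hg : Generic (Q : Set Plane)) (c : Fin n → ℕ)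
    (hcard : Q.card = n + ∑ i, c i) :
    ∃ S, IsDistribution σ Q w S ∧ ∀ i, (S i).card = c i := by
  classical
  set I : Finset Plane := Q \ Finset.univ.image w with hI
  have hIcard : I.card = ∑ i, c i := by
    rw [hI, Finset.card_sdiff_of_subset, hcard, Finset.card_image_of_injective _ h.injective]
    · simp
    · intro x hx
      obtain ⟨i, -, rfl⟩ := Finset.mem_image.1 hx
      exact h.mem i
  have hIQ : ∀ x : I, (x : Plane) ∈ Q := fun x => (Finset.mem_sdiff.1 x.2).1
  have hIw : ∀ (x : I) j, (x : Plane) ≠ w j := fun x j e =>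
    (Finset.mem_sdiff.1 x.2).2 (Finset.mem_image.2 ⟨j, by simp, e.symm⟩)
  let e₀ : I ≃ (i : Fin n) × Fin (c i) := Fintype.equivOfCardEq (by
    rw [Fintype.card_coe, hIcard, Fintype.card_sigma]; simp)
  obtain ⟨e, he⟩ := exists_equiv_exchange e₀
    (fun b x => sar σ (w b.1) (w (finRotate n b.1)) x) (fun b x => h.left b.1 x (hIQ x)
      (hIw x _) (hIw x _))
  refine ⟨fun i => Finset.univ.image fun j : Fin (c i) => (e.symm ⟨i, j⟩ : Plane), ?_, ?_⟩
  · have hS : ∀ i x, x ∈ (Finset.univ.image fun j : Fin (c i) => (e.symm ⟨i, j⟩ : Plane)) →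
        ∃ z : I, (z : Plane) = x ∧ (e z).1 = i := by
      intro i x hx
      obtain ⟨j, -, rfl⟩ := Finset.mem_image.1 hx
      exact ⟨e.symm ⟨i, j⟩, rfl, by simp⟩
    refine ⟨h, hg, ?_, ?_, ?_, ?_, ?_⟩
    · intro i x hx
      obtain ⟨z, rfl, -⟩ := hS i x hx
      exact hIQ z
    · intro i x hx j
      obtain ⟨z, rfl, -⟩ := hS i x hx
      exact hIw z j
    · intro i j x hx hx'
      obtain ⟨z, rfl, hz⟩ := hS i x hx
      obtain ⟨z', hzz, hz'⟩ := hS j _ hx'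
      rw [← hz, ← hz', Subtype.ext hzz]
    · intro x hx
      by_cases hc : ∃ i, x = w i
      · exact Or.inl hc
      · right
        have hxI : x ∈ I := Finset.mem_sdiff.2 ⟨hx, fun hx' => by
          obtain ⟨i, -, rfl⟩ := Finset.mem_image.1 hx'
          exact hc ⟨i, rfl⟩⟩
        exact ⟨(e ⟨x, hxI⟩).1, Finset.mem_image.2 ⟨(e ⟨x, hxI⟩).2, by simp, by simp⟩⟩
    · intro i j x y hx hy
      have nn : ∀ i k x, Cls w (fun i => Finset.univ.image fun j : Fin (c i) =>
          (e.symm ⟨i, j⟩ : Plane)) k x → 0 ≤ sar σ (w i) (w (finRotate n i)) x := by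
        rintro i k x (rfl | rfl | hx)
        · exact h.nonneg i (h.mem _)
        · exact h.nonneg i (h.mem _)
        · obtain ⟨z, rfl, -⟩ := hS k x hx
          exact h.nonneg i (hIQ z)
      have p := mul_nonneg (nn i j y hy) (nn j i x hx)
      rcases hx with rfl | rfl | hx
      · simpa using p
      · simpa using p
      rcases hy with rfl | rfl | hy
      · simpa using p
      · simpa using p
      obtain ⟨z, rfl, rfl⟩ := hS i x hx
      obtain ⟨z', rfl, rfl⟩ := hS j y hy
      exact he z z'
  · intro i
    rw [Finset.card_image_of_injective]
    · simp
    · intro j j' hj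
      have := e.symm.injective (Subtype.ext hj)
      simpa using this

namespace IsDistribution
variable {σ : ℝ} {Q : Finset Plane} {n : ℕ} {w : Fin n → Plane} {S : Fin n → Finset Plane}

theorem mem_of_cls (h : IsDistribution σ Q w S) {i : Fin n} {x : Plane} (hx : Cls w S i x) :
    x ∈ Q := by
  rcases hx with rfl | rfl | hx
  · exact h.hull.mem _
  · exact h.hull.mem _
  · exact h.subset i hx

theorem eq_zero_of_cls (h : IsDistribution σ Q w S) {i j : Fin n} {x : Plane} (hij : i ≠ j)
    (h1 : Cls w S i x) (h2 : Cls w S j x) :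
    (x = w i ∨ x = w (finRotate n i)) ∧ (x = w j ∨ x = w (finRotate n j)) := by
  rcases h1 with rfl | rfl | h1 <;> rcases h2 with h2 | h2 | h2
  · exact ⟨Or.inl rfl, Or.inl h2⟩
  · exact ⟨Or.inl rfl, Or.inr h2⟩
  · exact absurd rfl (h.ne_corner j _ h2 _)
  · exact ⟨Or.inr rfl, Or.inl h2⟩
  · exact ⟨Or.inr rfl, Or.inr h2⟩
  · exact absurd rfl (h.ne_corner j _ h2 _)
  · exact absurd h2 (h.ne_corner i _ h1 _)
  · exact absurd h2 (h.ne_corner i _ h1 _)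
  · exact absurd (h.disjoint i j x h1 h2) hij

/-- Two hull edges share at most one end. -/
theorem _root_.PointSet.IsHullCycle.edge_inter (h : IsHullCycle σ Q w) {i j : Fin n} (hij : i ≠ j)
    {x y : Plane} (hxy : x ≠ y)
    (hx : (x = w i ∨ x = w (finRotate n i)) ∧ (x = w j ∨ x = w (finRotate n j)))
    (hy : (y = w i ∨ y = w (finRotate n i)) ∧ (y = w j ∨ y = w (finRotate n j))) : False := by
  have hn := h.three_le
  have inj := h.injective
  obtain ⟨hx1, hx2⟩ := hx
  obtain ⟨hy1, hy2⟩ := hy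
  have e1 : w i ≠ w j := inj.ne hij
  have e2 : w (finRotate n i) ≠ w (finRotate n j) := inj.ne ((finRotate n).injective.ne hij)
  rcases hx1 with rfl | rfl <;> rcases hy1 with rfl | rfl
  · exact hxy rfl
  · have a := hx2.resolve_left e1
    have b := hy2.resolve_right e2
    have a := inj a
    have b := inj b
    rw [a] at b
    exact finRotate_finRotate_ne hn j b
  · have a := hx2.resolve_right e2
    have b := hy2.resolve_left e1
    have a := inj a
    have b := inj b
    rw [b] at a
    exact finRotate_finRotate_ne hn j a
  · exact hxy rfl

theorem _root_.PointSet.IsAffine.eq_zero {f : Plane → ℝ} (hf : IsAffine f) {σ : ℝ} {a b c : Plane}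
    (h : sar σ a b c ≠ 0) (ha : f a = 0) (hb : f b = 0) (hc : f c = 0) (z : Plane) : f z = 0 := by
  have := hf.bary σ a b c z
  rw [ha, hb, hc] at this
  simpa [h] using this

/-- Segments between points assigned to different hull edges do not cross. -/
theorem not_cross (h : IsDistribution σ Q w S) {i j : Fin n} (hij : i ≠ j) {x y x' y' : Plane}
    (hx : Cls w S i x) (hy : Cls w S i y) (hx' : Cls w S j x') (hy' : Cls w S j y') :
    ¬ Cross x y x' y' := by
  intro hc
  have hσ := h.hull.isSign
  obtain ⟨s, t, s0, s1, t0, t1, e⟩ := hc.exists_lineMap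
  obtain ⟨k1, k2⟩ := (cross_iff_sar hσ).1 hc
  set A := fun z => sar σ (w i) (w (finRotate n i)) z with hA
  set B := fun z => sar σ (w j) (w (finRotate n j)) z with hB
  have fA : IsAffine A := isAffine_sar _ _ _
  have fB : IsAffine B := isAffine_sar _ _ _
  have eA := congrArg A e
  have eB := congrArg B e
  rw [fA.lineMap, fA.lineMap] at eA
  rw [fB.lineMap, fB.lineMap] at eB
  have q1 : A x * B x' ≤ A x' * B x := h.exchange i j x x' hx hx'
  have q2 : A x * B y' ≤ A y' * B x := h.exchange i j x y' hx hy'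
  have q3 : A y * B x' ≤ A x' * B y := h.exchange i j y x' hy hx'
  have q4 : A y * B y' ≤ A y' * B y := h.exchange i j y y' hy hy'
  have u1 := mul_pos (sub_pos.2 s1) (sub_pos.2 t1)
  have u2 := mul_pos (sub_pos.2 s1) t0
  have u3 := mul_pos s0 (sub_pos.2 t1)
  have u4 := mul_pos s0 t0
  have r1 := mul_nonneg u1.le (sub_nonneg.2 q1)
  have r2 := mul_nonneg u2.le (sub_nonneg.2 q2)
  have r3 := mul_nonneg u3.le (sub_nonneg.2 q3)
  have r4 := mul_nonneg u4.le (sub_nonneg.2 q4)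
  -- in the crossing point both sides of the averaged inequality agree
  have tot : (1 - s) * (1 - t) * (A x' * B x - A x * B x') + (1 - s) * t * (A y' * B x - A x * B y')
      + s * (1 - t) * (A x' * B y - A y * B x') + s * t * (A y' * B y - A y * B y') = 0 := by
    have : ((1 - t) * A x' + t * A y') * ((1 - s) * B x + s * B y) =
        ((1 - s) * A x + s * A y) * ((1 - t) * B x' + t * B y') := by rw [eA, eB]
    linear_combination this
  have z1 := (mul_eq_zero.1 (show (1 - s) * (1 - t) * (A x' * B x - A x * B x') = 0 by
    linarith)).resolve_left u1.ne'
  have z2 := (mul_eq_zero.1 (show (1 - s) * t * (A y' * B x - A x * B y') = 0 by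
    linarith)).resolve_left u2.ne'
  have z3 := (mul_eq_zero.1 (show s * (1 - t) * (A x' * B y - A y * B x') = 0 by
    linarith)).resolve_left u3.ne'
  have z4 := (mul_eq_zero.1 (show s * t * (A y' * B y - A y * B y') = 0 by
    linarith)).resolve_left u4.ne'
  have n1 : sar σ x y x' ≠ 0 := fun hh => by rw [hh] at k1; simp at k1
  have n2 : sar σ x y y' ≠ 0 := fun hh => by rw [hh] at k1; simp at k1
  have hne : x' ≠ y' := by
    rintro rfl
    exact absurd k1 (not_lt.2 (mul_self_nonneg _))
  -- hence each of `x'`, `y'` is on both hull edges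
  have both : ∀ u, u ∈ Q → A u * B x = A x * B u → A u * B y = A y * B u → sar σ x y u ≠ 0 →
      A u = 0 ∧ B u = 0 := by
    intro u hu e1 e2 hn
    have hz := ((fA.const_mul (B u)).add (fB.const_mul (-A u))).eq_zero hn
      (by linarith) (by linarith) (by ring)
    have g1 := hz (w i)
    have g2 := hz (w (finRotate n i))
    have g3 := hz (w j)
    have g4 := hz (w (finRotate n j))
    have a1 : A (w i) = 0 := by simp [hA]
    have a2 : A (w (finRotate n i)) = 0 := by simp [hA]
    have b1 : B (w j) = 0 := by simp [hB]
    have b2 : B (w (finRotate n j)) = 0 := by simp [hB]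
    simp only [a1, a2, b1, b2, mul_zero, zero_add, add_zero, mul_eq_zero, neg_eq_zero] at g1 g2 g3 g4
    have hne1 : w i ≠ w (finRotate n i) :=
      h.hull.injective.ne (finRotate_ne (by have := h.hull.three_le; omega) i).symm
    have hne2 : w j ≠ w (finRotate n j) :=
      h.hull.injective.ne (finRotate_ne (by have := h.hull.three_le; omega) j).symm
    constructor
    · by_contra hAu
      exact h.hull.edge_inter hij hne1
        ⟨Or.inl rfl, h.hull.eq_or_eq (h.hull.mem _) (g1.resolve_left hAu)⟩
        ⟨Or.inr rfl, h.hull.eq_or_eq (h.hull.mem _) (g2.resolve_left hAu)⟩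
    · by_contra hBu
      exact h.hull.edge_inter hij hne2
        ⟨h.hull.eq_or_eq (h.hull.mem _) (g3.resolve_left hBu), Or.inl rfl⟩
        ⟨h.hull.eq_or_eq (h.hull.mem _) (g4.resolve_left hBu), Or.inr rfl⟩
  obtain ⟨x1, x2⟩ := both x' (h.mem_of_cls hx') (by linarith) (by linarith) n1
  obtain ⟨y1, y2⟩ := both y' (h.mem_of_cls hy') (by linarith) (by linarith) n2
  exact h.hull.edge_inter hij hne
    ⟨h.hull.eq_or_eq (h.mem_of_cls hx') x1, h.hull.eq_or_eq (h.mem_of_cls hx') x2⟩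
    ⟨h.hull.eq_or_eq (h.mem_of_cls hy') y1, h.hull.eq_or_eq (h.mem_of_cls hy') y2⟩

end IsDistribution

/-! ### Hull chains -/

theorem PEdge.exists_append {α : Type*} {l : List α} {x y : α} (h : PEdge l x y) :
    ∃ A B, l = A ++ x :: y :: B := by
  induction l with
  | nil => simp at h
  | cons a l ih =>
    cases l with
    | nil => simp at h
    | cons b l =>
      rcases h with ⟨rfl, rfl⟩ | h
      · exact ⟨[], l, rfl⟩
      · obtain ⟨A, B, e⟩ := ih h
        exact ⟨a :: A, B, by rw [e]; rfl⟩

/-- `l` is a chain turning right that has all points of `S` on its right. -/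
structure IsHullChain (σ : ℝ) (S : Finset Plane) (l : List Plane) : Prop where
  triple : ∀ a b c, List.Sublist [a, b, c] l → sar σ a b c < 0
  right : ∀ a b, PEdge l a b → ∀ s ∈ S, s ≠ a → s ≠ b → sar σ a b s < 0

/-- One of the points to the left of `x y` has all the others on its right, as seen from `x`. -/
theorem exists_leftmost {σ : ℝ} (hσ : IsSign σ) {x y : Plane} {S : Finset Plane}
    (hne : S.Nonempty) (hgen : Generic (insert x (S : Set Plane)))
    (hpos : ∀ s ∈ S, 0 < sar σ x y s) :
    ∃ s₁ ∈ S, ∀ s ∈ S, s ≠ s₁ → sar σ x s₁ s < 0 := by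
  classical
  have hx : ∀ s ∈ S, s ≠ x := by
    rintro s hs rfl
    have := hpos s hs
    simp at this
  induction hne using Finset.Nonempty.cons_induction with
  | singleton a => exact ⟨a, by simp, fun s hs hne => absurd (Finset.mem_singleton.1 hs) hne⟩
  | cons a T ha hT ih =>
    obtain ⟨s₁, h1, h2⟩ := ih (hgen.mono (Set.insert_subset_insert (by
      intro z hz; exact Finset.mem_cons_of_mem hz)))
      (fun s hs => hpos s (Finset.mem_cons_of_mem hs))
      (fun s hs => hx s (Finset.mem_cons_of_mem hs))
    have has : a ≠ s₁ := by rintro rfl; exact ha h1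
    have h1' : s₁ ∈ Finset.cons a T ha := Finset.mem_cons_of_mem h1
    have ha' : a ∈ Finset.cons a T ha := Finset.mem_cons_self a T
    rcases hgen.pos_or_neg hσ (Set.mem_insert x _) (Set.mem_insert_of_mem _ (Finset.mem_coe.2 ha'))
      (Set.mem_insert_of_mem _ (Finset.mem_coe.2 h1')) (hx a ha').symm (hx s₁ h1').symm has with k | k
    · refine ⟨s₁, h1', fun s hs hne => ?_⟩
      rcases Finset.mem_cons.1 hs with rfl | hs
      · rw [sar_swap']; linarith
      · exact h2 s hs hne
    · refine ⟨a, ha', fun s hs hne => ?_⟩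
      rcases Finset.mem_cons.1 hs with rfl | hs'
      · exact absurd rfl hne
      · by_cases hs1 : s = s₁
        · rw [hs1]; exact k
        · have k1 : 0 < sar σ x s₁ a := by rw [sar_swap']; linarith
          have k2 : 0 < sar σ x s s₁ := by rw [sar_swap']; linarith [h2 s hs' hs1]
          have := (isAffine_sar σ x y).sar_trans (σ := σ) (v := x) (by simp) (hpos s hs)
            (hpos s₁ h1') (hpos a ha') k2 k1
          rw [sar_swap']; linarith

/-- The upper convex hull of a set of points to the left of `x y`, as a chain from `x` to `y`. -/
theorem exists_hullChain {σ : ℝ} (hσ : IsSign σ) (S : Finset Plane) {x y : Plane} (hxy : x ≠ y)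
    (hgen : Generic (insert x (insert y (S : Set Plane)))) (hpos : ∀ s ∈ S, 0 < sar σ x y s) :
    ∃ mid : List Plane, (∀ z ∈ mid, z ∈ S) ∧ mid.Nodup ∧ IsHullChain σ S (x :: (mid ++ [y])) := by
  classical
  induction hk : S.card using Nat.strong_induction_on generalizing S x with
  | _ k ih =>
  subst hk
  have hx : ∀ s ∈ S, s ≠ x := by
    rintro s hs rfl
    have := hpos s hs
    simp at this
  have hy : ∀ s ∈ S, s ≠ y := by
    rintro s hs rfl
    have := hpos s hs
    simp at this
  rcases S.eq_empty_or_nonempty with rfl | hne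
  · refine ⟨[], by simp, by simp, fun a b c h => ?_, by simp⟩
    have := h.length_le
    simp at this
  obtain ⟨s₁, hs₁, hmax⟩ := exists_leftmost hσ hne (hgen.mono (by
    intro z hz
    rcases hz with rfl | hz
    · exact Or.inl rfl
    · exact Or.inr (Or.inr hz))) hpos
  set S' := S.filter (fun s => 0 < sar σ s₁ y s) with hS'
  have hs₁' : s₁ ∉ S' := by
    intro hh
    have := (Finset.mem_filter.1 hh).2
    simp at this
  have hsub : S' ⊆ S := Finset.filter_subset _ _
  have gS : ∀ s ∈ S, s ∈ (insert x (insert y (S : Set Plane)) : Set Plane) := fun s hs =>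
    Or.inr (Or.inr hs)
  obtain ⟨mid, hmid, hnd, htri, hright⟩ := ih S'.card
    (Finset.card_lt_card ⟨hsub, fun hh => hs₁' (hh hs₁)⟩) S' (x := s₁) (hy s₁ hs₁)
    (hgen.mono (by
      intro z hz
      rcases hz with rfl | rfl | hz
      · exact gS _ hs₁
      · exact Or.inr (Or.inl rfl)
      · exact gS _ (hsub hz))) (fun s hs => (Finset.mem_filter.1 hs).2) rfl
  have hmids₁ : s₁ ∉ mid := fun hh => hs₁' (hmid _ hh)
  have hmy : y ∉ mid := fun hh => hy y (hsub (hmid _ hh)) rfl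
  have d1 : sar σ x s₁ y < 0 := by rw [sar_swap']; linarith [hpos s₁ hs₁]
  -- the chain also turns right as seen from `x`
  have fromx : ∀ b c, List.Sublist [b, c] (s₁ :: (mid ++ [y])) → sar σ x b c < 0 := by
    intro b c hbc
    rcases List.cons_sublist_cons'.1 hbc with hbc | ⟨rfl, hc⟩
    · have hsplit : b ∈ mid ∧ (c ∈ mid ∨ c = y) := by
        obtain ⟨l₁, l₂, e, h1, h2⟩ := List.sublist_append_iff.1 hbc
        match l₁, e with
        | [], e =>
          have := h2.length_le
          rw [← (show [b, c] = l₂ from e)] at this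
          simp at this
        | [b'], e =>
          simp only [List.cons_append, List.nil_append, List.cons.injEq] at e
          obtain ⟨rfl, rfl⟩ := e
          exact ⟨h1.subset (by simp), Or.inr (by simpa using h2)⟩
        | b' :: c' :: l, e =>
          simp only [List.cons_append, List.cons.injEq] at e
          obtain ⟨rfl, rfl, -⟩ := e
          exact ⟨h1.subset (by simp), Or.inl (h1.subset (by simp))⟩
      obtain ⟨hb, hc⟩ := hsplit
      have hbS := hsub (hmid b hb)
      have hb' : 0 < sar σ s₁ y b := (Finset.mem_filter.1 (hmid b hb)).2
      have hbs : b ≠ s₁ := by rintro rfl; exact hmids₁ hb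
      rcases hc with hc | rfl
      · have hcS := hsub (hmid c hc)
        have hcb : b ≠ c := by
          rintro rfl
          have := (hnd.append (List.nodup_singleton y) (by simpa using hmy)).sublist hbc
          simp at this
        have hcs : c ≠ s₁ := by rintro rfl; exact hmids₁ hc
        have t1 : sar σ s₁ b c < 0 := htri _ _ _ (List.Sublist.cons_cons _ hbc)
        have t2 : sar σ b c y < 0 := by
          refine htri _ _ _ (List.Sublist.cons _ ?_)
          have : List.Sublist [b, c] mid := by
            obtain ⟨l₁, l₂, e, h1, h2⟩ := List.sublist_append_iff.1 hbc
            match l₂, e with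
            | [], e => simp at e; rw [e]; exact h1
            | z :: l, e =>
              exfalso
              have h3 := h2.length_le
              simp at h3
              subst h3
              have h4 : c = z := by
                have := congrArg List.getLast? e
                rw [List.getLast?_concat] at this
                simpa using this
              have h5 : z = y := by simpa using h2
              rw [h4, h5] at hc
              exact hmy hc
          exact List.Sublist.append this (List.Sublist.refl [y])
        have d2 := hmax b hbS hbs
        rcases hgen.pos_or_neg hσ (Set.mem_insert x _) (gS b hbS) (gS c hcS) (hx b hbS).symm
          (hx c hcS).symm hcb with hk | hk
        · exfalso
          have key := sar_bary σ y b x s₁ b c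
          rw [sar_self_right, mul_zero, add_zero, sar_cyc σ c s₁ b, sar_cyc σ y b c,
            sar_swap' σ x b c, ← sar_cyc σ x y b, sar_cyc' σ y b s₁] at key
          nlinarith [mul_pos_of_neg_of_neg d2 t2, mul_neg_of_neg_of_pos t1 (hpos b hbS),
            mul_pos hk hb']
        · exact hk
      · rw [sar_swap']; linarith [hpos b hbS]
    · rcases List.mem_append.1 (hc.subset (List.mem_singleton_self c)) with hc | hc
      · exact hmax c (hsub (hmid c hc)) (by rintro rfl; exact hmids₁ hc)
      · rw [List.mem_singleton.1 hc]; exact d1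
  refine ⟨s₁ :: mid, ?_, List.nodup_cons.2 ⟨hmids₁, hnd⟩, ?_, ?_⟩
  · intro z hz
    rcases List.mem_cons.1 hz with rfl | hz
    · exact hs₁
    · exact hsub (hmid z hz)
  · intro a b c hs
    simp only [List.cons_append] at hs
    rcases List.cons_sublist_cons'.1 hs with h1 | ⟨he, h1⟩
    · exact htri a b c h1
    · rw [he]; exact fromx b c h1
  · rintro a b (⟨rfl, rfl⟩ | hab) s hs hsa hsb
    · exact hmax s hs hsb
    · by_cases hsS' : s ∈ S'
      · exact hright a b hab s hsS' hsa hsb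
      have hab' : List.Sublist [a, b] (s₁ :: (mid ++ [y])) := by
        obtain ⟨A, B, e⟩ := hab.exists_append
        rw [show s₁ :: (mid ++ [y]) = A ++ a :: b :: B from e]
        exact (List.Sublist.cons_cons _ (List.Sublist.cons_cons _ (List.nil_sublist _))).trans
          (List.sublist_append_right _ _)
      have gx := fromx a b hab'
      rw [sar_cyc] at gx
      have gs : sar σ a b s₁ ≤ 0 := by
        rcases List.cons_sublist_cons'.1 hab' with hh | ⟨rfl, -⟩
        · have := htri _ _ _ (List.Sublist.cons_cons s₁ hh)
          rw [sar_cyc] at this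
          exact this.le
        · simp
      have gy : sar σ a b y ≤ 0 := by
        rw [show s₁ :: (mid ++ [y]) = (s₁ :: mid) ++ [y] by simp] at hab'
        obtain ⟨l₁, l₂, e, h1, h2⟩ := List.sublist_append_iff.1 hab'
        match l₂, e with
        | [], e =>
          simp only [List.append_nil] at e
          subst e
          refine (htri a b y ?_).le
          rw [show s₁ :: (mid ++ [y]) = (s₁ :: mid) ++ [y] by simp]
          exact List.Sublist.append h1 (List.Sublist.refl [y])
        | z :: l, e =>
          have h3 := h2.length_le
          simp at h3
          subst h3
          have h4 : b = z := by
            have := congrArg List.getLast? e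
            rw [List.getLast?_concat] at this
            simpa using this
          have h5 : z = y := by simpa using h2
          rw [h4, h5]; simp
      by_cases hss : s = s₁
      · subst hss
        rcases List.cons_sublist_cons'.1 hab' with hh | ⟨rfl, -⟩
        · have := htri _ _ _ (List.Sublist.cons_cons s hh)
          rwa [sar_cyc] at this
        · exact absurd rfl hsa
      -- the remaining points are in the triangle `x s₁ y`
      have k1 : sar σ s₁ y s < 0 := by
        rcases hgen.pos_or_neg hσ (gS s₁ hs₁) (Or.inr (Or.inl rfl)) (gS s hs) (hy s₁ hs₁)
          (Ne.symm hss) (hy s hs).symm with k | k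
        · exact absurd (Finset.mem_filter.2 ⟨hs, k⟩) hsS'
        · exact k
      have key := sar_bary σ a b x s₁ y s
      rw [sar_cyc σ s s₁ y, sar_swap' σ x y s] at key
      have := mul_pos_of_neg_of_neg k1 gx
      have := mul_nonneg_of_nonpos_of_nonpos (neg_nonpos.2 (hpos s hs).le) gs
      have := mul_nonneg_of_nonpos_of_nonpos (hmax s hs hss).le gy
      have : 0 < sar σ x s₁ y * sar σ a b s := by linarith
      by_contra hno
      exact absurd this (not_lt.2 (mul_nonpos_of_nonpos_of_nonneg d1.le (not_lt.1 hno)))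

/-! ### Splitting points among the edges of a chain -/

/-- Points in an angle at `o` can be sorted by their direction from `o`. -/
theorem exists_angular_sort {σ : ℝ} (hσ : IsSign σ) {o a b : Plane} (E : Finset Plane)
    (hgen : Generic (insert o (E : Set Plane))) (hab : 0 < sar σ o a b)
    (hE : ∀ z ∈ E, 0 < sar σ o a z ∧ 0 < sar σ o z b) :
    ∃ l : List Plane, l.Nodup ∧ (∀ z, z ∈ l ↔ z ∈ E) ∧
      (a :: (l ++ [b])).Pairwise fun x y => 0 < sar σ o x y := by
  classical
  let key : Plane → ℝ := fun z => sar σ o a z / sar σ o z b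
  let r : Plane → Plane → Prop := fun x y => key x ≤ key y
  have : IsTrans Plane r := ⟨fun x y z => le_trans⟩
  have : Std.Total r := ⟨fun x y => le_total _ _⟩
  have hmem : ∀ z, z ∈ E.toList.insertionSort r ↔ z ∈ E := fun z => by
    rw [(List.perm_insertionSort r E.toList).mem_iff, Finset.mem_toList]
  have hnd : (E.toList.insertionSort r).Nodup :=
    (List.perm_insertionSort r E.toList).nodup_iff.2 E.nodup_toList
  refine ⟨E.toList.insertionSort r, hnd, hmem, ?_⟩
  rw [List.pairwise_cons, List.pairwise_append]
  refine ⟨fun z hz => ?_, ?_, List.pairwise_singleton _ _, fun x hx y hy => ?_⟩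
  · rcases List.mem_append.1 hz with hz | hz
    · exact (hE z ((hmem z).1 hz)).1
    · rw [List.mem_singleton.1 hz]; exact hab
  · have hs : (E.toList.insertionSort r).Pairwise r := List.pairwise_insertionSort r _
    refine (hs.and hnd).imp_of_mem ?_
    rintro x y hx hy ⟨hxy, hne⟩
    have hx' := (hmem x).1 hx
    have hy' := (hmem y).1 hy
    obtain ⟨x1, x2⟩ := hE x hx'
    obtain ⟨y1, y2⟩ := hE y hy'
    have ho : ∀ z ∈ E, o ≠ z := by
      rintro z hz rfl
      have := (hE o hz).1
      simp at this
    have h1 := (div_le_div_iff₀ x2 y2).1 hxy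
    have h2 := sar_gp σ o a b x y
    rw [sar_swap' σ o y b, sar_swap' σ o x b] at h2
    rcases hgen.pos_or_neg hσ (Set.mem_insert o _) (Or.inr hx') (Or.inr hy') (ho x hx') (ho y hy')
      hne with h | h
    · exact h
    · nlinarith [mul_neg_of_pos_of_neg hab h]
  · rw [List.mem_singleton.1 hy]
    exact (hE x ((hmem x).1 hx)).2

/-- The points belonging to the edge `t` of the chain `g` when `E` is distributed by `τ`. -/
def InBlock (g : ℕ → Plane) (E : Finset Plane) (τ : Plane → ℕ) (t : ℕ) (x : Plane) : Prop :=
  x = g t ∨ x = g (t + 1) ∨ (x ∈ E ∧ τ x = t)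

/-- If `a b c d` is convex, no point beyond the side `b c` can see both diagonals from the
sides on which these do not meet. -/
theorem no_double_view {σ : ℝ} {a b c d o : Plane} (habc : sar σ a b c < 0) (hbcd : sar σ b c d < 0)
    (habd : sar σ a b d < 0) (ho : 0 < sar σ b c o) (h1 : 0 < sar σ o c a) (h2 : 0 < sar σ o d b) :
    False := by
  have id : sar σ b c d * sar σ o c a + sar σ a b c * sar σ o d b +
      (sar σ b c d + sar σ a b d) * sar σ b c o = sar σ a b c * sar σ b c d := by
    unfold sar orientation; ring
  nlinarith [mul_neg_of_neg_of_pos hbcd h1, mul_neg_of_neg_of_pos habc h2,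
    mul_neg_of_neg_of_pos (add_neg hbcd habd) ho, mul_pos_of_neg_of_neg habc hbcd]

/-- A turning chain `g 0, …, g m` with an apex `o t` for each of its edges, seeing this edge from
the other side. -/
structure IsFanChain (σ : ℝ) (Q : Set Plane) (g o : ℕ → Plane) (m : ℕ) : Prop where
  isSign : IsSign σ
  generic : Generic Q
  mem : ∀ t ≤ m, g t ∈ Q
  apex_mem : ∀ t < m, o t ∈ Q
  apex_ne : ∀ t < m, ∀ s ≤ m, o t ≠ g s
  turn : ∀ i j k, i < j → j < k → k ≤ m → sar σ (g i) (g j) (g k) < 0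
  apex_left : ∀ t < m, 0 < sar σ (g t) (g (t + 1)) (o t)

/-- `z` is to the right of a fan chain, and compatible with its apexes: if `z` is to the left of
the ray from an apex to the end of its edge, then so it is for the ray from the apex of the
preceding edge. -/
structure IsFanPoint (σ : ℝ) (Q : Set Plane) (g o : ℕ → Plane) (m : ℕ) (z : Plane) : Prop where
  mem : z ∈ Q
  ne : ∀ t ≤ m, z ≠ g t
  ne_apex : ∀ t < m, z ≠ o t
  right : ∀ t < m, sar σ (g t) (g (t + 1)) z < 0
  fan : ∀ t, t + 1 < m → 0 < sar σ (o (t + 1)) z (g (t + 1)) → 0 < sar σ (o t) z (g (t + 1))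

namespace IsFanChain
variable {σ : ℝ} {Q : Set Plane} {g o : ℕ → Plane} {m : ℕ}

theorem ne (h : IsFanChain σ Q g o m) (hm : 2 ≤ m) {i j : ℕ} (hij : i < j) (hj : j ≤ m) :
    g i ≠ g j := by
  intro e
  by_cases h1 : i + 1 < j
  · have := h.turn i (i + 1) j (by omega) h1 hj
    rw [e] at this; simp at this
  by_cases h2 : j < m
  · have := h.turn i j m hij h2 le_rfl
    rw [e] at this; simp at this
  · have := h.turn 0 i j (by omega) hij hj
    rw [e] at this; simp at this

/-- A line that splits the chain at the vertex `r + 1`, in such a way that the points on either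
side of it can be distributed to the edges on the same side. -/
theorem exists_split (h : IsFanChain σ Q g o m) {i j : ℕ} (hij : i + 1 < j) (hj : j ≤ m) :
    ∃ r, i ≤ r ∧ r + 1 < j ∧ ∃ f : Plane → ℝ, IsAffine f ∧ (∃ p, f p ≠ 0) ∧
      (∀ t, i ≤ t → t ≤ r + 1 → 0 ≤ f (g t)) ∧ (∀ t, r + 1 ≤ t → t ≤ j → f (g t) ≤ 0) ∧
      ∀ z, IsFanPoint σ Q g o m z →
        (0 < f z → 0 < sar σ (o r) z (g (r + 1))) ∧
        (f z ≤ 0 → 0 < sar σ (o (r + 1)) (g (r + 1)) z) := by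
  classical
  have hgen := h.generic
  have hσ := h.isSign
  have hm : 2 ≤ m := by omega
  have hex : ∃ r, i ≤ r ∧ r + 1 < j ∧ 0 < sar σ (o (r + 1)) (g (r + 1)) (g j) := by
    refine ⟨j - 2, by omega, by omega, ?_⟩
    have := h.apex_left (j - 1) (by omega)
    rw [sar_cyc'] at this
    rwa [show j - 2 + 1 = j - 1 by omega, show j - 1 + 1 = j by omega] at *
  set r := Nat.find hex with hr
  obtain ⟨h1, h2, h3⟩ := Nat.find_spec hex
  have hmin : ∀ r' < r, ¬ _ := fun r' hr' => Nat.find_min hex hr'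
  -- the preceding apex sees the chain up to the splitting vertex in the right order
  have h4 : 0 < sar σ (o r) (g i) (g (r + 1)) := by
    rcases Nat.lt_or_ge i r with hir | hir
    · have hn := hmin (r - 1) (by omega)
      rw [show r - 1 + 1 = r by omega] at hn
      have hn' : ¬ 0 < sar σ (o r) (g r) (g j) := fun hp => hn ⟨by omega, by omega, hp⟩
      rcases hgen.pos_or_neg hσ (h.apex_mem r (by omega)) (h.mem r (by omega)) (h.mem j hj)
        (h.apex_ne r (by omega) r (by omega)) (h.apex_ne r (by omega) j hj)
        (h.ne hm (by omega) hj) with hp | hp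
      · exact absurd hp hn'
      rcases hgen.pos_or_neg hσ (h.apex_mem r (by omega)) (h.mem i (by omega))
        (h.mem (r + 1) (by omega)) (h.apex_ne r (by omega) i (by omega))
        (h.apex_ne r (by omega) (r + 1) (by omega)) (h.ne hm (by omega) (by omega)) with hq | hq
      · exact hq
      exfalso
      refine no_double_view (h.turn i r (r + 1) hir (by omega) (by omega))
        (h.turn r (r + 1) j (by omega) (by omega) hj) (h.turn i r j hir (by omega) hj)
        (h.apex_left r (by omega)) (o := o r) ?_ ?_
      · rw [sar_swap']; linarith
      · rw [sar_swap']; linarith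
    · have e : i = r := by omega
      rw [e, ← sar_cyc']
      exact sar_cyc_pos _ _ _ (sar_cyc_pos _ _ _ (by
        have := h.apex_left r (by omega)
        rw [sar_cyc'] at this
        rwa [sar_cyc]))
  have h5 : 0 < sar σ (o (r + 1)) (g (r + 1)) (g (r + 2)) := by
    rw [sar_cyc]; exact h.apex_left (r + 1) (by omega)
  have h6 : 0 < sar σ (o r) (g r) (g (r + 1)) := by
    rw [sar_cyc]; exact h.apex_left r (by omega)
  refine ⟨r, h1, h2, ?_⟩
  rcases hgen.pos_or_neg hσ (h.apex_mem (r + 1) (by omega)) (h.mem i (by omega))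
    (h.mem (r + 1) (by omega)) (h.apex_ne (r + 1) (by omega) i (by omega))
    (h.apex_ne (r + 1) (by omega) (r + 1) (by omega)) (h.ne hm (by omega) (by omega)) with hq | hq
  · -- the line from the apex of the next edge
    set f : Plane → ℝ := fun y => sar σ (g (r + 1)) (o (r + 1)) y with hf
    have fA : IsAffine f := isAffine_sar _ _ _
    have fv : f (g (r + 1)) = 0 := by simp [hf]
    have fi : 0 < f (g i) := by rwa [sar_cyc'] at hq
    have fj : f (g j) < 0 := by simp only [hf]; rw [sar_swap]; linarith
    have fs : f (g (r + 2)) < 0 := by simp only [hf]; rw [sar_swap]; linarith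
    refine ⟨f, fA, ⟨_, fi.ne'⟩, fun t ht ht' => ?_, fun t ht ht' => ?_, fun z hz => ⟨fun hp => ?_,
      fun hp => ?_⟩⟩
    · rcases eq_or_lt_of_le ht with rfl | ht
      · exact fi.le
      rcases eq_or_lt_of_le ht' with rfl | ht'
      · exact fv.ge
      have rel := fA.sar_relation σ fv (g j) (g i) (g t)
      have s1 := h.turn t (r + 1) j ht' (by omega) hj
      have s2 := h.turn i t (r + 1) ht ht' (by omega)
      have s3 := h.turn i (r + 1) j (by omega) (by omega) hj
      rw [sar_cyc' σ _ (g j) (g t), sar_cyc σ _ (g i) (g t), sar_cyc' σ _ (g j) (g i)] at rel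
      have := mul_neg_of_pos_of_neg fi s1
      have := mul_pos_of_neg_of_neg fj s2
      exact (pos_of_mul_neg_left (by linarith) s3.le).le
    · rcases eq_or_lt_of_le ht with rfl | ht
      · exact fv.le
      rcases eq_or_lt_of_le ht' with rfl | ht'
      · exact fj.le
      rcases eq_or_lt_of_le (show r + 2 ≤ t by omega) with rfl | ht2
      · exact fs.le
      have rel := fA.sar_relation σ fv (g (r + 2)) (g t) (g j)
      have s1 := h.turn (r + 1) (r + 2) j (by omega) (by omega) hj
      have s2 := h.turn (r + 1) t j ht ht' hj
      have s3 := h.turn (r + 1) (r + 2) t (by omega) ht2 (by omega)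
      have := mul_pos_of_neg_of_neg fs s2
      have := mul_pos_of_neg_of_neg fj s3
      exact (neg_of_mul_pos_left (by linarith) s1.le).le
    · exact hz.fan r (by omega) (by rw [sar_cyc']; exact hp)
    · rcases hgen.pos_or_neg hσ (h.apex_mem (r + 1) (by omega)) (h.mem (r + 1) (by omega)) hz.mem
        (h.apex_ne (r + 1) (by omega) (r + 1) (by omega)) (hz.ne_apex (r + 1) (by omega)).symm
        (hz.ne (r + 1) (by omega)).symm with k | k
      · exact k
      · simp only [hf] at hp
        rw [sar_swap] at hp
        linarith
  · -- the chord from the beginning of the chain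
    set f : Plane → ℝ := fun y => sar σ (g i) (g (r + 1)) y with hf
    have fj : f (g j) < 0 := h.turn i (r + 1) j (by omega) (by omega) hj
    refine ⟨f, isAffine_sar _ _ _, ⟨_, fj.ne⟩, fun t ht ht' => ?_, fun t ht ht' => ?_,
      fun z hz => ⟨fun hp => ?_, fun hp => ?_⟩⟩
    · rcases eq_or_lt_of_le ht with rfl | ht
      · simp [hf]
      rcases eq_or_lt_of_le ht' with rfl | ht'
      · simp [hf]
      have := h.turn i t (r + 1) ht ht' (by omega)
      simp only [hf]
      rw [sar_swap']; linarith
    · rcases eq_or_lt_of_le ht with rfl | ht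
      · simp [hf]
      exact (h.turn i (r + 1) t (by omega) ht (by omega)).le
    · have hr1 := hz.right r (by omega)
      rcases eq_or_lt_of_le h1 with hir | hir
      · rw [← hr] at hir
        simp only [hf, hir] at hp
        linarith
      set k : Plane → ℝ := fun y => sar σ (g (r + 1)) (o r) y with hk
      have kA : IsAffine k := isAffine_sar _ _ _
      have ki : 0 < k (g i) := by rwa [sar_cyc'] at h4
      have kr : 0 < k (g r) := by rwa [sar_cyc'] at h6
      have rel := kA.sar_relation σ (by simp [hk]) (v := g (r + 1)) (g i) z (g r)
      have s1 := h.turn i r (r + 1) hir (by omega) (by omega)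
      rw [sar_cyc' σ _ z (g r), ← sar_cyc' σ (g i) (g r), sar_swap σ (g i)] at rel
      have hp' : 0 < sar σ (g i) (g (r + 1)) z := hp
      have := mul_neg_of_pos_of_neg ki hr1
      have := mul_pos kr hp'
      have : 0 < k z := pos_of_mul_neg_left (by linarith) s1.le
      rw [sar_cyc']; exact this
    · have hr1 := hz.right (r + 1) (by omega)
      have hp' : sar σ (g i) (g (r + 1)) z < 0 := by
        refine lt_of_le_of_ne hp (hgen.sar_ne hσ (h.mem i (by omega)) (h.mem (r + 1) (by omega))
          hz.mem (h.ne hm (by omega) (by omega)) (hz.ne i (by omega)).symm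
          (hz.ne (r + 1) (by omega)).symm)
      set k : Plane → ℝ := fun y => sar σ (g (r + 1)) (o (r + 1)) y with hk
      have kA : IsAffine k := isAffine_sar _ _ _
      have ki : k (g i) < 0 := by rwa [sar_cyc'] at hq
      have ks : k (g (r + 2)) < 0 := by simp only [hk]; rw [sar_swap]; linarith
      have rel := kA.sar_relation σ (by simp [hk]) (v := g (r + 1)) (g (r + 2)) z (g i)
      have s1 := h.turn i (r + 1) (r + 2) (by omega) (by omega) (by omega)
      rw [sar_cyc' σ _ z (g i), sar_cyc' σ _ (g (r + 2)) (g i)] at rel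
      have := mul_pos_of_neg_of_neg ks hp'
      have := mul_pos_of_neg_of_neg ki hr1
      have : k z < 0 := neg_of_mul_pos_left (by linarith) s1.le
      simp only [hk] at this
      rw [sar_swap] at this
      linarith

/-- The points to the right of a fan chain can be distributed to its edges, so that each point is
seen from the apex of its edge through this edge, and segments belonging to different edges do not
cross. -/
theorem exists_distribution (h : IsFanChain σ Q g o m) {d i j : ℕ} (hd : j = i + d + 1)
    (hj : j ≤ m) (E : Finset Plane) (hE : ∀ z ∈ E, IsFanPoint σ Q g o m z)
    (hends : ∀ z ∈ E, 0 < sar σ (o i) (g i) z ∧ 0 < sar σ (o (j - 1)) z (g j)) :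
    ∃ τ : Plane → ℕ, (∀ z ∈ E, i ≤ τ z ∧ τ z < j ∧ 0 < sar σ (o (τ z)) (g (τ z)) z ∧
        0 < sar σ (o (τ z)) z (g (τ z + 1))) ∧
      ∀ t t', i ≤ t → t < t' → t' < j → ∀ x y x' y', InBlock g E τ t x → InBlock g E τ t y →
        InBlock g E τ t' x' → InBlock g E τ t' y' → ¬ Cross x y x' y' := by
  classical
  induction d using Nat.strong_induction_on generalizing i j E with
  | _ d ih =>
  rcases Nat.eq_zero_or_pos d with rfl | hd0
  · refine ⟨fun _ => i, fun z hz => ⟨le_rfl, by simp only; omega, (hends z hz).1, ?_⟩,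
      fun t t' h1 h2 h3 => by omega⟩
    have := (hends z hz).2
    rwa [show j - 1 = i by omega, show j = i + 1 by omega] at this
  obtain ⟨r, hir, hrj, f, fA, ⟨p, hp⟩, hf1, hf2, hfz⟩ := h.exists_split (i := i) (j := j)
    (by omega) hj
  obtain ⟨τ₁, a1, a2⟩ := ih (r - i) (by omega) (i := i) (j := r + 1) (by omega) (by omega)
    (E.filter fun z => 0 < f z) (fun z hz => hE z (Finset.mem_filter.1 hz).1)
    (fun z hz => ⟨(hends z (Finset.mem_filter.1 hz).1).1,
      (hfz z (hE z (Finset.mem_filter.1 hz).1)).1 (Finset.mem_filter.1 hz).2⟩)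
  obtain ⟨τ₂, b1, b2⟩ := ih (j - r - 2) (by omega) (i := r + 1) (j := j) (by omega) (by omega)
    (E.filter fun z => ¬ 0 < f z) (fun z hz => hE z (Finset.mem_filter.1 hz).1)
    (fun z hz => ⟨(hfz z (hE z (Finset.mem_filter.1 hz).1)).2
      (not_lt.1 (Finset.mem_filter.1 hz).2), (hends z (Finset.mem_filter.1 hz).1).2⟩)
  set τ : Plane → ℕ := fun z => if 0 < f z then τ₁ z else τ₂ z with hτ
  have left : ∀ t x, i ≤ t → t < r + 1 → InBlock g E τ t x →
      InBlock g (E.filter fun z => 0 < f z) τ₁ t x := by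
    rintro t x h1 h2 (hx | hx | ⟨hx, e⟩)
    · exact Or.inl hx
    · exact Or.inr (Or.inl hx)
    · by_cases hfx : 0 < f x
      · exact Or.inr (Or.inr ⟨Finset.mem_filter.2 ⟨hx, hfx⟩, by simpa [hτ, hfx] using e⟩)
      · have := (b1 x (Finset.mem_filter.2 ⟨hx, hfx⟩)).1
        simp only [hτ, if_neg hfx] at e
        omega
  have right : ∀ t x, r + 1 ≤ t → t < j → InBlock g E τ t x →
      InBlock g (E.filter fun z => ¬ 0 < f z) τ₂ t x := by
    rintro t x h1 h2 (hx | hx | ⟨hx, e⟩)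
    · exact Or.inl hx
    · exact Or.inr (Or.inl hx)
    · by_cases hfx : 0 < f x
      · have := (a1 x (Finset.mem_filter.2 ⟨hx, hfx⟩)).2.1
        simp only [hτ, if_pos hfx] at e
        omega
      · exact Or.inr (Or.inr ⟨Finset.mem_filter.2 ⟨hx, hfx⟩, by simpa [hτ, hfx] using e⟩)
  refine ⟨τ, fun z hz => ?_, fun t t' h1 h2 h3 x y x' y' hx hy hx' hy' => ?_⟩
  · by_cases hfz0 : 0 < f z
    · obtain ⟨c1, c2, c3⟩ := a1 z (Finset.mem_filter.2 ⟨hz, hfz0⟩)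
      simp only [hτ, if_pos hfz0]
      exact ⟨c1, by omega, c3⟩
    · obtain ⟨c1, c2, c3⟩ := b1 z (Finset.mem_filter.2 ⟨hz, hfz0⟩)
      simp only [hτ, if_neg hfz0]
      exact ⟨by omega, c2, c3⟩
  · by_cases c1 : t' < r + 1
    · exact a2 t t' h1 h2 c1 x y x' y' (left t x h1 (by omega) hx) (left t y h1 (by omega) hy)
        (left t' x' (by omega) c1 hx') (left t' y' (by omega) c1 hy')
    by_cases c2 : r + 1 ≤ t
    · exact b2 t t' c2 h2 h3 x y x' y' (right t x c2 (by omega) hx) (right t y c2 (by omega) hy)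
        (right t' x' (by omega) h3 hx') (right t' y' (by omega) h3 hy')
    -- the blocks are separated by the splitting line
    have l : ∀ x, InBlock g E τ t x → 0 ≤ f x := by
      intro x hx
      rcases left t x h1 (by omega) hx with rfl | rfl | ⟨hx, -⟩
      · exact hf1 t h1 (by omega)
      · exact hf1 (t + 1) (by omega) (by omega)
      · exact (Finset.mem_filter.1 hx).2.le
    have l' : ∀ x, InBlock g E τ t' x → f x ≤ 0 := by
      intro x hx
      rcases right t' x (by omega) (by omega) hx with rfl | rfl | ⟨hx, -⟩
      · exact hf2 t' (by omega) (by omega)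
      · exact hf2 (t' + 1) (by omega) (by omega)
      · exact not_lt.1 (Finset.mem_filter.1 hx).2
    intro hc
    obtain ⟨z1, z2, z3, z4⟩ := hc.symm.eq_zero_of_separated f fA.lineMap (l' x' hx') (l' y' hy')
      (l x hx) (l y hy)
    have hne : sar σ x y x' ≠ 0 := fun e => by
      have := ((cross_iff_sar h.isSign).1 hc).1
      rw [e] at this
      simp at this
    exact hp (fA.eq_zero hne z3 z4 z1 p)

end IsFanChain

/-! ### Refining one chain of a triangulated polygon -/

section Strip
variable {α : Type*} {R : α → α → α → Prop} {g o : ℕ → α}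

/-- A triangulated polygon with vertices `g i, …, g (i + m)` followed by `ρ`, cut along the
triangles that have the edges of the chain `g` as a side; `o t` is the apex of the edge `t`. -/
def Strip (R : α → α → α → Prop) (g o : ℕ → α) : ℕ → ℕ → List α → Prop
  | i, 0, ρ => Tri R (g i :: ρ)
  | i, m + 1, ρ => ∃ l₁ l₂, ρ = l₁ ++ o i :: l₂ ∧ R (g i) (g (i + 1)) (o i) ∧
      Tri R (g i :: o i :: l₂) ∧ Strip R g o (i + 1) m (l₁ ++ [o i])

theorem Strip.congr {o' : ℕ → α} {m : ℕ} : ∀ {i : ℕ} {ρ : List α}, Strip R g o i m ρ →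
    (∀ t, i ≤ t → o t = o' t) → Strip R g o' i m ρ := by
  induction m with
  | zero => intro i ρ h _; exact h
  | succ m ih =>
    rintro i ρ ⟨l₁, l₂, rfl, h1, h2, h3⟩ ho
    refine ⟨l₁, l₂, by rw [ho i le_rfl], by rwa [← ho i le_rfl], by rwa [← ho i le_rfl], ?_⟩
    rw [← ho i le_rfl]
    exact ih h3 fun t ht => ho t (by omega)

/-- If no triangle has all corners in a set `V` containing the chain, the apexes over the chain edges
are not on the chain, so that the polygon can be cut along the triangles at these edges. -/
theorem exists_strip {m : ℕ} {V : Set α} : ∀ {i : ℕ} {ρ : List α},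
    Tri R ((List.range' i (m + 1)).map g ++ ρ) → ρ ≠ [] → (∀ t, i ≤ t → t ≤ i + m → g t ∈ V) →
    (∀ x y z, x ∈ V → y ∈ V → R x y z → z ∉ V) → ∃ o, Strip R g o i m ρ := by
  induction m with
  | zero => intro i ρ h _ _ _; exact ⟨g, h⟩
  | succ m ih =>
    intro i ρ h hρ hV hR
    have h' : Tri R (g i :: g (i + 1) :: ((List.range' (i + 2) m).map g ++ ρ)) := by
      simpa [List.range'_succ] using h
    obtain ⟨l₁, k, l₂, e, h1, h2, h3⟩ := h'.apex (by simp [hρ])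
    have hk := hR _ _ _ (hV i le_rfl (by omega)) (hV (i + 1) (by omega) (by omega)) h1
    -- the apex is not on the chain, hence in `ρ`
    obtain ⟨l₁', rfl, rfl⟩ : ∃ l₁', l₁ = (List.range' (i + 2) m).map g ++ l₁' ∧
        ρ = l₁' ++ k :: l₂ := by
      rcases List.append_eq_append_iff.1 e with ⟨as, e1, e2⟩ | ⟨bs, e1, e2⟩
      · exact ⟨as, e1, e2⟩
      · cases bs with
        | nil => exact ⟨[], by simpa using e1.symm, by simpa using e2.symm⟩
        | cons b bs =>
          exfalso
          simp only [List.cons_append, List.cons.injEq] at e2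
          obtain ⟨rfl, -⟩ := e2
          have : k ∈ (List.range' (i + 2) m).map g := by rw [e1]; simp
          obtain ⟨t, ht, rfl⟩ := List.mem_map.1 this
          rw [List.mem_range'_1] at ht
          exact hk (hV t (by omega) (by omega))
    obtain ⟨o, ho⟩ := ih (i := i + 1) (ρ := l₁' ++ [k])
      (by simpa [List.range'_succ] using h2) (by simp)
      (fun t ht ht' => hV t (by omega) (by omega)) hR
    classical
    refine ⟨Function.update o i k, l₁', l₂, by simp, by simpa, by simpa, ?_⟩
    rw [Function.update_self]
    exact ho.congr fun t ht => by rw [Function.update_of_ne (by omega)]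

theorem Strip.apex {m : ℕ} : ∀ {i : ℕ} {ρ : List α}, Strip R g o i m ρ →
    ∀ t, i ≤ t → t < i + m → R (g t) (g (t + 1)) (o t) := by
  induction m with
  | zero => intro i ρ _ t h1 h2; omega
  | succ m ih =>
    rintro i ρ ⟨l₁, l₂, rfl, h1, -, h3⟩ t ht ht'
    rcases eq_or_lt_of_le ht with rfl | ht
    · exact h1
    · exact ih h3 t ht (by omega)

/-- A property that is handed on by each triangle at the head of a triangulated polygon is handed
on from the second to the last vertex. -/
theorem Tri.head_induction {l : List α} {p : α → Prop} {v : α} (h : Tri R (v :: l))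
    (hR : ∀ a b, R v a b → p a → p b) : ∀ a ∈ l.head?, p a → ∀ b ∈ l.getLast?, p b := by
  generalize hl : v :: l = L at h
  induction h generalizing l with
  | edge a b =>
    simp only [List.cons.injEq] at hl
    obtain ⟨rfl, rfl⟩ := hl
    intro x hx px y hy
    simp only [List.head?_cons, List.getLast?_singleton, Option.mem_def, Option.some.injEq] at hx hy
    rw [← hy, hx]; exact px
  | @tri A B a k b hA hB hr _ _ ih₁ ih₂ =>
    cases A with
    | nil => simp at hA
    | cons a' A =>
      simp only [List.cons_append, List.cons.injEq] at hl
      obtain ⟨rfl, rfl⟩ := hl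
      simp only [List.head?_cons, Option.some.injEq] at hA
      subst hA
      intro x hx px y hy
      have hlast : (A ++ k :: B).getLast? = some b := by
        rw [List.getLast?_append, List.getLast?_cons, hB]; simp
      have hk : p k := ih₁ (l := A ++ [k]) rfl x (by
        cases A with
        | nil => simpa using hx
        | cons c A => simpa using hx) px k (by simp)
      rw [Option.mem_def, hlast, Option.some.injEq] at hy
      rw [← hy]
      exact hR _ _ hr hk

/-- Between the triangles at two successive chain edges there is a fan of triangles at their common
vertex. -/
theorem Strip.fan {m : ℕ} {p : α → Prop} : ∀ {i : ℕ} {ρ : List α}, Strip R g o i m ρ →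
    ∀ t, i ≤ t → t + 1 < i + m → (∀ a b, R (g (t + 1)) a b → p a → p b) → p (o (t + 1)) →
      p (o t) := by
  induction m with
  | zero => intro i ρ _ t h1 h2; omega
  | succ m ih =>
    rintro i ρ ⟨l₁, l₂, rfl, h1, -, h3⟩ t ht ht' hR hp
    rcases eq_or_lt_of_le ht with rfl | ht
    · cases m with
      | zero => omega
      | succ m =>
        obtain ⟨l₃, l₄, e, -, h4, -⟩ := h3
        refine h4.head_induction hR (o (i + 1)) (by simp) hp (o i) ?_
        have := congrArg List.getLast? e
        rw [List.getLast?_concat, List.getLast?_append] at this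
        rw [Option.mem_def, this]
        simp [List.getLast?_cons]
    · exact ih h3 t ht (by omega) hR hp

/-- The chain `g i, …, g (i + m)` with the points of `ζ t` inserted into its edge `t`. -/
def weave (g : ℕ → α) (ζ : ℕ → List α) : ℕ → ℕ → List α
  | i, 0 => [g i]
  | i, m + 1 => g i :: (ζ i ++ weave g ζ (i + 1) m)

theorem exists_weave_eq_cons (g : ℕ → α) (ζ : ℕ → List α) (i m : ℕ) :
    ∃ l, weave g ζ i m = g i :: l := by
  cases m with
  | zero => exact ⟨[], rfl⟩
  | succ m => exact ⟨_, rfl⟩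

theorem exists_weave_eq_concat (g : ℕ → α) (ζ : ℕ → List α) (m : ℕ) : ∀ i,
    ∃ l, weave g ζ i m = l ++ [g (i + m)] := by
  induction m with
  | zero => intro i; exact ⟨[], rfl⟩
  | succ m ih =>
    intro i
    obtain ⟨l, e⟩ := ih (i + 1)
    refine ⟨g i :: (ζ i ++ l), ?_⟩
    rw [weave, e, show i + 1 + m = i + (m + 1) by omega]
    simp

theorem mem_weave {g : ℕ → α} {ζ : ℕ → List α} {m : ℕ} : ∀ {i : ℕ} {x : α},
    x ∈ weave g ζ i m ↔ (∃ t, i ≤ t ∧ t ≤ i + m ∧ x = g t) ∨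
      ∃ t, i ≤ t ∧ t < i + m ∧ x ∈ ζ t := by
  induction m with
  | zero =>
    intro i x
    simp only [weave, List.mem_singleton]
    constructor
    · rintro rfl; exact Or.inl ⟨i, le_rfl, le_rfl, rfl⟩
    · rintro (⟨t, h1, h2, rfl⟩ | ⟨t, h1, h2, -⟩)
      · rw [show t = i by omega]
      · omega
  | succ m ih =>
    intro i x
    simp only [weave, List.mem_cons, List.mem_append, ih]
    constructor
    · rintro (rfl | h | ⟨t, h1, h2, h⟩ | ⟨t, h1, h2, h⟩)
      · exact Or.inl ⟨i, le_rfl, by omega, rfl⟩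
      · exact Or.inr ⟨i, le_rfl, by omega, h⟩
      · exact Or.inl ⟨t, by omega, by omega, h⟩
      · exact Or.inr ⟨t, by omega, by omega, h⟩
    · rintro (⟨t, h1, h2, h⟩ | ⟨t, h1, h2, h⟩)
      · rcases eq_or_lt_of_le h1 with rfl | h1
        · exact Or.inl h
        · exact Or.inr (Or.inr (Or.inl ⟨t, h1, by omega, h⟩))
      · rcases eq_or_lt_of_le h1 with rfl | h1
        · exact Or.inr (Or.inl h)
        · exact Or.inr (Or.inr (Or.inr ⟨t, h1, by omega, h⟩))

theorem nodup_weave {g : ℕ → α} {ζ : ℕ → List α} {m : ℕ} : ∀ {i : ℕ},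
    (∀ s t, i ≤ s → s < t → t ≤ i + m → g s ≠ g t) → (∀ t, (ζ t).Nodup) →
    (∀ s t, i ≤ s → s ≤ i + m → t < i + m → g s ∉ ζ t) →
    (∀ s t x, x ∈ ζ s → x ∈ ζ t → s = t) → (weave g ζ i m).Nodup := by
  induction m with
  | zero => intro i _ _ _ _; simp [weave]
  | succ m ih =>
    intro i h1 h2 h3 h4
    rw [weave, List.nodup_cons, List.nodup_append]
    refine ⟨?_, h2 i, ih (fun s t a b c => h1 s t (by omega) b (by omega)) h2
      (fun s t a b c => h3 s t (by omega) (by omega) (by omega)) h4, ?_⟩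
    · rw [List.mem_append, mem_weave]
      rintro (h | ⟨t, a, b, h⟩ | ⟨t, a, b, h⟩)
      · exact h3 i i le_rfl (by omega) (by omega) h
      · exact h1 i t le_rfl (by omega) (by omega) h
      · exact h3 i t le_rfl (by omega) (by omega) h
    · rintro x hx y hy rfl
      rcases mem_weave.1 hy with ⟨t, a, b, rfl⟩ | ⟨t, a, b, h⟩
      · exact h3 t i (by omega) (by omega) (by omega) hx
      · have := h4 i t x hx h
        omega

theorem PEdge.weave {g : ℕ → α} {ζ : ℕ → List α} {m : ℕ} : ∀ {i : ℕ} {x y : α},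
    PEdge (weave g ζ i m) x y → ∃ t, i ≤ t ∧ t < i + m ∧ PEdge (g t :: (ζ t ++ [g (t + 1)])) x y := by
  induction m with
  | zero => intro i x y h; simp [PointSet.weave] at h
  | succ m ih =>
    intro i x y h
    rw [PointSet.weave, ← List.cons_append, pEdge_append] at h
    rcases h with h | h | ⟨h1, h2⟩
    · refine ⟨i, le_rfl, by omega, ?_⟩
      rw [← List.cons_append, pEdge_append]
      exact Or.inl h
    · obtain ⟨t, h1, h2, h3⟩ := ih h
      exact ⟨t, by omega, by omega, h3⟩
    · refine ⟨i, le_rfl, by omega, ?_⟩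
      rw [← List.cons_append, pEdge_append]
      obtain ⟨l, e⟩ := exists_weave_eq_cons g ζ (i + 1) m
      rw [e] at h2
      exact Or.inr (Or.inr ⟨h1, by simpa using h2⟩)

theorem Tri.of_fan {k : α} {l : List α} (hl : l ≠ []) (h : ∀ a b, PEdge l a b → R a b k) :
    Tri R (l ++ [k]) := by
  induction l with
  | nil => exact absurd rfl hl
  | cons a l ih =>
    cases l with
    | nil => exact .edge a k
    | cons b l =>
      refine Tri.tri (A := [a]) (k := b) (B := l ++ [k]) (a := a) (b := k) rfl (by simp)
        (h a b (Or.inl ⟨rfl, rfl⟩)) (.edge a b) ?_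
      exact ih (by simp) fun x y hxy => h x y (Or.inr hxy)

/-- Inserting points into the edges of the chain, with fans from the apexes. -/
theorem Strip.weave {ζ : ℕ → List α} {m : ℕ} : ∀ {i : ℕ} {ρ : List α}, Strip R g o i m ρ →
    (∀ t, i ≤ t → t < i + m → ∀ a b, PEdge (g t :: (ζ t ++ [g (t + 1)])) a b → R a b (o t)) →
    Tri R (weave g ζ i m ++ ρ) := by
  induction m with
  | zero => intro i ρ h _; exact h
  | succ m ih =>
    rintro i ρ ⟨l₁, l₂, rfl, -, h2, h3⟩ hfan
    have h4 := ih h3 fun t ht ht' => hfan t (by omega) (by omega)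
    obtain ⟨l, e⟩ := exists_weave_eq_cons g ζ (i + 1) m
    rw [e] at h4
    have h5 := Tri.of_fan (l := g i :: (ζ i ++ [g (i + 1)])) (by simp) (hfan i le_rfl (by omega))
    have h6 : Tri R ((g i :: ζ i) ++ g (i + 1) :: ((l ++ l₁) ++ o i :: [])) := by
      refine Tri.graft ?_ ?_
      · simpa using h5
      · simpa using h4
    have h7 : Tri R ([] ++ g i :: ((ζ i ++ g (i + 1) :: (l ++ l₁)) ++ o i :: l₂)) := by
      refine Tri.graft (by simpa using h2) ?_
      simpa using h6
    rw [PointSet.weave, e]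
    simpa using h7

end Strip

/-! ### Closed lists made of chains, and their fillings -/

section Loop
variable {α : Type*} {n : ℕ}

theorem pEdge_finRange_concat (hn : 0 < n) {i j : Fin n}
    (h : PEdge (List.finRange n ++ [⟨0, hn⟩]) i j) : j = finRotate n i := by
  obtain ⟨A, B, e⟩ := h.exists_append
  obtain ⟨m, rfl⟩ : ∃ m, n = m + 1 := ⟨n - 1, by omega⟩
  have hlen := congrArg List.length e
  simp only [List.length_append, List.length_finRange, List.length_cons, List.length_nil] at hlen
  have hi : (List.finRange (m + 1) ++ [⟨0, hn⟩])[A.length]'(by simp; omega) = i :=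
    (List.getElem_of_eq e _).trans (by simp)
  have hj : (List.finRange (m + 1) ++ [⟨0, hn⟩])[A.length + 1]'(by simp; omega) = j :=
    (List.getElem_of_eq e _).trans (by simp)
  rw [List.getElem_append_left (by simp; omega)] at hi
  have hi' : i.val = A.length := by rw [← hi]; simp
  by_cases hA : A.length + 1 < m + 1
  · rw [List.getElem_append_left (by simp; omega)] at hj
    have hj' : j.val = A.length + 1 := by rw [← hj]; simp
    apply Fin.ext
    rw [finRotate_val i (by omega), hi', hj']
  · rw [List.getElem_append_right (by simp; omega)] at hj
    simp only [List.length_finRange, List.getElem_singleton] at hj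
    have : i = Fin.last m := Fin.ext (by simp; omega)
    rw [this, finRotate_last, ← hj]
    rfl

/-- The list of all indices can be rotated such that it starts with `k`. -/
theorem exists_rotation_finRange (hn : 2 ≤ n) (k : Fin n) :
    ∃ A B L, List.finRange n = A ++ B ∧ B ++ A = k :: finRotate n k :: L := by
  obtain ⟨A, B, e⟩ := List.append_of_mem (List.mem_finRange k)
  have h0 : 0 < n := by omega
  cases B with
  | cons b B =>
    refine ⟨A, k :: b :: B, B ++ A, e, ?_⟩
    rw [← pEdge_finRange_concat h0 (i := k) (j := b)]
    · simp
    · rw [e, List.append_assoc, pEdge_append]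
      exact Or.inr (Or.inl (Or.inl ⟨rfl, rfl⟩))
  | nil =>
    cases A with
    | nil =>
      have := congrArg List.length e
      simp at this; omega
    | cons a A =>
      refine ⟨a :: A, [k], A, e, ?_⟩
      have ha : a = ⟨0, h0⟩ := by
        obtain ⟨m, rfl⟩ : ∃ m, n = m + 1 := ⟨n - 1, by omega⟩
        rw [List.finRange_succ] at e
        simp only [List.cons_append, List.cons.injEq] at e
        rw [← e.1]; rfl
      rw [← pEdge_finRange_concat h0 (i := k) (j := a)]
      · simp
      · rw [e, pEdge_append]
        exact Or.inr (Or.inr ⟨List.getLast?_concat, by simp [ha]⟩)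

/-- The closed list `w 0, h 0, w 1, h 1, …`. -/
def loop (w : Fin n → α) (h : Fin n → List α) : List α :=
  (List.finRange n).flatMap fun i => w i :: h i

theorem mem_loop {w : Fin n → α} {h : Fin n → List α} {x : α} :
    x ∈ loop w h ↔ ∃ i, x = w i ∨ x ∈ h i := by
  simp [loop]

theorem loop_eq_cons (hn : 0 < n) (w : Fin n → α) (h : Fin n → List α) :
    ∃ l, loop w h = w ⟨0, hn⟩ :: l := by
  obtain ⟨m, rfl⟩ : ∃ m, n = m + 1 := ⟨n - 1, by omega⟩
  exact ⟨h 0 ++ ((List.finRange m).map Fin.succ).flatMap fun i => w i :: h i, by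
    rw [loop, List.finRange_succ]; simp⟩

/-- The closed list can be rotated so that it starts with the chain `k`, in a way that does not depend on
the chains. -/
theorem exists_rotation_loop (hn : 3 ≤ n) (k : Fin n) :
    ∃ L : List (Fin n), L ≠ [] ∧ k ∉ L ∧ finRotate n k ∉ L ∧
      ∀ (w : Fin n → α) (h : Fin n → List α), ∃ A B, loop w h = A ++ B ∧
        B ++ A = (w k :: (h k ++ [w (finRotate n k)])) ++
          (h (finRotate n k) ++ L.flatMap fun i => w i :: h i) := by
  obtain ⟨A, B, L, e1, e2⟩ := exists_rotation_finRange (by omega) k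
  have hnd : (k :: finRotate n k :: L).Nodup := by
    rw [← e2]
    have := List.nodup_finRange n
    rw [e1] at this
    exact List.nodup_append_comm.1 this
  have hlen := congrArg List.length e2
  have hlen' := congrArg List.length e1
  simp only [List.length_append, List.length_cons, List.length_finRange] at hlen hlen'
  simp only [List.nodup_cons, List.mem_cons, not_or] at hnd
  refine ⟨L, ?_, hnd.1.2, hnd.2.1, fun w h => ?_⟩
  · rintro rfl
    simp at hlen; omega
  · refine ⟨A.flatMap fun i => w i :: h i, B.flatMap fun i => w i :: h i, ?_, ?_⟩
    · rw [loop, e1, List.flatMap_append]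
    · rw [← List.flatMap_append, e2]
      simp

theorem pEdge_flatMap {w : Fin n → α} {h : Fin n → List α} {l : List (Fin n)} {j : Fin n}
    {x y : α} (hxy : PEdge ((l.flatMap fun i => w i :: h i) ++ [w j]) x y) :
    ∃ i i', PEdge (l ++ [j]) i i' ∧ PEdge (w i :: (h i ++ [w i'])) x y := by
  induction l with
  | nil => simp at hxy
  | cons i l ih =>
    rw [List.flatMap_cons, List.append_assoc, pEdge_append] at hxy
    obtain ⟨i', l', e⟩ : ∃ i' l', l ++ [j] = i' :: l' := by
      cases l with
      | nil => exact ⟨j, [], rfl⟩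
      | cons a l => exact ⟨a, _, rfl⟩
    have hh : ((l.flatMap fun i => w i :: h i) ++ [w j]).head? = some (w i') := by
      cases l with
      | nil =>
        simp only [List.nil_append, List.cons.injEq] at e
        simp [e.1]
      | cons a l =>
        simp only [List.cons_append, List.cons.injEq] at e
        simp [e.1]
    rcases hxy with hxy | hxy | ⟨h1, h2⟩
    · refine ⟨i, i', by rw [List.cons_append, e]; exact Or.inl ⟨rfl, rfl⟩, ?_⟩
      rw [← List.cons_append, pEdge_append]
      exact Or.inl hxy
    · obtain ⟨a, b, h1, h2⟩ := ih hxy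
      refine ⟨a, b, ?_, h2⟩
      rw [List.cons_append, ← List.singleton_append, pEdge_append]
      exact Or.inr (Or.inl h1)
    · refine ⟨i, i', by rw [List.cons_append, e]; exact Or.inl ⟨rfl, rfl⟩, ?_⟩
      rw [← List.cons_append, pEdge_append]
      rw [hh] at h2
      exact Or.inr (Or.inr ⟨h1, by simpa using h2⟩)

/-- The edges of the closed list are the edges of its chains. -/
theorem CEdge.exists_chain (hn : 0 < n) {w : Fin n → α} {h : Fin n → List α} {x y : α}
    (hxy : CEdge (loop w h) x y) : ∃ i, PEdge (w i :: (h i ++ [w (finRotate n i)])) x y := by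
  obtain ⟨l, e⟩ := loop_eq_cons hn w h
  have : PEdge (loop w h ++ [w ⟨0, hn⟩]) x y := by
    rw [pEdge_append]
    rcases hxy with hxy | ⟨h1, h2⟩
    · exact Or.inl hxy
    · rw [e, List.head?_cons] at h2
      exact Or.inr (Or.inr ⟨h1, h2⟩)
  obtain ⟨i, i', h1, h2⟩ := pEdge_flatMap this
  rw [pEdge_finRange_concat hn h1] at h2
  exact ⟨i, h2⟩

theorem pathSum_eq_sum {c : α → α → ℤ} {r : α → α} {l : List α}
    (h : ∀ i j, PEdge l i j → j = r i) :
    pathSum c l = (l.dropLast.map fun i => c i (r i)).sum := by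
  induction l with
  | nil => simp [pathSum]
  | cons a l ih =>
    cases l with
    | nil => simp [pathSum]
    | cons b l =>
      rw [pathSum, ih fun i j hij => h i j (Or.inr hij), List.dropLast_cons_cons, List.map_cons,
        List.sum_cons, ← h a b (Or.inl ⟨rfl, rfl⟩)]

theorem pathSum_flatMap (c : α → α → ℤ) (w : Fin n → α) (h : Fin n → List α) (l : List (Fin n))
    (j : Fin n) : pathSum c ((l.flatMap fun i => w i :: h i) ++ [w j]) =
      pathSum (fun i i' => pathSum c (w i :: (h i ++ [w i']))) (l ++ [j]) := by
  induction l with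
  | nil => simp [pathSum]
  | cons i l ih =>
    cases l with
    | nil => simp [pathSum]
    | cons a l =>
      have ih' : pathSum (fun i i' => pathSum c (w i :: (h i ++ [w i']))) (a :: (l ++ [j])) = _ :=
        ih.symm
      rw [List.cons_append, List.cons_append, pathSum, ih', List.flatMap_cons, List.flatMap_cons,
        List.append_assoc, List.cons_append (a := w a), List.cons_append (a := w a),
        pathSum_append]
      simp

theorem pathSum_concat (c : α → α → ℤ) {l : List α} {a b : α} (hb : b ∈ l.getLast?) :
    pathSum c (l ++ [a]) = pathSum c l + c b a := by
  obtain ⟨l', rfl⟩ := List.getLast?_eq_some_iff.1 hb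
  rw [List.append_assoc, List.singleton_append, pathSum_append]
  simp [pathSum]

theorem pathSum_loop (hn : 0 < n) (c : α → α → ℤ) (w : Fin n → α) (h : Fin n → List α) :
    pathSum c (loop w h ++ [w ⟨0, hn⟩]) =
      ∑ i, pathSum c (w i :: (h i ++ [w (finRotate n i)])) := by
  rw [loop, pathSum_flatMap, pathSum_eq_sum (r := finRotate n)
    fun i j => pEdge_finRange_concat hn, List.dropLast_concat, Fin.sum_univ_def]

theorem pathSum_reverse {c : α → α → ℤ} (hc : ∀ x y, c y x = - c x y) (l : List α) :
    pathSum c l.reverse = - pathSum c l := by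
  induction l with
  | nil => simp [pathSum]
  | cons a l ih =>
    cases l with
    | nil => simp [pathSum]
    | cons b l =>
      rw [List.reverse_cons, pathSum_concat c (b := b) (by simp), ih, pathSum, hc a b]
      ring

variable {R : α → α → α → Prop}

theorem Tri.exists_list_loop (hn : 0 < n) {w : Fin n → α} {h : Fin n → List α}
    (ht : Tri R (loop w h)) : ∃ F : List (α × α × α), (∀ t ∈ F, R t.1 t.2.1 t.2.2) ∧
      Tri (fun a b c => (a, b, c) ∈ F) (loop w h) ∧
      ∀ c : α → α → ℤ, (∀ x y, c y x = - c x y) → (F.map (triSum c)).sum =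
        ∑ i, pathSum c (w i :: (h i ++ [w (finRotate n i)])) := by
  obtain ⟨F, h1, h2, h3⟩ := ht.exists_list
  refine ⟨F, h1, h2, fun c hc => ?_⟩
  obtain ⟨l, e⟩ := loop_eq_cons hn w h
  obtain ⟨b, hb⟩ : ∃ b, b ∈ (loop w h).getLast? := by
    rw [e]; exact ⟨_, List.getLast?_eq_some_getLast (List.cons_ne_nil _ _)⟩
  rw [h3 c hc (w ⟨0, hn⟩) (by rw [e]; simp) b hb, ← pathSum_loop hn, pathSum_concat c hb]

/-- The triangles of a pocket, turned around; their boundaries add up to the hull edge minus the chain. -/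
theorem Tri.exists_list_reverse {x y : α} {l : List α} (ht : Tri R (x :: (l ++ [y]))) :
    ∃ F : List (α × α × α), (∀ t ∈ F, R t.2.2 t.2.1 t.1) ∧
      Tri (fun a b c => (c, b, a) ∈ F) (x :: (l ++ [y])) ∧
      ∀ c : α → α → ℤ, (∀ x y, c y x = - c x y) → (F.map (triSum c)).sum =
        c x y - pathSum c (x :: (l ++ [y])) := by
  obtain ⟨F, h1, h2, h3⟩ := (ht.reverse (R' := fun a b c => R c b a) fun _ _ _ h => h).exists_list
  refine ⟨F, h1, ?_, fun c hc => ?_⟩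
  · have := h2.reverse (R' := fun a b c => (c, b, a) ∈ F) fun _ _ _ h => h
    rwa [List.reverse_reverse] at this
  · rw [h3 c hc y (by simp) x (by rw [List.reverse_cons]; exact List.getLast?_concat),
      pathSum_reverse hc]
    ring

/-- Triangles filling the inside of a closed list of chains, together with triangles between each
chain and its hull edge, fill the convex hull. -/
theorem IsHullCycle.isFilling {σ : ℝ} {P : Finset Plane} (p : α → Plane) {w : Fin n → α}
    {h : Fin n → List α} (hull : IsHullCycle σ P fun i => p (w i)) (hg : Generic (P : Set Plane))
    {F : List (α × α × α)} {G : Fin n → List (α × α × α)}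
    (hF : ∀ t ∈ F, (p t.1 ∈ P ∧ p t.2.1 ∈ P ∧ p t.2.2 ∈ P) ∧ 0 < sar σ (p t.1) (p t.2.1) (p t.2.2))
    (hG : ∀ i, ∀ t ∈ G i,
      (p t.1 ∈ P ∧ p t.2.1 ∈ P ∧ p t.2.2 ∈ P) ∧ 0 < sar σ (p t.1) (p t.2.1) (p t.2.2))
    (sF : ∀ c : α → α → ℤ, (∀ x y, c y x = - c x y) → (F.map (triSum c)).sum =
        ∑ i, pathSum c (w i :: (h i ++ [w (finRotate n i)])))
    (sG : ∀ i, ∀ c : α → α → ℤ, (∀ x y, c y x = - c x y) → ((G i).map (triSum c)).sum =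
        c (w i) (w (finRotate n i)) - pathSum c (w i :: (h i ++ [w (finRotate n i)]))) :
    IsFilling σ P (fun i => p (w i))
      ((F ++ (List.finRange n).flatMap G).map fun t => (p t.1, p t.2.1, p t.2.2)) := by
  have key : ∀ t ∈ F ++ (List.finRange n).flatMap G,
      (p t.1 ∈ P ∧ p t.2.1 ∈ P ∧ p t.2.2 ∈ P) ∧
        0 < sar σ (p t.1) (p t.2.1) (p t.2.2) := by
    intro t ht
    rcases List.mem_append.1 ht with ht | ht
    · exact hF t ht
    · obtain ⟨i, -, ht⟩ := List.mem_flatMap.1 ht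
      exact hG i t ht
  refine ⟨hull, hg, ?_, ?_, fun c hc => ?_⟩
  · intro t ht q hq
    obtain ⟨t', ht', rfl⟩ := List.mem_map.1 ht
    obtain ⟨h1, h2, h3⟩ := (key t' ht').1
    rcases hq with rfl | rfl | rfl
    · exact h1
    · exact h2
    · exact h3
  · intro t ht
    obtain ⟨t', ht', rfl⟩ := List.mem_map.1 ht
    exact (key t' ht').2
  · have hc' : ∀ x y : α, c (p y) (p x) = - c (p x) (p y) := fun x y => hc _ _
    have hsum : ∀ l : List (Fin n), ((l.flatMap G).map (triSum fun x y => c (p x) (p y))).sum =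
        (l.map fun i => c (p (w i)) (p (w (finRotate n i))) -
          pathSum (fun x y => c (p x) (p y)) (w i :: (h i ++ [w (finRotate n i)]))).sum := by
      intro l
      induction l with
      | nil => simp
      | cons i l ih =>
        rw [List.flatMap_cons, List.map_append, List.sum_append, sG i _ hc', ih]
        simp
    rw [List.map_map, show triSum c ∘ (fun t : α × α × α => (p t.1, p t.2.1, p t.2.2)) =
      triSum fun x y => c (p x) (p y) from rfl, List.map_append, List.sum_append, sF _ hc', hsum,
      ← Fin.sum_univ_def, Finset.sum_sub_distrib]
    ring

end Loop

/-! ### The polygon made of the hull chains -/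

/-- A counterclockwise triangle with corners in `Q` that do not all belong to the same hull
edge. -/
def Inner (σ : ℝ) (Q : Finset Plane) {n : ℕ} (w : Fin n → Plane) (S : Fin n → Finset Plane)
    (x y z : Plane) : Prop :=
  (x ∈ Q ∧ y ∈ Q ∧ z ∈ Q) ∧ 0 < sar σ x y z ∧ ∀ i, ¬ (Cls w S i x ∧ Cls w S i y ∧ Cls w S i z)

theorem Inner.cyc {σ : ℝ} {Q : Finset Plane} {n : ℕ} {w : Fin n → Plane} {S : Fin n → Finset Plane}
    {x y z : Plane} (h : Inner σ Q w S x y z) : Inner σ Q w S y z x :=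
  ⟨⟨h.1.2.1, h.1.2.2, h.1.1⟩, sar_cyc_pos _ _ _ h.2.1,
    fun i hi => h.2.2 i ⟨hi.2.2, hi.1, hi.2.1⟩⟩

/-- A choice of chains through points assigned to the hull edges, such that the polygon made of
these chains and the pockets between them and the hull edges are triangulated. -/
structure IsChainSystem (σ : ℝ) (Q : Finset Plane) {n : ℕ} (w : Fin n → Plane)
    (S : Fin n → Finset Plane) (h : Fin n → List Plane) : Prop where
  nodup : ∀ i, (h i).Nodup
  subset : ∀ i, ∀ x ∈ h i, x ∈ S i
  pocket : ∀ i, Tri (fun a b c => sar σ a b c < 0) (w i :: (h i ++ [w (finRotate n i)]))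
  inner : Tri (Inner σ Q w S) (loop w h)

theorem PEdge.mem_tail {α : Type*} {l : List α} {x y : α} (h : PEdge l x y) : y ∈ l.tail := by
  cases l with
  | nil => simp at h
  | cons a l =>
    cases l with
    | nil => simp at h
    | cons b l =>
      rcases h with ⟨-, rfl⟩ | h
      · simp
      · exact h.mem.2

/-- An ordered triple of entries of a list is still in cyclic order after rotating the list. -/
theorem sublist_cyc_of_append {α : Type*} {A B : List α} {a b c : α}
    (h : List.Sublist [a, b, c] (A ++ B)) : List.Sublist [a, b, c] (B ++ A) ∨
      List.Sublist [b, c, a] (B ++ A) ∨ List.Sublist [c, a, b] (B ++ A) := by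
  obtain ⟨l₁, l₂, e, h1, h2⟩ := List.sublist_append_iff.1 h
  have h3 := List.Sublist.append h2 h1
  match l₁, e with
  | [], e =>
    simp only [List.nil_append] at e
    subst e
    exact Or.inl (by simpa using h3)
  | [x], e =>
    simp only [List.cons_append, List.nil_append, List.cons.injEq] at e
    obtain ⟨rfl, rfl⟩ := e
    exact Or.inr (Or.inl h3)
  | [x, y], e =>
    simp only [List.cons_append, List.nil_append, List.cons.injEq] at e
    obtain ⟨rfl, rfl, rfl⟩ := e
    exact Or.inr (Or.inr h3)
  | x :: y :: z :: l, e =>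
    simp only [List.cons_append, List.cons.injEq, List.nil_eq, List.append_eq_nil_iff] at e
    obtain ⟨rfl, rfl, rfl, rfl, rfl⟩ := e
    exact Or.inl (by simpa using h3)

theorem IsHullChain.nonpos {σ : ℝ} {S : Finset Plane} {l : List Plane} (h : IsHullChain σ S l)
    {a b c : Plane} (hab : PEdge l a b) (hc : c ∈ l) : sar σ a b c ≤ 0 := by
  obtain ⟨A, B, rfl⟩ := hab.exists_append
  rcases List.mem_append.1 hc with hc | hc
  · have := h.triple c a b (List.Sublist.append (List.singleton_sublist.2 hc)
      (List.Sublist.cons_cons a (List.Sublist.cons_cons b (List.nil_sublist B))))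
    rw [sar_cyc] at this
    exact this.le
  · simp only [List.mem_cons] at hc
    rcases hc with rfl | rfl | hc
    · simp
    · simp
    · exact (h.triple a b c ((List.Sublist.cons_cons a (List.Sublist.cons_cons b
        (List.singleton_sublist.2 hc))).trans (List.sublist_append_right A _))).le

namespace IsDistribution
variable {σ : ℝ} {Q : Finset Plane} {n : ℕ} {w : Fin n → Plane} {S : Fin n → Finset Plane}

theorem cls_of_mem {h : Fin n → List Plane} (hs : ∀ i, ∀ x ∈ h i, x ∈ S i) {i : Fin n} {x : Plane}
    (hx : x ∈ w i :: (h i ++ [w (finRotate n i)])) : Cls w S i x := by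
  simp only [List.mem_cons, List.mem_append, List.not_mem_nil, or_false] at hx
  rcases hx with rfl | hx | rfl
  · exact Or.inl rfl
  · exact Or.inr (Or.inr (hs i x hx))
  · exact Or.inr (Or.inl rfl)

theorem ne_rotate (hd : IsDistribution σ Q w S) (i : Fin n) : finRotate n i ≠ i :=
  finRotate_ne (by have := hd.hull.three_le; omega) i

theorem not_cls_of_mem_rest (hd : IsDistribution σ Q w S) {h : Fin n → List Plane}
    (hs : ∀ i, ∀ x ∈ h i, x ∈ S i) {k : Fin n} {L : List (Fin n)} (h1 : k ∉ L)
    (h2 : finRotate n k ∉ L) {x : Plane}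
    (hx : x ∈ h (finRotate n k) ++ L.flatMap fun i => w i :: h i) : ¬ Cls w S k x := by
  have inS : ∀ i, i ≠ k → x ∈ h i → ¬ Cls w S k x := by
    rintro i hi hx (rfl | rfl | hk)
    · exact hd.ne_corner i _ (hs i _ hx) _ rfl
    · exact hd.ne_corner i _ (hs i _ hx) _ rfl
    · exact hi (hd.disjoint i k x (hs i x hx) hk)
  rcases List.mem_append.1 hx with hx | hx
  · exact inS _ (hd.ne_rotate k) hx
  obtain ⟨i, hi, hx⟩ := List.mem_flatMap.1 hx
  have hik : i ≠ k := by rintro rfl; exact h1 hi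
  have hik' : i ≠ finRotate n k := by rintro rfl; exact h2 hi
  rcases List.mem_cons.1 hx with rfl | hx
  · rintro (e | e | e)
    · exact hik (hd.hull.injective e)
    · exact hik' (hd.hull.injective e)
    · exact hd.ne_corner k _ e i rfl
  · exact inS i hik hx

theorem nodup_chain (hd : IsDistribution σ Q w S) {i : Fin n} {l : List Plane}
    (hnd : l.Nodup) (hs : ∀ x ∈ l, x ∈ S i) : (w i :: (l ++ [w (finRotate n i)])).Nodup := by
  rw [List.nodup_cons, List.mem_append, List.mem_singleton, List.nodup_append]
  refine ⟨?_, hnd, List.nodup_singleton _, ?_⟩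
  · rintro (h | h)
    · exact hd.ne_corner i _ (hs _ h) i rfl
    · exact hd.ne_rotate i (hd.hull.injective h).symm
  · intro x hx y hy
    rw [List.mem_singleton.1 hy]
    exact hd.ne_corner i _ (hs x hx) _

theorem nodup_loop (hd : IsDistribution σ Q w S) {h : Fin n → List Plane}
    (hnd : ∀ i, (h i).Nodup) (hs : ∀ i, ∀ x ∈ h i, x ∈ S i) : (loop w h).Nodup := by
  refine List.nodup_flatMap.2 ⟨fun i _ => ?_, ?_⟩
  · have := hd.nodup_chain (hnd i) (hs i)
    rw [← List.cons_append] at this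
    exact (List.nodup_append.1 this).1
  · refine (List.nodup_finRange n).imp fun {i j} hij => ?_
    intro x hx hx'
    rcases List.mem_cons.1 hx with rfl | hx
    · rcases List.mem_cons.1 hx' with e | hx'
      · exact hij (hd.hull.injective e)
      · exact hd.ne_corner j _ (hs j _ hx') i rfl
    · rcases List.mem_cons.1 hx' with rfl | hx'
      · exact hd.ne_corner i _ (hs i _ hx) j rfl
      · exact hij (hd.disjoint i j x (hs i x hx) (hs j x hx'))

/-- The polygon made of hull chains does not cross itself. -/
theorem fair_loop (hd : IsDistribution σ Q w S) {h : Fin n → List Plane}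
    (hs : ∀ i, ∀ x ∈ h i, x ∈ S i)
    (hc : ∀ i, IsHullChain σ (S i) (w i :: (h i ++ [w (finRotate n i)]))) : Fair (loop w h) := by
  have hn : 0 < n := by have := hd.hull.three_le; omega
  intro a b c d hab hcd
  obtain ⟨i, hi⟩ := hab.exists_chain hn
  obtain ⟨j, hj⟩ := hcd.exists_chain hn
  by_cases hij : i = j
  · subst hij
    intro hx
    have := ((cross_iff_sar hd.hull.isSign).1 hx).1
    exact absurd this (not_lt.2 (mul_nonneg_of_nonpos_of_nonpos
      ((hc i).nonpos hi hj.mem.1) ((hc i).nonpos hi hj.mem.2)))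
  · exact hd.not_cross hij (cls_of_mem hs hi.mem.1) (cls_of_mem hs hi.mem.2)
      (cls_of_mem hs hj.mem.1) (cls_of_mem hs hj.mem.2)

/-- The polygon made of the chains is counterclockwise: at the corner `w i`, this is the exchange
condition for the two neighbours. -/
theorem corner_nonneg (hd : IsDistribution σ Q w S) {i j : Fin n} (hj : finRotate n j = i)
    {a b : Plane} (ha : Cls w S i a) (hb : Cls w S j b) : 0 ≤ sar σ (w i) a b := by
  have h1 := hd.exchange i j a b ha hb
  rw [hj] at h1
  have hji : j ≠ i := by rintro rfl; exact hd.ne_rotate j hj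
  have hji' : j ≠ finRotate n i := by
    intro e
    rw [e] at hj
    exact finRotate_finRotate_ne hd.hull.three_le i hj
  have h2 := hd.hull.left i (w j) (hd.hull.mem j) (hd.hull.injective.ne hji)
    (hd.hull.injective.ne hji')
  have h3 := sar_gp σ (w i) (w (finRotate n i)) (w j) a b
  rw [sar_swap σ (w j) (w i) b, sar_swap σ (w j) (w i) a] at h3
  by_contra hneg
  nlinarith [mul_neg_of_pos_of_neg h2 (not_le.1 hneg)]

theorem mem_of_mem_loop (hd : IsDistribution σ Q w S) {h : Fin n → List Plane}
    (hs : ∀ i, ∀ x ∈ h i, x ∈ S i) {x : Plane} (hx : x ∈ loop w h) : x ∈ Q := by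
  obtain ⟨i, rfl | hx⟩ := mem_loop.1 hx
  · exact hd.hull.mem i
  · exact hd.subset i (hs i x hx)

/-- The polygon through the upper hulls of all classes, with its triangulation. Its triangles are not
contained in one class as they are counterclockwise, and three points of an upper hull are clockwise. -/
theorem exists_isChainSystem (hd : IsDistribution σ Q w S) : ∃ h, IsChainSystem σ Q w S h ∧
    ∀ i, IsHullChain σ (S i) (w i :: (h i ++ [w (finRotate n i)])) := by
  have hσ := hd.hull.isSign
  have hn := hd.hull.three_le
  have hn0 : 0 < n := by omega
  have hex : ∀ i, _ := fun i => exists_hullChain hσ (S i)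
    (hd.hull.injective.ne (hd.ne_rotate i).symm) (hd.generic.mono (by
      rintro z (rfl | rfl | hz)
      · exact hd.hull.mem _
      · exact hd.hull.mem _
      · exact hd.subset i hz)) (fun s hs => hd.hull.left i s (hd.subset i hs)
        (hd.ne_corner i s hs _) (hd.ne_corner i s hs _))
  choose h hs hnd hc using hex
  refine ⟨h, ⟨hnd, hs, fun i => Tri.of_triples (by simp) (hc i).triple, ?_⟩, hc⟩
  have hndl := hd.nodup_loop hnd hs
  have hlen : 3 ≤ (loop w h).length := by
    have : (Finset.univ.image w) ⊆ (loop w h).toFinset := by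
      intro x hx
      obtain ⟨i, -, rfl⟩ := Finset.mem_image.1 hx
      exact List.mem_toFinset.2 (mem_loop.2 ⟨i, Or.inl rfl⟩)
    have := Finset.card_le_card this
    rw [Finset.card_image_of_injective _ hd.hull.injective, List.toFinset_card_of_nodup hndl] at this
    simp at this
    omega
  obtain ⟨σ', hσ', htri⟩ := Fair.exists_tri hlen hndl (hd.generic.mono fun x hx =>
    hd.mem_of_mem_loop hs hx) (hd.fair_loop hs hc)
  -- the polygon has the same orientation as the hull
  have hσσ : σ' = σ := by
    obtain ⟨l, e⟩ := loop_eq_cons hn0 w h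
    obtain ⟨f, fA, f0, fpos⟩ := hd.hull.exists_support ⟨0, hn0⟩
    have htri' := htri
    rw [e] at htri' hlen hndl
    have hl2 : 2 ≤ l.length := by simpa using hlen
    obtain ⟨a, l', rfl⟩ : ∃ a l', l = a :: l' := by
      cases l with
      | nil => simp at hl2
      | cons a l' => exact ⟨a, l', rfl⟩
    obtain ⟨b, hb⟩ : ∃ b, b ∈ (a :: l').getLast? :=
      ⟨_, List.getLast?_eq_some_getLast (List.cons_ne_nil _ _)⟩
    have hpos := htri'.sar_head_pos fA f0 (fun x hx => fpos x (hd.mem_of_mem_loop hs (by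
      rw [e]; exact List.mem_cons_of_mem _ hx)) (by
        rintro rfl; exact (List.nodup_cons.1 hndl).1 hx)) hl2 a (by simp) b hb
    have c1 : CEdge (loop w h) (w ⟨0, hn0⟩) a := by
      rw [e]; exact Or.inl (Or.inl ⟨rfl, rfl⟩)
    have c2 : CEdge (loop w h) b (w ⟨0, hn0⟩) := by
      rw [e]
      refine Or.inr ⟨?_, rfl⟩
      rw [List.getLast?_cons_cons]; exact hb
    obtain ⟨i, hi⟩ := c1.exists_chain hn0
    obtain ⟨j, hj⟩ := c2.exists_chain hn0
    have ei : i = ⟨0, hn0⟩ := by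
      have h1 := hi.mem.1
      have h2 := PEdge.ne_last (l := w i :: h i) (by
        rw [List.cons_append]; exact hd.nodup_chain (hnd i) (hs i)) hi
      simp only [List.mem_cons, List.mem_append, List.not_mem_nil, or_false] at h1
      rcases h1 with h1 | h1 | h1
      · exact hd.hull.injective h1.symm
      · exact absurd rfl (hd.ne_corner i _ (hs i _ h1) _)
      · exact absurd h1 h2
    have ej : finRotate n j = ⟨0, hn0⟩ := by
      have h1 := hj.mem_tail
      simp only [List.tail_cons, List.mem_append, List.mem_singleton] at h1
      rcases h1 with h1 | h1
      · exact absurd rfl (hd.ne_corner j _ (hs j _ h1) _)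
      · exact hd.hull.injective h1.symm
    have hnn := hd.corner_nonneg ej (by rw [← ei]; exact cls_of_mem hs hi.mem.2)
      (cls_of_mem hs hj.mem.1)
    have cases' : σ' = σ ∨ σ' = -σ := by
      rcases hσ with rfl | rfl <;> rcases hσ' with rfl | rfl <;> simp
    rcases cases' with e' | e'
    · exact e'
    · rw [e', sar_neg] at hpos
      linarith
  rw [hσσ] at htri
  refine htri.sublist.mono fun a b c ⟨hpos, hsub⟩ => ⟨⟨hd.mem_of_mem_loop hs (hsub.subset (by simp)),
    hd.mem_of_mem_loop hs (hsub.subset (by simp)), hd.mem_of_mem_loop hs (hsub.subset (by simp))⟩,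
    hpos, fun k hk => ?_⟩
  -- triangles with corners on one hull chain are clockwise
  obtain ⟨L, -, hL1, hL2, hrot⟩ := exists_rotation_loop hn k
  obtain ⟨A, B, e1, e2⟩ := hrot w h
  have main : ∀ x y z, Cls w S k x → Cls w S k y → Cls w S k z →
      List.Sublist [x, y, z] (B ++ A) → sar σ x y z < 0 := by
    intro x y z hx hy hz hsub
    rw [e2] at hsub
    obtain ⟨l₁, l₂, e3, h1, h2⟩ := List.sublist_append_iff.1 hsub
    have : l₂ = [] := by
      refine List.eq_nil_iff_forall_not_mem.2 fun p hp => ?_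
      have hcl : Cls w S k p := by
        have : p ∈ [x, y, z] := by rw [e3]; exact List.mem_append_right _ hp
        simp only [List.mem_cons, List.not_mem_nil, or_false] at this
        rcases this with rfl | rfl | rfl
        · exact hx
        · exact hy
        · exact hz
      exact hd.not_cls_of_mem_rest hs hL1 hL2 (h2.subset hp) hcl
    rw [this, List.append_nil] at e3
    exact (hc k).triple x y z (by rwa [e3])
  rw [e1] at hsub
  rcases sublist_cyc_of_append hsub with hs' | hs' | hs'
  · have := main a b c hk.1 hk.2.1 hk.2.2 hs'
    linarith
  · have := main b c a hk.2.1 hk.2.2 hk.1 hs'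
    rw [← sar_cyc] at this
    linarith
  · have := main c a b hk.2.2 hk.1 hk.2.1 hs'
    rw [← sar_cyc'] at this
    linarith

end IsDistribution

/-! ### Extending one chain to all points assigned to its hull edge -/

theorem Strip.mono {α : Type*} {R R' : α → α → α → Prop} {g o : ℕ → α}
    (hR : ∀ a b c, R a b c → R' a b c) {m : ℕ} : ∀ {i : ℕ} {ρ : List α}, Strip R g o i m ρ →
      Strip R' g o i m ρ := by
  induction m with
  | zero => intro i ρ h; exact Tri.mono h hR
  | succ m ih =>
    rintro i ρ ⟨l₁, l₂, rfl, h1, h2, h3⟩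
    exact ⟨l₁, l₂, rfl, hR _ _ _ h1, h2.mono hR, ih h3⟩

/-- Consecutive segments in a list sorted by direction from `o` do not cross. -/
theorem not_cross_of_sorted {σ : ℝ} {o : Plane} {l : List Plane}
    (h : l.Pairwise fun x y => 0 < sar σ o x y) {a b c d : Plane} (hab : PEdge l a b)
    (hcd : PEdge l c d) : ¬ Cross a b c d := by
  -- if `a b` comes first, the line through `o` and `b` separates the segments
  have main : ∀ {l : List Plane}, (l.Pairwise fun x y => 0 < sar σ o x y) → ∀ {a b c d},
      PEdge l a b → PEdge l c d → ¬ Cross a b c d := by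
    intro l
    induction l with
    | nil => intro _ a b c d h; simp at h
    | cons x l ih =>
      cases l with
      | nil => intro _ a b c d h; simp at h
      | cons y l =>
        intro h
        have first : ∀ {c d}, PEdge (y :: l) c d → ¬ Cross x y c d := by
          intro c d hcd hx
          have hfd : 0 < sar σ o y d := by
            rw [List.pairwise_cons, List.pairwise_cons] at h
            exact h.2.1 d (by simpa using hcd.mem_tail)
          have hfc : 0 ≤ sar σ o y c := by
            rcases List.mem_cons.1 hcd.mem.1 with rfl | hc
            · simp
            · rw [List.pairwise_cons, List.pairwise_cons] at h
              exact (h.2.1 c hc).le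
          have hfx : sar σ o y x ≤ 0 := by
            rw [sar_swap']
            have := List.rel_of_pairwise_cons h (a' := y) (by simp)
            linarith
          have := (hx.eq_zero_of_separated (sar σ o y) (isAffine_sar σ o y).lineMap hfx (by simp)
            hfc hfd.le).2.2.2
          exact hfd.ne' this
        rintro a b c d (⟨rfl, rfl⟩ | hab) (⟨rfl, rfl⟩ | hcd)
        · exact not_cross_of_mem (Or.inl rfl)
        · exact first hcd
        · exact fun hx => first hab hx.symm
        · exact ih (List.pairwise_cons.1 h).2 hab hcd
  exact main h hab hcd

namespace IsChainSystem
variable {σ : ℝ} {Q : Finset Plane} {n : ℕ} {w : Fin n → Plane} {S : Fin n → Finset Plane}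
  {h : Fin n → List Plane}

/-- A triangle of the inner polygon, and the directions from a vertex of a hull chain into the
pocket between this chain and its hull edge, do not overlap. -/
theorem not_enters (st : IsChainSystem σ Q w S h) (hd : IsDistribution σ Q w S) (k : Fin n)
    (hc : IsHullChain σ (S k) (w k :: (h k ++ [w (finRotate n k)]))) :
    Tri (fun a b c => Inner σ Q w S a b c ∧ (a ∈ loop w h ∧ b ∈ loop w h ∧ c ∈ loop w h) ∧
      ∀ l₁ l₂ x y z, w k :: (h k ++ [w (finRotate n k)]) = l₁ ++ x :: y :: z :: l₂ →
        ∀ v, sar σ x y v < 0 → sar σ y z v < 0 → ¬ EntersTri σ (a, b, c) y v) (loop w h) := by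
  have hn : 0 < n := by have := hd.hull.three_le; omega
  have hin := st.inner.sublist.mono (R' := fun a b c => Inner σ Q w S a b c ∧
    (a ∈ loop w h ∧ b ∈ loop w h ∧ c ∈ loop w h)) fun a b c ⟨h1, h2⟩ =>
      ⟨h1, h2.subset (by simp), h2.subset (by simp), h2.subset (by simp)⟩
  obtain ⟨F, F1, F2, F3⟩ := hin.exists_list_loop hn
  refine F2.mono fun a b c habc => ⟨(F1 _ habc).1, (F1 _ habc).2, fun l₁ l₂ x y z e v hv1 hv2 hent => ?_⟩
  have hmem : ∀ i, ∀ x ∈ w i :: (h i ++ [w (finRotate n i)]), x ∈ Q := fun i x hx =>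
    hd.mem_of_cls (IsDistribution.cls_of_mem st.subset hx)
  have hpock : ∀ i, ∃ G : List (Plane × Plane × Plane),
      (∀ t ∈ G, (t.1 ∈ Q ∧ t.2.1 ∈ Q ∧ t.2.2 ∈ Q) ∧ 0 < sar σ t.1 t.2.1 t.2.2) ∧
      (i = k → (z, y, x) ∈ G) ∧
      ∀ c : Plane → Plane → ℤ, (∀ x y, c y x = - c x y) → (G.map (triSum c)).sum =
        c (w i) (w (finRotate n i)) - pathSum c (w i :: (h i ++ [w (finRotate n i)])) := by
    intro i
    by_cases hik : i = k
    · subst hik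
      have erev : l₂.reverse ++ z :: y :: x :: l₁.reverse =
          (w i :: (h i ++ [w (finRotate n i)])).reverse := by rw [e]; simp
      obtain ⟨G, G1, G2, G3⟩ := exists_list_ear (l₁ := l₂.reverse) (l₂ := l₁.reverse) (x := z)
        (y := y) (z := x)
        (R := fun a b c => (a ∈ Q ∧ b ∈ Q ∧ c ∈ Q) ∧ 0 < sar σ a b c) (by
          intro a b c hs
          rw [erev] at hs
          have hs' := hs.reverse
          rw [List.reverse_reverse] at hs'
          refine ⟨⟨hmem i _ (hs'.subset (by simp)), hmem i _ (hs'.subset (by simp)),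
            hmem i _ (hs'.subset (by simp))⟩, ?_⟩
          have := hc.triple c b a (by simpa using hs')
          rw [sar_rev] at this
          linarith)
      refine ⟨G, G1, fun _ => G2, fun c hc' => ?_⟩
      have := G3 c hc' (w (finRotate n i)) (by rw [erev]; simp) (w i) (by
        rw [erev, List.reverse_cons]; exact List.getLast?_concat)
      rw [this, erev, pathSum_reverse hc']
      ring
    · have := (st.pocket i).sublist.mono (R' := fun a b c => (c ∈ Q ∧ b ∈ Q ∧ a ∈ Q) ∧
        0 < sar σ c b a) fun a b c ⟨h1, h2⟩ =>
          ⟨⟨hmem i _ (h2.subset (by simp)), hmem i _ (h2.subset (by simp)),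
            hmem i _ (h2.subset (by simp))⟩, by rw [sar_rev]; linarith⟩
      obtain ⟨G, G1, -, G3⟩ := this.exists_list_reverse
      exact ⟨G, G1, fun h => absurd h hik, G3⟩
  choose G G1 G2 G3 using hpock
  have hfill := IsHullCycle.isFilling (p := fun x : Plane => x) hd.hull hd.generic
    (fun t ht => ⟨(F1 t ht).1.1, (F1 t ht).1.2.1⟩) G1 F3 G3
  have hmemG : (z, y, x) ∈ (F ++ (List.finRange n).flatMap G).map fun t => (t.1, t.2.1, t.2.2) :=
    List.mem_map.2 ⟨(z, y, x), List.mem_append_right _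
      (List.mem_flatMap.2 ⟨k, List.mem_finRange k, G2 k rfl⟩), rfl⟩
  have hmemF : (a, b, c) ∈ (F ++ (List.finRange n).flatMap G).map fun t => (t.1, t.2.1, t.2.2) :=
    List.mem_map.2 ⟨(a, b, c), List.mem_append_left _ habc, rfl⟩
  have hxyz : sar σ x y z < 0 := hc.triple x y z (by
    rw [e]
    exact (List.Sublist.cons_cons x (List.Sublist.cons_cons y (List.Sublist.cons_cons z
      (List.nil_sublist l₂)))).trans (List.sublist_append_right _ _))
  refine hfill.not_enters hmemF hmemG ?_ hent ⟨Or.inr ⟨by simp, ?_⟩, Or.inr ⟨by simp, ?_⟩,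
    Or.inl ?_⟩
  · rintro heq
    simp only [Prod.mk.injEq] at heq
    obtain ⟨rfl, rfl, rfl⟩ := heq
    have hcl : ∀ u ∈ c :: b :: a :: l₂, Cls w S k u := fun u hu =>
      IsDistribution.cls_of_mem st.subset (by rw [e]; exact List.mem_append_right _ hu)
    exact (F1 _ habc).1.2.2 k ⟨hcl _ (by simp), hcl _ (by simp), hcl _ (by simp)⟩
  · show 0 < sar σ z y v
    rw [sar_swap]; linarith
  · show 0 < sar σ y x v
    rw [sar_swap]; linarith
  · show 0 < sar σ x z y
    rw [sar_swap']; linarith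

end IsChainSystem

theorem cons_sublist_range' {a N x : ℕ} {l : List ℕ} (h1 : a ≤ x) (h2 : x < a + N)
    (h : l.Sublist (List.range' (x + 1) (a + N - x - 1))) :
    (x :: l).Sublist (List.range' a N) := by
  have e : List.range' a N = List.range' a (x - a) ++ List.range' x (a + N - x) := by
    have := List.range'_append (s := a) (m := x - a) (n := a + N - x) (step := 1)
    rw [show a + 1 * (x - a) = x by omega, show x - a + (a + N - x) = N by omega] at this
    exact this.symm
  rw [e, show a + N - x = (a + N - x - 1) + 1 by omega, List.range'_succ]
  exact (List.Sublist.cons_cons x h).trans (List.sublist_append_right _ _)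

theorem range'_zero_eq_append {t m : ℕ} (h : t ≤ m) :
    List.range' 0 m = List.range' 0 t ++ List.range' t (m - t) := by
  have := List.range'_append (s := 0) (m := t) (n := m - t) (step := 1)
  rw [show 0 + 1 * t = t by omega, show t + (m - t) = m by omega] at this
  exact this.symm

theorem map_getD_range' {α : Type*} {L : List α} {m : ℕ} (hL : L.length = m + 1) (a : α) :
    (List.range' 0 (m + 1)).map (fun t => L.getD t a) = L := by
  refine List.ext_getElem (by simp [hL]) fun i h1 h2 => ?_
  simp [List.getElem?_eq_getElem h2]

namespace IsChainSystem
variable {σ : ℝ} {Q : Finset Plane} {n : ℕ} {w : Fin n → Plane} {S : Fin n → Finset Plane}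
  {h : Fin n → List Plane}

/-- A hull chain can be extended to a chain through all points assigned to its hull edge, such
that the polygon and the pocket are still triangulated. -/
theorem exists_extension (st : IsChainSystem σ Q w S h) (hd : IsDistribution σ Q w S) (k : Fin n)
    (hc : IsHullChain σ (S k) (w k :: (h k ++ [w (finRotate n k)]))) :
    ∃ path : List Plane, (∀ z, z ∈ path ↔ z ∈ S k) ∧ IsChainSystem σ Q w S (Function.update h k path) := by
  classical
  have hσ := hd.hull.isSign
  have hn := hd.hull.three_le
  obtain ⟨Rest, hRest, hk1, hk2, hrot⟩ := exists_rotation_loop hn k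
  set L := w k :: (h k ++ [w (finRotate n k)]) with hL
  set m := (h k).length + 1 with hm
  have hlen : L.length = m + 1 := by simp [hL, hm]
  set g : ℕ → Plane := fun t => L.getD t (w k) with hg
  have hmap : (List.range' 0 (m + 1)).map g = L := map_getD_range' hlen _
  have g0 : g 0 = w k := by simp [hg, hL]
  have gm : g m = w (finRotate n k) := by simp [hg, hL, hm]
  have gL : ∀ t ≤ m, g t ∈ L := fun t ht => by
    rw [← hmap]; exact List.mem_map_of_mem (by rw [List.mem_range'_1]; omega)
  have exg : ∀ x ∈ L, ∃ t ≤ m, x = g t := fun x hx => by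
    rw [← hmap] at hx
    obtain ⟨t, ht, rfl⟩ := List.mem_map.1 hx
    rw [List.mem_range'_1] at ht
    exact ⟨t, by omega, rfl⟩
  have hLnd : L.Nodup := hd.nodup_chain (st.nodup k) (st.subset k)
  have gne : ∀ s t, s < t → t ≤ m → g s ≠ g t := by
    intro s t hst ht
    have hs : ([s, t].map g).Sublist L := by
      rw [← hmap]
      exact (cons_sublist_range' (by omega) (by omega) (cons_sublist_range' (by omega) (by omega)
        (List.nil_sublist _))).map g
    have := hLnd.sublist hs
    simpa using this
  have gcls : ∀ t ≤ m, Cls w S k (g t) := fun t ht =>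
    IsDistribution.cls_of_mem st.subset (gL t ht)
  have gedge : ∀ t < m, PEdge L (g t) (g (t + 1)) := by
    intro t ht
    rw [← hmap, range'_zero_eq_append (t := t) (by omega),
      show m + 1 - t = (m - 1 - t) + 1 + 1 by omega, List.range'_succ, List.range'_succ,
      List.map_append, pEdge_append]
    exact Or.inr (Or.inl (Or.inl ⟨rfl, rfl⟩))
  have gsplit : ∀ t, t + 1 < m → ∃ l₁ l₂, L = l₁ ++ g t :: g (t + 1) :: g (t + 2) :: l₂ := by
    intro t ht
    refine ⟨(List.range' 0 t).map g, (List.range' (t + 3) (m - 2 - t)).map g, ?_⟩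
    rw [← hmap, range'_zero_eq_append (t := t) (by omega),
      show m + 1 - t = (m - 2 - t) + 1 + 1 + 1 by omega, List.range'_succ, List.range'_succ,
      List.range'_succ, List.map_append]
    rfl
  set E := (S k).filter (fun z => z ∉ h k) with hE
  have ES : ∀ z ∈ E, z ∈ S k ∧ z ∉ h k := fun z hz => Finset.mem_filter.1 hz
  have EL : ∀ z ∈ E, z ∉ L := by
    intro z hz hzL
    simp only [hL, List.mem_cons, List.mem_append, List.not_mem_nil, or_false] at hzL
    rcases hzL with rfl | hzL | rfl
    · exact hd.ne_corner k _ (ES _ hz).1 _ rfl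
    · exact (ES _ hz).2 hzL
    · exact hd.ne_corner k _ (ES _ hz).1 _ rfl
  have Eloop : ∀ z ∈ E, z ∉ loop w h := by
    intro z hz hzl
    obtain ⟨i, rfl | hi⟩ := mem_loop.1 hzl
    · exact hd.ne_corner k _ (ES _ hz).1 _ rfl
    · have := hd.disjoint i k z (st.subset i z hi) (ES z hz).1
      subst this
      exact (ES z hz).2 hi
  have Eright : ∀ z ∈ E, ∀ t < m, sar σ (g t) (g (t + 1)) z < 0 := fun z hz t ht =>
    hc.right _ _ (gedge t ht) z (ES z hz).1 (fun e => EL z hz (e ▸ gL t ht.le))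
      (fun e => EL z hz (e ▸ gL (t + 1) ht))
  have EQ : ∀ z ∈ E, z ∈ Q := fun z hz => hd.subset k (ES z hz).1
  -- the triangles at the edges of the chain
  obtain ⟨A, B, e1, e2⟩ := hrot w h
  set ρ := h (finRotate n k) ++ Rest.flatMap (fun i => w i :: h i) with hρ
  have hρ0 : ρ ≠ [] := by
    obtain ⟨r, Rest', rfl⟩ := List.exists_cons_of_ne_nil hRest
    simp [hρ]
  have htri : Tri (fun a b c => Inner σ Q w S a b c ∧
      (a ∈ loop w h ∧ b ∈ loop w h ∧ c ∈ loop w h) ∧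
      ∀ l₁ l₂ x y z, L = l₁ ++ x :: y :: z :: l₂ →
        ∀ v, sar σ x y v < 0 → sar σ y z v < 0 → ¬ EntersTri σ (a, b, c) y v)
      ((List.range' 0 (m + 1)).map g ++ ρ) := by
    rw [hmap, ← e2]
    refine Tri.rotate ?_ (by rw [← e1]; exact st.not_enters hd k hc)
    rintro a b c ⟨h1, ⟨h2, h3, h4⟩, h5⟩
    exact ⟨h1.cyc, ⟨h3, h4, h2⟩, fun l₁ l₂ x y z e v hv1 hv2 ⟨u1, u2, u3⟩ =>
      h5 l₁ l₂ x y z e v hv1 hv2 ⟨u3, u1, u2⟩⟩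
  obtain ⟨o, hstrip⟩ := exists_strip (V := {x | Cls w S k x}) htri hρ0
    (fun t _ ht => gcls t (by omega)) (fun x y z hx hy hr hz => hr.1.2.2 k ⟨hx, hy, hz⟩)
  have hap : ∀ t < m, Inner σ Q w S (g t) (g (t + 1)) (o t) ∧ o t ∈ loop w h := fun t ht =>
    ⟨(hstrip.apex t (by omega) (by omega)).1, (hstrip.apex t (by omega) (by omega)).2.1.2.2⟩
  have ocls : ∀ t < m, ¬ Cls w S k (o t) := fun t ht hcl =>
    (hap t ht).1.2.2 k ⟨gcls t ht.le, gcls (t + 1) ht, hcl⟩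
  have hchain : IsFanChain σ (Q : Set Plane) g o m := by
    refine ⟨hσ, hd.generic, fun t ht => hd.mem_of_cls (gcls t ht), fun t ht => (hap t ht).1.1.2.2,
      fun t ht s hs e => ocls t ht (e ▸ gcls s hs), fun i j l hij hjl hl => hc.triple _ _ _ ?_,
      fun t ht => (hap t ht).1.2.1⟩
    have := (cons_sublist_range' (a := 0) (N := m + 1) (x := i) (by omega) (by omega)
      (cons_sublist_range' (x := j) (by omega) (by omega)
      (cons_sublist_range' (x := l) (by omega) (by omega) (List.nil_sublist _)))).map g
    rwa [hmap] at this
  have hpoint : ∀ z ∈ E, IsFanPoint σ (Q : Set Plane) g o m z := by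
    intro z hz
    refine ⟨EQ z hz, fun t ht e => EL z hz (e ▸ gL t ht),
      fun t ht e => Eloop z hz (e ▸ (hap t ht).2), Eright z hz, fun t ht hpos => ?_⟩
    refine hstrip.fan (p := fun y => 0 < sar σ y z (g (t + 1))) t (by omega) (by omega) ?_ hpos
    rintro a b ⟨hin, ⟨-, -, hb⟩, hent⟩ hpa
    by_contra hpb
    obtain ⟨l₁, l₂, e⟩ := gsplit t ht
    have hzv : z ≠ g (t + 1) := fun e => EL z hz (e ▸ gL (t + 1) (by omega))
    have hbv : b ≠ g (t + 1) := by
      rintro rfl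
      have := hin.2.1
      simp at this
    rcases hd.generic.pos_or_neg hσ hin.1.2.2 (EQ z hz) hin.1.1
      (fun e => Eloop z hz (e ▸ hb)) hbv hzv with hh | hh
    · exact hpb hh
    refine hent l₁ l₂ _ _ _ e z (Eright z hz t (by omega)) (Eright z hz (t + 1) (by omega))
      ⟨Or.inr ⟨by simp, ?_⟩, Or.inl ?_, Or.inr ⟨by simp, ?_⟩⟩
    · show 0 < sar σ (g (t + 1)) a z
      rw [sar_cyc]; exact hpa
    · exact sar_cyc_pos _ _ _ hin.2.1
    · show 0 < sar σ b (g (t + 1)) z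
      rw [sar_swap']; linarith
  -- the chain begins and ends in corners
  have hends : ∀ z ∈ E, 0 < sar σ (o 0) (g 0) z ∧ 0 < sar σ (o (m - 1)) z (g m) := by
    intro z hz
    have hne : ∀ t < m, ∀ s ≤ m, o t ≠ g s := hchain.apex_ne
    have hzg : ∀ t ≤ m, z ≠ g t := fun t ht e => EL z hz (e ▸ gL t ht)
    constructor
    · obtain ⟨f, fA, f0, fpos⟩ := hd.hull.exists_support k
      rw [← g0] at f0 fpos
      have p1 := fpos z (EQ z hz) (hzg 0 (by omega))
      have p2 := fpos (g 1) (hchain.mem 1 (by omega)) (gne 0 1 (by omega) (by omega)).symm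
      have p3 := fpos (o 0) (hchain.apex_mem 0 (by omega)) (hne 0 (by omega) 0 (by omega))
      have q1 := Eright z hz 0 (by omega)
      have q2 := hchain.apex_left 0 (by omega)
      rw [sar_cyc]
      refine fA.sar_trans f0 p1 p2 p3 ?_ q2
      rw [sar_swap']; linarith
    · obtain ⟨f, fA, f0, fpos⟩ := hd.hull.exists_support (finRotate n k)
      rw [← gm] at f0 fpos
      have p1 := fpos z (EQ z hz) (hzg m (by omega))
      have p2 := fpos (g (m - 1)) (hchain.mem (m - 1) (by omega))
        (gne (m - 1) m (by omega) (by omega))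
      have p3 := fpos (o (m - 1)) (hchain.apex_mem (m - 1) (by omega))
        (hne (m - 1) (by omega) m (by omega))
      have q1 := Eright z hz (m - 1) (by omega)
      have q2 := hchain.apex_left (m - 1) (by omega)
      rw [show m - 1 + 1 = m by omega] at q1 q2
      rw [sar_cyc']
      refine fA.sar_trans f0 p3 p2 p1 ?_ ?_
      · rw [sar_cyc] at q2; exact q2
      · rw [sar_swap]; linarith
  obtain ⟨τ, hτ1, hτ2⟩ := hchain.exists_distribution (d := m - 1) (i := 0) (j := m) (by omega)
    le_rfl E hpoint hends
  have hsort : ∀ t, ∃ l : List Plane, l.Nodup ∧ (∀ z, z ∈ l ↔ z ∈ E ∧ τ z = t) ∧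
      (t < m → (g t :: (l ++ [g (t + 1)])).Pairwise fun x y => 0 < sar σ (o t) x y) := by
    intro t
    by_cases ht : t < m
    · obtain ⟨l, l1, l2, l3⟩ := exists_angular_sort hσ (o := o t) (a := g t) (b := g (t + 1))
        (E.filter fun z => τ z = t) (hd.generic.mono (by
          rintro z (rfl | hz)
          · exact hchain.apex_mem t ht
          · exact EQ z (Finset.mem_filter.1 hz).1)) (by
          rw [sar_cyc]; exact hchain.apex_left t ht) (by
          intro z hz
          have h1 := Finset.mem_filter.1 hz
          rw [← h1.2]
          exact (hτ1 z h1.1).2.2)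
      exact ⟨l, l1, fun z => by rw [l2, Finset.mem_filter], fun _ => l3⟩
    · refine ⟨[], List.nodup_nil, fun z => ?_, fun h => absurd h ht⟩
      simp only [List.not_mem_nil, false_iff, not_and]
      rintro hz rfl
      exact ht (hτ1 z hz).2.1
  choose ζ ζ1 ζ2 ζ3 using hsort
  have hblock : ∀ t x, x ∈ g t :: (ζ t ++ [g (t + 1)]) → InBlock g E τ t x := by
    intro t x hx
    simp only [List.mem_cons, List.mem_append, List.not_mem_nil, or_false] at hx
    rcases hx with rfl | hx | rfl
    · exact Or.inl rfl
    · exact Or.inr (Or.inr ((ζ2 t x).1 hx))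
    · exact Or.inr (Or.inl rfl)
  have hbcls : ∀ t < m, ∀ x, InBlock g E τ t x → Cls w S k x := by
    rintro t ht x (rfl | rfl | ⟨hx, -⟩)
    · exact gcls t ht.le
    · exact gcls (t + 1) ht
    · exact Or.inr (Or.inr (ES x hx).1)
  obtain ⟨path, hpath⟩ : ∃ path, weave g ζ 0 m = w k :: (path ++ [w (finRotate n k)]) := by
    obtain ⟨m', hm'⟩ : ∃ m', m = m' + 1 := ⟨m - 1, by omega⟩
    rw [← g0, ← gm, hm', weave]
    obtain ⟨l, e⟩ := exists_weave_eq_concat g ζ m' (0 + 1)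
    exact ⟨ζ 0 ++ l, by rw [e, show 0 + 1 + m' = m' + 1 by omega]; simp⟩
  have hwnd : (weave g ζ 0 m).Nodup := by
    refine nodup_weave (fun s t _ h1 h2 => gne s t h1 (by omega)) ζ1 (fun s t _ h1 h2 h3 => ?_)
      fun s t x h1 h2 => by rw [← ((ζ2 s x).1 h1).2, ← ((ζ2 t x).1 h2).2]
    exact EL _ ((ζ2 t _).1 h3).1 (gL s (by omega))
  have hwmem : ∀ x, x ∈ weave g ζ 0 m ↔ x ∈ L ∨ x ∈ E := by
    intro x
    rw [mem_weave]
    constructor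
    · rintro (⟨t, -, ht, rfl⟩ | ⟨t, -, -, ht⟩)
      · exact Or.inl (gL t (by omega))
      · exact Or.inr ((ζ2 t x).1 ht).1
    · rintro (hx | hx)
      · obtain ⟨t, ht, rfl⟩ := exg x hx
        exact Or.inl ⟨t, by omega, by omega, rfl⟩
      · exact Or.inr ⟨τ x, by omega, by have := (hτ1 x hx).2.1; omega, (ζ2 _ x).2 ⟨hx, rfl⟩⟩
  have hwcls : ∀ x, x ∈ weave g ζ 0 m → Cls w S k x := by
    intro x hx
    rcases (hwmem x).1 hx with hx | hx
    · exact IsDistribution.cls_of_mem st.subset hx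
    · exact Or.inr (Or.inr (ES x hx).1)
  have hpnd := hwnd
  rw [hpath, List.nodup_cons, List.nodup_append] at hpnd
  have hpmem : ∀ z, z ∈ path ↔ z ∈ S k := by
    intro z
    constructor
    · intro hz
      rcases hwcls z (by rw [hpath]; simp [hz]) with rfl | rfl | hz'
      · exact absurd (List.mem_append_left _ hz) hpnd.1
      · exact absurd rfl (hpnd.2.2.2 _ hz _ (List.mem_singleton_self _))
      · exact hz'
    · intro hz
      have : z ∈ weave g ζ 0 m := by
        rw [hwmem]
        by_cases hzh : z ∈ h k
        · exact Or.inl (by simp [hL, hzh])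
        · exact Or.inr (Finset.mem_filter.2 ⟨hz, hzh⟩)
      rw [hpath] at this
      simp only [List.mem_cons, List.mem_append, List.not_mem_nil, or_false] at this
      rcases this with rfl | hz' | rfl
      · exact absurd rfl (hd.ne_corner k _ hz _)
      · exact hz'
      · exact absurd rfl (hd.ne_corner k _ hz _)
  refine ⟨path, hpmem, ?_, ?_, ?_, ?_⟩
  · intro i
    by_cases hik : i = k
    · subst hik; rw [Function.update_self]; exact hpnd.2.1
    · rw [Function.update_of_ne hik]; exact st.nodup i
  · intro i x hx
    by_cases hik : i = k
    · subst hik; rw [Function.update_self] at hx; exact (hpmem x).1 hx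
    · rw [Function.update_of_ne hik] at hx; exact st.subset i x hx
  · intro i
    by_cases hik : i = k
    swap
    · rw [Function.update_of_ne hik]; exact st.pocket i
    subst hik
    rw [Function.update_self, ← hpath]
    -- the pocket polygon does not cross itself
    have hfair : Fair (weave g ζ 0 m) := by
      have hbase : ∀ c d, c ∈ weave g ζ 0 m → d ∈ weave g ζ 0 m →
          ¬ Cross (w (finRotate n i)) (w i) c d := by
        intro c d hc' hd' hx
        have hx := ((cross_iff_sar hσ).1 hx.swap_left).1
        exact absurd hx (not_lt.2 (mul_nonneg
          (hd.hull.nonneg i (hd.mem_of_cls (hwcls c hc')))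
          (hd.hull.nonneg i (hd.mem_of_cls (hwcls d hd')))))
      have hclose : ∀ a b, CEdge (weave g ζ 0 m) a b →
          PEdge (weave g ζ 0 m) a b ∨ (a = w (finRotate n i) ∧ b = w i) := by
        rintro a b (hab | ⟨h1, h2⟩)
        · exact Or.inl hab
        · rw [hpath] at h1 h2
          rw [← List.cons_append, List.getLast?_concat] at h1
          simp only [List.head?_cons, Option.some.injEq] at h1 h2
          exact Or.inr ⟨h1.symm, h2.symm⟩
      intro a b c d hab hcd
      rcases hclose a b hab with hab' | ⟨rfl, rfl⟩
      · rcases hclose c d hcd with hcd' | ⟨rfl, rfl⟩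
        · obtain ⟨t, -, ht, hab''⟩ := hab'.weave
          obtain ⟨t', -, ht', hcd''⟩ := hcd'.weave
          rcases lt_trichotomy t t' with htt | rfl | htt
          · exact hτ2 t t' (by omega) htt (by omega) _ _ _ _ (hblock t _ hab''.mem.1)
              (hblock t _ hab''.mem.2) (hblock t' _ hcd''.mem.1) (hblock t' _ hcd''.mem.2)
          · exact not_cross_of_sorted (ζ3 t (by omega)) hab'' hcd''
          · exact fun hx => hτ2 t' t (by omega) htt (by omega) _ _ _ _ (hblock t' _ hcd''.mem.1)
              (hblock t' _ hcd''.mem.2) (hblock t _ hab''.mem.1) (hblock t _ hab''.mem.2) hx.symm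
        · exact fun hx => hbase a b hab.mem.1 hab.mem.2 hx.symm
      · exact hbase c d hcd.mem.1 hcd.mem.2
    cases hp : path with
    | nil =>
      rw [hpath, hp]
      exact Tri.edge _ _
    | cons p₁ path' =>
      have hl3 : 3 ≤ (weave g ζ 0 m).length := by rw [hpath, hp]; simp
      obtain ⟨σ', hσ', htri'⟩ := Fair.exists_tri hl3 hwnd (hd.generic.mono fun x hx =>
        hd.mem_of_cls (hwcls x hx)) hfair
      have hQ : ∀ x ∈ weave g ζ 0 m, x ∈ Q := fun x hx => hd.mem_of_cls (hwcls x hx)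
      obtain ⟨f, fA, f0, fpos⟩ := hd.hull.exists_support i
      have hpos : 0 < sar σ' (w i) p₁ (w (finRotate n i)) := by
        have ht := htri'
        rw [hpath] at ht
        refine ht.sar_head_pos fA f0 (fun x hx => fpos x (hQ x (by
          rw [hpath]; exact List.mem_cons_of_mem _ hx)) ?_) (by simp [hp]) p₁ (by simp [hp]) _
          List.getLast?_concat
        rintro rfl
        exact hpnd.1 hx
      have hneg : sar σ (w i) p₁ (w (finRotate n i)) < 0 := by
        have hp1 : p₁ ∈ S i := (hpmem p₁).1 (by simp [hp])
        rw [sar_swap']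
        have := hd.hull.left i p₁ (hd.subset i hp1) (hd.ne_corner i _ hp1 _)
          (hd.ne_corner i _ hp1 _)
        linarith
      have cases' : σ' = σ ∨ σ' = -σ := by
        rcases hσ with rfl | rfl <;> rcases hσ' with rfl | rfl <;> simp
      rcases cases' with e' | e'
      · rw [e'] at hpos; linarith
      · rw [e'] at htri'
        refine htri'.mono fun a b c habc => ?_
        rw [sar_neg] at habc
        linarith
  · have hfan : ∀ t, 0 ≤ t → t < 0 + m → ∀ a b, PEdge (g t :: (ζ t ++ [g (t + 1)])) a b →
        Inner σ Q w S a b (o t) := by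
      intro t _ ht a b hab
      have ht : t < m := by omega
      have ha := hbcls t ht a (hblock t a hab.mem.1)
      have hb := hbcls t ht b (hblock t b hab.mem.2)
      have hpos : 0 < sar σ (o t) a b := by
        obtain ⟨l₁, l₂, e⟩ := hab.exists_append
        have := ζ3 t ht
        rw [e] at this
        exact List.rel_of_pairwise_cons (List.pairwise_append.1 this).2.1 (by simp)
      refine ⟨⟨hd.mem_of_cls ha, hd.mem_of_cls hb, hchain.apex_mem t ht⟩, sar_cyc_pos _ _ _ hpos,
        fun i ⟨hia, hib, hio⟩ => ?_⟩
      by_cases hik : i = k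
      · subst hik; exact ocls t ht hio
      · have hab' : a ≠ b := by
          rintro rfl
          simp at hpos
        exact hd.hull.edge_inter hik hab' (hd.eq_zero_of_cls hik hia ha)
          (hd.eq_zero_of_cls hik hib hb)
    have hnew := (hstrip.mono (R' := Inner σ Q w S) fun a b c habc => habc.1).weave hfan
    obtain ⟨A', B', e1', e2'⟩ := hrot w (Function.update h k path)
    rw [e1']
    refine Tri.rotate (fun a b c habc => habc.cyc) ?_
    rw [e2', Function.update_self, Function.update_of_ne (hd.ne_rotate k), ← hpath]
    have : (Rest.flatMap fun i => w i :: Function.update h k path i) =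
        Rest.flatMap fun i => w i :: h i := by
      refine List.flatMap_congr fun i hi => ?_
      rw [Function.update_of_ne]
      rintro rfl
      exact hk1 hi
    rw [this]
    exact hnew

end IsChainSystem

/-! ### Triangulating by labels -/

/-- Extending the upper hulls one after the other to all points of their classes. -/
theorem IsDistribution.exists_paths {σ : ℝ} {Q : Finset Plane} {n : ℕ} {w : Fin n → Plane}
    {S : Fin n → Finset Plane} (hd : IsDistribution σ Q w S) :
    ∃ path, IsChainSystem σ Q w S path ∧ ∀ i z, z ∈ path i ↔ z ∈ S i := by
  classical
  obtain ⟨h, st, hc⟩ := hd.exists_isChainSystem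
  have main : ∀ T : Finset (Fin n), ∃ path, IsChainSystem σ Q w S path ∧
      (∀ i ∈ T, ∀ z, z ∈ path i ↔ z ∈ S i) ∧ ∀ i ∉ T, path i = h i := by
    intro T
    induction T using Finset.induction_on with
    | empty => exact ⟨h, st, by simp, fun _ _ => rfl⟩
    | insert k T hk ih =>
      obtain ⟨path, st', h1, h2⟩ := ih
      obtain ⟨new, h3, h4⟩ := st'.exists_extension hd k (by rw [h2 k hk]; exact hc k)
      refine ⟨_, h4, fun i hi => ?_, fun i hi => ?_⟩
      · by_cases hik : i = k
        · subst hik; rw [Function.update_self]; exact h3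
        · rw [Function.update_of_ne hik]
          exact h1 i ((Finset.mem_insert.1 hi).resolve_left hik)
      · rw [Finset.mem_insert, not_or] at hi
        rw [Function.update_of_ne hi.1]
        exact h2 i hi.2
  obtain ⟨path, st', h1, -⟩ := main Finset.univ
  exact ⟨path, st', fun i => h1 i (Finset.mem_univ i)⟩

section Labels
variable {n : ℕ} {c : Fin n → ℕ}

/-- The labels of the inner points of the `i`-th chain. -/
def labChain (c : Fin n → ℕ) (i : Fin n) : List (Lab c) :=
  (List.finRange (c i)).map fun j => ⟨i, j.succ⟩

theorem three_le_length_loop {α : Type*} (hn : 3 ≤ n) (w : Fin n → α) (h : Fin n → List α) :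
    3 ≤ (loop w h).length := by
  have : (loop w h).length = ∑ i, ((h i).length + 1) := by
    rw [loop, List.length_flatMap, Fin.sum_univ_def]
    simp
  rw [this, Finset.sum_add_distrib]
  simp
  omega

theorem mem_loop_labChain (x : Lab c) : x ∈ loop (fun i => (⟨i, 0⟩ : Lab c)) (labChain c) := by
  obtain ⟨i, s⟩ := x
  refine mem_loop.2 ⟨i, ?_⟩
  refine Fin.cases (Or.inl rfl) (fun j => Or.inr ?_) s
  exact List.mem_map.2 ⟨j, List.mem_finRange j, rfl⟩

theorem pairwise_labLt : (loop (fun i => (⟨i, 0⟩ : Lab c)) (labChain c)).Pairwise LabLt := by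
  refine List.pairwise_flatMap.2 ⟨fun i _ => ?_, ?_⟩
  · rw [List.pairwise_cons]
    constructor
    · intro x hx
      obtain ⟨j, -, rfl⟩ := List.mem_map.1 hx
      exact Or.inr ⟨rfl, by simp⟩
    · refine List.Pairwise.map _ (R := fun a b : Fin (c i) => a < b) (fun a b hab => ?_)
        (List.pairwise_lt_finRange _)
      exact Or.inr ⟨rfl, by simpa using hab⟩
  · have hfst : ∀ (i : Fin n) (x : Lab c), x ∈ (⟨i, 0⟩ : Lab c) :: labChain c i → x.1 = i := by
      intro i x hx
      rcases List.mem_cons.1 hx with rfl | hx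
      · rfl
      · obtain ⟨j, -, rfl⟩ := List.mem_map.1 hx
        rfl
    refine (List.pairwise_lt_finRange n).imp fun {i j} hij x hx y hy => Or.inl ?_
    rw [hfst i x hx, hfst j y hy]
    exact hij

theorem labChain_eq_map (i : Fin n) : (⟨i, 0⟩ : Lab c) :: (labChain c i ++ [⟨finRotate n i, 0⟩]) =
    (List.range (c i + 2)).map (lab c i) := by
  rw [List.range_succ, List.map_append, List.map_singleton, lab_last, ← List.cons_append]
  congr 1
  refine List.ext_getElem (by simp [labChain]) fun t h1 h2 => ?_
  cases t with
  | zero => simp [lab_zero]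
  | succ t =>
    have ht : t < c i := by simpa [labChain] using h1
    simp only [labChain, List.getElem_cons_succ, List.getElem_map, List.getElem_finRange,
      List.getElem_range]
    rw [lab_of_lt (by omega)]
    rfl

theorem exists_lab_of_sublist {i : Fin n} {x y z : Lab c} (h : List.Sublist [x, y, z]
    ((⟨i, 0⟩ : Lab c) :: (labChain c i ++ [⟨finRotate n i, 0⟩]))) :
    ∃ s t u, s < t ∧ t < u ∧ u ≤ c i + 1 ∧ x = lab c i s ∧ y = lab c i t ∧ z = lab c i u := by
  rw [labChain_eq_map] at h
  obtain ⟨l, hl, e⟩ := List.sublist_map_iff.1 h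
  match l, e with
  | [s, t, u], e =>
    simp only [List.map_cons, List.map_nil, List.cons.injEq, and_true] at e
    have hp := (List.pairwise_lt_range (n := c i + 2)).sublist hl
    have hu : u ∈ List.range (c i + 2) := hl.subset (by simp)
    rw [List.mem_range] at hu
    simp only [List.pairwise_cons, List.mem_cons, List.not_mem_nil, or_false] at hp
    exact ⟨s, t, u, hp.1 t (Or.inl rfl), hp.2.1 u rfl, by omega, e⟩

/-- Sides of the triangles with labels in `F`, when the labels are placed at distinct points. -/
theorem sideGraph_map_adj {α : Type*} {p : α → Plane} (hp : Function.Injective p)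
    (F : List (α × α × α)) (x y : α) :
    (sideGraph (F.map fun t => (p t.1, p t.2.1, p t.2.2))).Adj (p x) (p y) ↔
      x ≠ y ∧ ∃ t ∈ F, (x = t.1 ∨ x = t.2.1 ∨ x = t.2.2) ∧ (y = t.1 ∨ y = t.2.1 ∨ y = t.2.2) := by
  simp only [sideGraph, Corner, List.mem_map, hp.eq_iff, ne_eq]
  constructor
  · rintro ⟨h, t, ⟨t, ht, rfl⟩, h1, h2⟩
    exact ⟨h, t, ht, by simpa [hp.eq_iff] using h1, by simpa [hp.eq_iff] using h2⟩
  · rintro ⟨h, t, ht, h1, h2⟩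
    exact ⟨h, _, ⟨t, ht, rfl⟩, by simpa [hp.eq_iff] using h1, by simpa [hp.eq_iff] using h2⟩

/-- A list of triangles with labels as corners that triangulates both a generalized double circle
and the points of a distribution, placed along suitable paths. -/
theorem exists_common_triangles {σ τ : ℝ} {P Q : Finset Plane} {p : Lab c → Plane}
    (hp : IsDoubleCircleSign τ P c p) {w : Fin n → Plane} {S : Fin n → Finset Plane}
    (hd : IsDistribution σ Q w S) (hS : ∀ i, (S i).card = c i) :
    ∃ q : Lab c → Plane, Function.Injective q ∧ (∀ x, q x ∈ Q) ∧ (∀ y ∈ Q, ∃ x, q x = y) ∧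
      (∀ i, q ⟨i, 0⟩ = w i) ∧ ∃ F : List (Lab c × Lab c × Lab c),
        (∀ x, ∃ t ∈ F, x = t.1 ∨ x = t.2.1 ∨ x = t.2.2) ∧
        IsFilling τ P (fun i => p ⟨i, 0⟩) (F.map fun t => (p t.1, p t.2.1, p t.2.2)) ∧
        IsFilling σ Q w (F.map fun t => (q t.1, q t.2.1, q t.2.2)) := by
  have hn := hd.hull.three_le
  obtain ⟨path, st, hpath⟩ := hd.exists_paths
  have hlen : ∀ i, (path i).length = c i := by
    intro i
    rw [← hS i, ← List.toFinset_card_of_nodup (st.nodup i)]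
    congr 1
    ext z
    rw [List.mem_toFinset, hpath]
  set q : Lab c → Plane := labPos c w fun i j => (path i)[j.val]'(by rw [hlen]; exact j.isLt) with hq
  have q0 : ∀ i, q ⟨i, 0⟩ = w i := fun i => labPos_zero i
  have qs : ∀ i (j : Fin (c i)), q ⟨i, j.succ⟩ = (path i)[j.val]'(by rw [hlen]; exact j.isLt) :=
    fun i j => labPos_succ i j
  have mapc : ∀ i, (labChain c i).map q = path i := by
    intro i
    refine List.ext_getElem (by simp [labChain, hlen]) fun t h1 h2 => ?_
    simp only [labChain, List.map_map, List.getElem_map, Function.comp, List.getElem_finRange]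
    exact qs i _
  have mapl : (loop (fun i => (⟨i, 0⟩ : Lab c)) (labChain c)).map q = loop w path := by
    simp only [loop, List.map_flatMap, List.map_cons, mapc, q0]
  have mapp : ∀ i, ((⟨i, 0⟩ : Lab c) :: (labChain c i ++ [⟨finRotate n i, 0⟩])).map q =
      w i :: (path i ++ [w (finRotate n i)]) := by
    intro i
    simp only [List.map_cons, List.map_append, List.map_nil, mapc, q0]
  have qinj : Function.Injective q := by
    have := hd.nodup_loop st.nodup st.subset
    rw [← mapl] at this
    exact fun x y hxy => List.inj_on_of_nodup_map this (mem_loop_labChain x) (mem_loop_labChain y) hxy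
  have qmem : ∀ x, q x ∈ Q := fun x => hd.mem_of_mem_loop st.subset (by
    rw [← mapl]; exact List.mem_map_of_mem (mem_loop_labChain x))
  have qcls : ∀ i x, InChain i x → Cls w S i (q x) := by
    rintro i ⟨j, s⟩ (hx | ⟨hx, h0⟩)
    · simp only at hx
      subst hx
      refine Fin.cases (Or.inl (q0 j)) (fun t => Or.inr (Or.inr ?_)) s
      rw [qs, ← hpath]
      exact List.getElem_mem _
    · simp only at hx h0
      subst hx
      have : s = 0 := Fin.ext h0
      rw [this, q0]
      exact Or.inr (Or.inl rfl)
  refine ⟨q, qinj, qmem, fun y hy => ?_, q0, ?_⟩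
  · have : y ∈ loop w path := by
      rcases hd.cover y hy with ⟨i, rfl⟩ | ⟨i, hi⟩
      · exact mem_loop.2 ⟨i, Or.inl rfl⟩
      · exact mem_loop.2 ⟨i, Or.inr ((hpath i y).2 hi)⟩
    rw [← mapl] at this
    obtain ⟨x, -, e⟩ := List.mem_map.1 this
    exact ⟨x, e⟩
  have hin := st.inner
  rw [← mapl] at hin
  have hin := hin.of_map.sublist.mono (R' := fun x y z => 0 < sar σ (q x) (q y) (q z) ∧
      0 < sar τ (p x) (p y) (p z)) fun x y z ⟨h1, h2⟩ => by
    refine ⟨h1.2.1, ?_⟩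
    have hlt := pairwise_labLt.sublist h2
    simp only [List.pairwise_cons, List.mem_cons, List.not_mem_nil, or_false] at hlt
    exact hp.triple_pos (hlt.1 y (Or.inl rfl)) (hlt.2.1 z rfl) fun ⟨i, hx, hy, hz⟩ =>
      h1.2.2 i ⟨qcls i x hx, qcls i y hy, qcls i z hz⟩
  obtain ⟨F, F1, F2, F3⟩ := hin.exists_list_loop (by omega)
  have hpock : ∀ i, ∃ G : List (Lab c × Lab c × Lab c),
      (∀ t ∈ G, 0 < sar σ (q t.1) (q t.2.1) (q t.2.2) ∧ 0 < sar τ (p t.1) (p t.2.1) (p t.2.2)) ∧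
      ∀ f : Lab c → Lab c → ℤ, (∀ x y, f y x = - f x y) → (G.map (triSum f)).sum =
        f ⟨i, 0⟩ ⟨finRotate n i, 0⟩ -
          pathSum f ((⟨i, 0⟩ : Lab c) :: (labChain c i ++ [⟨finRotate n i, 0⟩])) := by
    intro i
    have h1 := st.pocket i
    rw [← mapp] at h1
    have h2 := h1.of_map.sublist.mono (R' := fun x y z => 0 < sar σ (q z) (q y) (q x) ∧
      0 < sar τ (p z) (p y) (p x)) fun x y z ⟨h1, h2⟩ => by
        obtain ⟨s, t, u, hst, htu, hu, rfl, rfl, rfl⟩ := exists_lab_of_sublist h2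
        have h3 := hp.reflex i s t u hst htu hu
        refine ⟨?_, ?_⟩
        · rw [sar_rev]; linarith
        · rw [sar_rev]; linarith
    obtain ⟨G, G1, -, G3⟩ := h2.exists_list_reverse
    exact ⟨G, G1, G3⟩
  choose G G1 G3 using hpock
  refine ⟨F ++ (List.finRange n).flatMap G, fun x => ?_, ?_, ?_⟩
  · obtain ⟨a, b, d, h1, h2⟩ := F2.exists_mem_triangle (three_le_length_loop hn _ _)
      (mem_loop_labChain x)
    exact ⟨_, List.mem_append_left _ h1, h2⟩
  · exact IsHullCycle.isFilling p hp.hull hp.generic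
      (fun t ht => ⟨⟨hp.mem _, hp.mem _, hp.mem _⟩, (F1 t ht).2⟩)
      (fun i t ht => ⟨⟨hp.mem _, hp.mem _, hp.mem _⟩, (G1 i t ht).2⟩) F3 G3
  · have hw : w = fun i => q ⟨i, 0⟩ := by funext i; exact (q0 i).symm
    have hull := hd.hull
    rw [hw] at hull ⊢
    exact IsHullCycle.isFilling q hull hd.generic
      (fun t ht => ⟨⟨qmem _, qmem _, qmem _⟩, (F1 t ht).1⟩)
      (fun i t ht => ⟨⟨qmem _, qmem _, qmem _⟩, (G1 i t ht).1⟩) F3 G3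

end Labels

end PointSet

theorem mainTheorem1 (n : ℕ) (c : Fin n → ℕ) (P : Finset PointSet.Plane)
    (hP : PointSet.IsGeneralizedDoubleCircle c P) :
    PointSet.IsUniversal P := by
  open PointSet in
  obtain ⟨v, a, h⟩ := hP
  intro Q hQ hcard f₀ hf₀
  obtain ⟨τ, hτ⟩ := h.exists_isDoubleCircleSign
  have hv : ∀ i, v i ∈ hullVertices P := fun i => by rw [h.hull]; exact ⟨i, rfl⟩
  have hvinj : Function.Injective v := fun i j hij => by
    have : labPos c v a ⟨i, 0⟩ = labPos c v a ⟨j, 0⟩ := hij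
    exact congrArg Sigma.fst (hτ.injective this)
  set w : Fin n → Plane := fun i => (f₀ ⟨v i, hv i⟩ : Plane) with hw
  have hwinj : Function.Injective w := fun i j hij =>
    hvinj (congrArg Subtype.val (f₀.injective (Subtype.ext hij)))
  obtain ⟨σ, hσ⟩ := exists_isHullCycle hQ.generic h.three_le hwinj fun i =>
    (hf₀ ⟨v i, hv i⟩ ⟨v (finRotate n i), hv _⟩).1 (h.hullEdge i)
  obtain ⟨S, hd, hS⟩ := hσ.exists_isDistribution hQ.generic c (by rw [← hcard, h.card_eq])
  obtain ⟨q, qinj, qmem, qsurj, q0, F, hcov, hFP, hFQ⟩ := exists_common_triangles hτ hd hS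
  have psurj : ∀ y ∈ P, ∃ x, labPos c v a x = y := fun y hy => by
    have : y ∈ Set.range (labPos c v a) := by rw [h.range_labPos]; exact hy
    exact this
  have covers : ∀ {R : Finset Plane} {r : Lab c → Plane}, (∀ y ∈ R, ∃ x, r x = y) →
      ∀ y ∈ R, ∃ t ∈ F.map fun t => (r t.1, r t.2.1, r t.2.2), Corner y t := by
    intro R r hr y hy
    obtain ⟨x, rfl⟩ := hr y hy
    obtain ⟨t, ht, hx⟩ := hcov x
    refine ⟨_, List.mem_map_of_mem ht, ?_⟩
    rcases hx with rfl | rfl | rfl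
    · exact Or.inl rfl
    · exact Or.inr (Or.inl rfl)
    · exact Or.inr (Or.inr rfl)
  let eP : Lab c ≃ P := Equiv.ofBijective (fun x => ⟨labPos c v a x, hτ.mem x⟩)
    ⟨fun x y hxy => hτ.injective (congrArg Subtype.val hxy), fun y => by
      obtain ⟨x, hx⟩ := psurj y y.2
      exact ⟨x, Subtype.ext hx⟩⟩
  let eQ : Lab c ≃ Q := Equiv.ofBijective (fun x => ⟨q x, qmem x⟩)
    ⟨fun x y hxy => qinj (congrArg Subtype.val hxy), fun y => by
      obtain ⟨x, hx⟩ := qsurj y y.2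
      exact ⟨x, Subtype.ext hx⟩⟩
  refine ⟨eP.symm.trans eQ, fun p hp => ?_, _, _, hFP.isTriangulation (covers psurj),
    hFQ.isTriangulation (covers qsurj), fun p₁ p₂ => ?_⟩
  · have hp' := hp
    rw [h.hull] at hp'
    obtain ⟨i, hi⟩ := hp'
    have e : eP ⟨i, 0⟩ = p := Subtype.ext hi
    have e' : ((eP.symm.trans eQ) p : Plane) = w i := by
      rw [← e, Equiv.trans_apply, Equiv.symm_apply_apply]
      exact q0 i
    rw [e', hw]
    simp only [hi]
  · obtain ⟨x, rfl⟩ := eP.surjective p₁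
    obtain ⟨y, rfl⟩ := eP.surjective p₂
    rw [Equiv.trans_apply, Equiv.trans_apply, Equiv.symm_apply_apply, Equiv.symm_apply_apply]
    exact (sideGraph_map_adj hτ.injective F x y).trans (sideGraph_map_adj qinj F x y).symm
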